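/- Let $k$ be a field of characteristic zero, $V$ a $k$-vector space with basis $x_1,\dots,x_n$ and dual basis $x_1^*,\dots,x_n^*$ of $V^*$, and let $R\subseteq V\otimes V$ be a subspace such that $A=T(V)/(R)$ is Koszul (the trivial right module $k_A$ has a graded free resolution of the form $\cdots\to A(-2)^{b_2}\to A(-1)^{b_1}\to A\to k\to 0$ with all $b_i$ finite) and AS-Gorenstein of global dimension $d$ (that is, $A$ has global dimension $d<\infty$, $\mathrm{Ext}^i_A(k_A,A)=0$ for $i\ne d$ and $\mathrm{Ext}^d_A(k_A,A)\cong k$). Let $\nu:R\to V$ and $\theta:R\to k$ be linear maps such that $U=T(V)/(r-\nu(r)-\theta(r):r\in R)$, filtered by the images of the tensors of degree at most $i$, is a PBW-deformation of $A$, i.e. the canonical surjection $A\to \mathrm{gr}(U)$ is an isomorphism. Let $A^!=T(V^*)/(R^\perp)$ be the quadratic dual, where $V^*\otimes V^*$ is paired with $V\otimes V$ by $(f\otimes g)(v\otimes w)=f(v)g(w)$, so that $A^!_1=V^*$ and $A^!_2=R^*$. Then the following hold. 1. There is a unique curved differential graded algebra $(A^!,\delta,\theta)$ dual to $U$: there is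 a unique linear map $\delta:A^!\to A^!$ of degree one with $\delta(\alpha\beta)=\delta(\alpha)\beta+(-1)^{i}\alpha\,\delta(\beta)$ for $\alpha\in A^!_i$ whose restriction $V^*=A^!_1\to A^!_2=R^*$ is the transpose $\nu^*$; moreover, with $\theta$ regarded as an element of $A^!_2=R^*$, one has $\delta^2(\alpha)=\alpha\theta-\theta\alpha$ for all $\alpha$, and $\delta(\theta)=0$. 2. $A^!$ is graded Frobenius of length $d$ and has a unique Nakayama automorphism $\phi$, that is, a graded algebra automorphism for which there is an isomorphism ${}_1A^!_\phi\cong (A^!)^*(-d)$ of graded $A^!$-bimodules. Hence $\phi(x_1^*,\dots,x_n^*)=(x_1^*,\dots,x_n^*)P$ for a unique $n\times n$ matrix $P$ over $k$, and $P$ is invertible. Moreover $\dim A^!_d=1$; for every basis $\varpi$ of $A^!_d$ there is a unique basis $w_1,\dots,w_n$ of $A^!_{d-1}$ with $x_i^*w_j=\delta_{ij}\varpi$ (where $A^!_{-1}=0$), and $\delta(w_j)=\lambda_j\varpi$ for unique scalars $\lambda_j\in k$. 3. Let $U^e=U\otimes U^{op}$. Then $\mathrm{Ext}^i_{U^e}(U,U\otimes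 U)=0$ for all $i\neq d$. 4. For every such choice of $\varpi$, there is an algebra automorphism $\xi$ of $U$ given on the generators by $$\xi(x_j)=(-1)^{d+1}\sum_{i=1}^n (P^{-1})_{ji}\,x_i+\lambda_j\qquad(1\le j\le n),$$ that is, $(\xi(x_1),\dots,\xi(x_n))=(-1)^{d+1}(x_1,\dots,x_n)(P^{-1})^t+(\lambda_1,\dots,\lambda_n)$, and $$\mathrm{Ext}^d_{U^e}(U,U\otimes U)\cong {}_1U_\xi$$ as $U$-bimodules. Here $\mathrm{Ext}_{U^e}(U,U\otimes U)$ is formed with the outer bimodule structure $a(p\otimes q)b=ap\otimes qb$ of $U\otimes U$ and is a $U$-bimodule through the inner one, $a\cdot(p\otimes q)\cdot b=pb\otimes aq$; and ${}_1U_\xi$ is $U$ with $a\cdot y\cdot b=ay\,\xi(b)$. -/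

import Mathlib

open scoped TensorProduct
open CategoryTheory

universe u

noncomputable section

namespace KoszulDeformation

section Quadratic

variable {k : Type u} [Field k] {V : Type u} [AddCommGroup V] [Module k V]

/-- The canonical map `V ⊗ V → T(V)`, `v ⊗ w ↦ v w`, onto the degree two part. -/
def tensorTwo (k V : Type u) [Field k] [AddCommGroup V] [Module k V] :
    V ⊗[k] V →ₗ[k] TensorAlgebra k V :=
  LinearMap.mul' k (TensorAlgebra k V) ∘ₗ
    TensorProduct.map (TensorAlgebra.ι k) (TensorAlgebra.ι k)

/-- The relations `r = 0`, for `r ∈ R ⊆ V ⊗ V`. -/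
inductive QuadRel (R : Submodule k (V ⊗[k] V)) : TensorAlgebra k V → TensorAlgebra k V → Prop
  | of (r : V ⊗[k] V) (hr : r ∈ R) : QuadRel R (tensorTwo k V r) 0

/-- The quadratic algebra `T(V)/(R)`. -/
abbrev QuadAlg (R : Submodule k (V ⊗[k] V)) : Type u := RingQuot (QuadRel R)

/-- The quotient map `T(V) → T(V)/(R)`. -/
def QuadAlg.mk (R : Submodule k (V ⊗[k] V)) : TensorAlgebra k V →ₐ[k] QuadAlg R :=
  RingQuot.mkAlgHom k (QuadRel R)

/-- The canonical map `V → T(V)/(R)`. -/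
def QuadAlg.gen (R : Submodule k (V ⊗[k] V)) : V →ₗ[k] QuadAlg R :=
  (QuadAlg.mk R).toLinearMap ∘ₗ TensorAlgebra.ι k

/-- The homogeneous component of degree `i` of `T(V)/(R)`: the span of the products of `i`
generators. -/
def QuadAlg.piece (R : Submodule k (V ⊗[k] V)) (i : ℕ) : Submodule k (QuadAlg R) :=
  LinearMap.range (QuadAlg.gen R) ^ i

/-- The augmentation `T(V)/(R) → k`, killing the generators. -/
def QuadAlg.aug (R : Submodule k (V ⊗[k] V)) : QuadAlg R →ₐ[k] k :=
  RingQuot.liftAlgHom k ⟨TensorAlgebra.lift k (0 : V →ₗ[k] k), by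
    rintro _ _ ⟨r, -⟩
    induction r using TensorProduct.induction_on with
    | zero => simp
    | tmul v w => simp [tensorTwo]
    | add a b ha hb => simp_all⟩

/-- The trivial right module `k` over `A = T(V)/(R)`; right `A`-modules are
`Aᵐᵒᵖ`-modules. -/
def trivialModule (R : Submodule k (V ⊗[k] V)) : ModuleCat.{u} (QuadAlg R)ᵐᵒᵖ :=
  (ModuleCat.restrictScalars
    ((QuadAlg.aug R).fromOpposite fun _ _ => Commute.all _ _).toRingHom).obj (ModuleCat.of k k)

/-- `A = T(V)/(R)` is a Koszul algebra: the trivial right module `k` has a linear (hence minimal)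
graded free resolution by modules of finite rank
`⋯ → A(-2)^{b 2} → A(-1)^{b 1} → A → k → 0`.
Elements of the right module `A^b` are column vectors, and the differential
`A(-i-1)^{b (i+1)} → A(-i)^{b i}` is left multiplication by a matrix with entries in `A_1`. -/
def IsKoszul (R : Submodule k (V ⊗[k] V)) : Prop :=
  ∃ (b : ℕ → ℕ) (M : ∀ i, Matrix (Fin (b i)) (Fin (b (i + 1))) (QuadAlg R)),
    b 0 = 1 ∧
    (∀ i p q, M i p q ∈ QuadAlg.piece R 1) ∧
    (∀ v : Fin (b 0) → QuadAlg R,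
      (∀ p, QuadAlg.aug R (v p) = 0) ↔ ∃ w, (M 0).mulVec w = v) ∧
    (∀ i, ∀ v : Fin (b (i + 1)) → QuadAlg R,
      (M i).mulVec v = 0 ↔ ∃ w, (M (i + 1)).mulVec w = v)

/-- `B` has (right) global dimension `d`: every right module has projective dimension at most `d`,
and some right module has projective dimension exactly `d`. -/
def HasGlobalDimension (B : Type u) [Ring B] (d : ℕ) : Prop :=
  (∀ M : ModuleCat.{u} Bᵐᵒᵖ, HasProjectiveDimensionLE M d) ∧
    ∃ M : ModuleCat.{u} Bᵐᵒᵖ, ¬ HasProjectiveDimensionLT M d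

/-- `A = T(V)/(R)` is AS-Gorenstein of global dimension `d`. -/
structure IsASGorenstein (R : Submodule k (V ⊗[k] V)) (d : ℕ) : Prop where
  globalDimension : HasGlobalDimension (QuadAlg R) d
  ext_eq_zero : ∀ i, i ≠ d →
    Subsingleton (Abelian.Ext (trivialModule R)
      (ModuleCat.of (QuadAlg R)ᵐᵒᵖ (QuadAlg R)) i)
  ext_top : Nonempty (Abelian.Ext (trivialModule R)
      (ModuleCat.of (QuadAlg R)ᵐᵒᵖ (QuadAlg R)) d ≃ₗ[k] k)

end Quadratic

section Deformation

variable {k : Type u} [Field k] {V : Type u} [AddCommGroup V] [Module k V]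
  {R : Submodule k (V ⊗[k] V)}

/-- The relations `r = ν(r) + θ(r)`, for `r ∈ R`. -/
inductive DefRel (ν : R →ₗ[k] V) (θ : R →ₗ[k] k) :
    TensorAlgebra k V → TensorAlgebra k V → Prop
  | of (r : R) : DefRel ν θ (tensorTwo k V (r : V ⊗[k] V))
      (TensorAlgebra.ι k (ν r) + algebraMap k (TensorAlgebra k V) (θ r))

/-- The algebra `U = T(V)/(r - ν(r) - θ(r) : r ∈ R)`. -/
abbrev DefAlg (ν : R →ₗ[k] V) (θ : R →ₗ[k] k) : Type u := RingQuot (DefRel ν θ)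

/-- The quotient map `T(V) → U`. -/
def DefAlg.mk (ν : R →ₗ[k] V) (θ : R →ₗ[k] k) : TensorAlgebra k V →ₐ[k] DefAlg ν θ :=
  RingQuot.mkAlgHom k (DefRel ν θ)

/-- The canonical map `V → U`. -/
def DefAlg.gen (ν : R →ₗ[k] V) (θ : R →ₗ[k] k) : V →ₗ[k] DefAlg ν θ :=
  (DefAlg.mk ν θ).toLinearMap ∘ₗ TensorAlgebra.ι k

/-- `DefAlg.filtrationBelow ν θ n` is `F_{n-1} U`, where `F_n U` is the image in `U` of the
tensors of degree at most `n`, that is `(k + V)^n`, and `F_{-1} U = 0`. -/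
def DefAlg.filtrationBelow (ν : R →ₗ[k] V) (θ : R →ₗ[k] k) : ℕ → Submodule k (DefAlg ν θ)
  | 0 => ⊥
  | n + 1 => (1 ⊔ LinearMap.range (DefAlg.gen ν θ)) ^ n

/-- `U` is a PBW-deformation of `A = T(V)/(R)`: the canonical surjection of graded algebras
`A → gr U`, whose component `A_n → F_n U / F_{n-1} U` sends the class of a tensor `t` of degree
`n` to the class of the image of `t` in `U`, is injective, hence an isomorphism. -/
def IsPBWDeformation (ν : R →ₗ[k] V) (θ : R →ₗ[k] k) : Prop :=
  ∀ n : ℕ, ∀ t ∈ LinearMap.range (TensorAlgebra.ι k (M := V)) ^ n,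
    DefAlg.mk ν θ t ∈ DefAlg.filtrationBelow ν θ n → QuadAlg.mk R t = 0

end Deformation

section Dual

variable {k : Type u} [Field k] {V : Type u} [AddCommGroup V] [Module k V]

/-- The orthogonal complement `R^⊥ ⊆ V^* ⊗ V^*`, for the pairing
`(f ⊗ g)(v ⊗ w) = f(v) g(w)`. -/
def orth (R : Submodule k (V ⊗[k] V)) :
    Submodule k (Module.Dual k V ⊗[k] Module.Dual k V) :=
  R.dualAnnihilator.comap (TensorProduct.dualDistrib k V V)

/-- The quadratic dual `A^! = T(V^*)/(R^⊥)` of `A = T(V)/(R)`. -/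
abbrev DualAlg (R : Submodule k (V ⊗[k] V)) : Type u := QuadAlg (orth R)

/-- The canonical map `V^* → A^!`. -/
abbrev DualAlg.gen (R : Submodule k (V ⊗[k] V)) : Module.Dual k V →ₗ[k] DualAlg R :=
  QuadAlg.gen (orth R)

/-- The component `A^!_i`. -/
abbrev DualAlg.piece (R : Submodule k (V ⊗[k] V)) (i : ℕ) : Submodule k (DualAlg R) :=
  QuadAlg.piece (orth R) i

/-- Under the identification `A^!_2 = (V^* ⊗ V^*)/R^⊥ = R^*`, the element `a ∈ A^!_2` is the
functional `g ∈ R^*`. -/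
def Represents (R : Submodule k (V ⊗[k] V)) (a : DualAlg R) (g : R →ₗ[k] k) : Prop :=
  ∃ t : Module.Dual k V ⊗[k] Module.Dual k V,
    a = QuadAlg.mk (orth R) (tensorTwo k (Module.Dual k V) t) ∧
      ∀ r : R, TensorProduct.dualDistrib k V V t (r : V ⊗[k] V) = g r

/-- `(A^!, δ, c)` is the curved differential graded algebra dual to
`U = T(V)/(r - ν(r) - θ(r) : r ∈ R)`: `δ` is a graded derivation of degree one whose restriction
`V^* = A^!_1 → A^!_2 = R^*` is the transpose of `ν`, and `c` is `θ`, seen in `A^!_2 = R^*`. -/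
structure IsDualCurvedDGA {R : Submodule k (V ⊗[k] V)} (ν : R →ₗ[k] V) (θ : R →ₗ[k] k)
    (δ : DualAlg R →ₗ[k] DualAlg R) (c : DualAlg R) : Prop where
  degree : ∀ i, ∀ a ∈ DualAlg.piece R i, δ a ∈ DualAlg.piece R (i + 1)
  leibniz : ∀ i, ∀ a ∈ DualAlg.piece R i, ∀ b, δ (a * b) = δ a * b + (-1) ^ i * (a * δ b)
  restrict : ∀ f : Module.Dual k V, Represents R (δ (DualAlg.gen R f)) (f ∘ₗ ν)
  curvature : Represents R c θ
  sq : ∀ a, δ (δ a) = a * c - c * a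
  closed : δ c = 0

/-- `φ` is the Nakayama automorphism of the graded Frobenius algebra `A^!` of length `d`: it is a
graded automorphism, and there is an isomorphism `Θ : ₁(A^!)_φ → (A^!)^*(-d)` of graded
`A^!`-bimodules. Here `(a f)(y) = f (y a)` and `(f a)(y) = f (a y)` for `f ∈ (A^!)^*`. -/
def IsNakayamaAut (R : Submodule k (V ⊗[k] V)) (d : ℕ) (φ : DualAlg R ≃ₐ[k] DualAlg R) : Prop :=
  (∀ i, ∀ a ∈ DualAlg.piece R i, φ a ∈ DualAlg.piece R i) ∧
  ∃ Θ : DualAlg R ≃ₗ[k] Module.Dual k (DualAlg R),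
    (∀ a b y, Θ (a * b) y = Θ b (y * a)) ∧
    (∀ a b y, Θ (a * φ b) y = Θ a (b * y)) ∧
    (∀ i j, i + j ≠ d → ∀ a ∈ DualAlg.piece R i, ∀ y ∈ DualAlg.piece R j, Θ a y = 0)

/-- `φ` is given on the generators by
`φ(x_1^*, …, x_n^*) = (x_1^*, …, x_n^*) P`. -/
def HasMatrix (R : Submodule k (V ⊗[k] V)) {n : ℕ} (x : Module.Basis (Fin n) k V)
    (φ : DualAlg R ≃ₐ[k] DualAlg R) (P : Matrix (Fin n) (Fin n) k) : Prop :=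
  ∀ j, φ (DualAlg.gen R (x.coord j)) = ∑ i, P i j • DualAlg.gen R (x.coord i)

/-- `w_1, …, w_n` is the basis of `A^!_{d-1}` with `x_i^* w_j = δ_{ij} ϖ`
(if `d = 0`, then `A^!_{d-1} = 0`). -/
structure IsDualBasisTo (R : Submodule k (V ⊗[k] V)) {n : ℕ} (x : Module.Basis (Fin n) k V)
    (d : ℕ) (ϖ : DualAlg R) (w : Fin n → DualAlg R) : Prop where
  linearIndependent : LinearIndependent k w
  span_eq : Submodule.span k (Set.range w) = if d = 0 then ⊥ else DualAlg.piece R (d - 1)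
  mul_eq : ∀ i j, DualAlg.gen R (x.coord i) * w j = if i = j then ϖ else 0

end Dual

section Bimodule

variable (k : Type u) [Field k] (B : Type u) [Ring B] [Algebra k B]

/-- The enveloping algebra `B^e = B ⊗ B^op`; its left modules are the `B`-bimodules. -/
abbrev Env : Type u := B ⊗[k] Bᵐᵒᵖ

/-- `B` as a `B`-bimodule, `(a ⊗ b) y = a y b`. -/
def regularBimodule : ModuleCat.{u} (Env k B) :=
  letI : Module (Env k B) B := TensorProduct.Algebra.module
  ModuleCat.of (Env k B) B

/-- `B ⊗ B` with the outer bimodule structure `a (p ⊗ q) b = a p ⊗ q b`; this is `B^e` as a left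
module over itself. -/
def outerBimodule : ModuleCat.{u} (Env k B) := ModuleCat.of (Env k B) (Env k B)

/-- The inner action of `a` (from the left) and `b` (from the right) on `B ⊗ B`, namely
`p ⊗ q ↦ p b ⊗ a q`; this is right multiplication by `b ⊗ a` in `B^e`. -/
def innerAction (a b : B) : outerBimodule k B ⟶ outerBimodule k B :=
  ModuleCat.ofHom (LinearMap.toSpanSingleton (Env k B) (Env k B) (b ⊗ₜ[k] MulOpposite.op a))

/-- `Ext^i_{B^e}(B, B ⊗ B)`. -/
abbrev ExtEnv (i : ℕ) : Type u := Abelian.Ext (regularBimodule k B) (outerBimodule k B) i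

/-- The `B`-bimodule structure `e ↦ a e b` of `Ext^i_{B^e}(B, B ⊗ B)`, induced by the inner
bimodule structure of `B ⊗ B`. -/
def ExtEnv.act {i : ℕ} (a b : B) (e : ExtEnv k B i) : ExtEnv k B i :=
  e.comp (Abelian.Ext.mk₀ (innerAction k B a b)) (add_zero i)

/-- `Ext^i_{B^e}(B, B ⊗ B) ≅ ₁B_ξ` as `B`-bimodules, where `₁B_ξ` is `B` with the actions
`a · y · b = a y ξ(b)`. -/
def ExtEnvIsoTwist (i : ℕ) (ξ : B ≃ₐ[k] B) : Prop :=
  ∃ Ψ : ExtEnv k B i ≃+ B, ∀ a b e, Ψ (ExtEnv.act k B a b e) = a * Ψ e * ξ b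

end Bimodule

end KoszulDeformation

end

/-!
Write `A = T(V)/(R)`, and let `U` be the PBW-deformation given by `ν` and `θ`. Everything is read
off from one free resolution of `U` as a bimodule, the Koszul bimodule complex, whose terms are
`U^e ⊗ (A^!_i)^*`.

The matrices of the linear resolution of `k_A` determine bases `e i` of the components of `A^!`,
in which right multiplication by generators is given by these matrices (`KoszulData.e_mul_gen`,
`KoszulData.coord_e`). By the Gorenstein condition, `A^!_d` is one-dimensional and no element of
lower degree is annihilated by all generators. Hence the coefficient `τ` of a basis `ϖ` of `A^!_d`
is a Frobenius form (`KoszulData.exists_frobeniusTrace`), and the Nakayama automorphism `φ` of `A^!`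
is characterized by `τ(y φ(b)) = τ(b y)`.

For a linear map `f : V → B` to an algebra, put `X = ∑ f(xᵢ) ⊗ xᵢ*` in `B ⊗ A^!`. Then `f` extends
to `U` if and only if `X² = ∑ f(xᵢ) ⊗ ν^*(xᵢ*) + 1 ⊗ θ` (`maurerCartan_iff`). For `B = U`, computing
`X³` in two ways and using the PBW property in degrees at most two, `ν^*` extends to a derivation
`δ` with the properties of a curved differential graded algebra
(`IsPBWDeformation.exists_isDualCurvedDGA`). The functional `τ ∘ δ` is represented by the element
`λ = ∑ λⱼ xⱼ*`; comparing `τ` of `δ(yg)` and of `δ(φ⁻¹(g) y)`, one finds how `φ⁻¹` transforms `δ`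
and `θ`, and this shows that the formula for `ξ` satisfies the Maurer–Cartan equation
(`maurerCartan_nakayamaGen`). As `ξ` maps `k + V` onto itself, it is an automorphism.

Left multiplication by the canonical element of the left copy of `U`, signed right multiplication by
that of the right copy, and `δ` together give an operator of square zero on `U^e ⊗ A^!`
(`diffOp_sq`), because the two curvature terms cancel against `δ²`. Its matrices are the
differentials of the Koszul bimodule complex. With `U^op` filtered, the leading part of the
differential is given by the matrices of the linear resolution, acting on the right factor only, so
exactness of the complex follows from exactness of that resolution
(`KoszulData.exists_vecMul_diff_eq`). In the same way, vanishing of `Ext^i_A(k, A)` for `i ≠ d`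
implies that the dual complex is exact outside degree `d` (`KoszulData.exists_mulVec_diff_eq`).
This gives the vanishing of `Ext^i_{U^e}(U, U^e)`. In degree `d`, where `A^!_d` has dimension one,
this group is the quotient of `U^e` by the right ideal generated by the entries of the last
differential. Evaluated at the dual basis `wⱼ`, these are `xⱼ ⊗ 1 - 1 ⊗ ξ(xⱼ)`
(`traceDiff_dualBasis`), and the quotient is `U`, with the right action twisted by `ξ`
(`KoszulData.twistAug_eq_zero_iff`, `KoszulData.extEnvIsoTwist`).
-/

noncomputable section

namespace KoszulDeformation

/-! ### Resolutions by free modules and `Ext` -/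

section Resolutions

/-- A resolution of the `S`-module `M` by free modules of finite rank, given by matrices: elements
of `S ^ b i` are row vectors and `D i` acts by right multiplication `v ↦ v ᵥ* D i`, from
`S ^ b (i + 1)` to `S ^ b i`. -/
structure FreeResolution (S : Type u) [Ring S] (M : Type u) [AddCommGroup M] [Module S M] where
  /-- The ranks. -/
  b : ℕ → ℕ
  /-- The matrices of the differentials. -/
  D : ∀ i, Matrix (Fin (b (i + 1))) (Fin (b i)) S
  /-- The augmentation. -/
  ε : (Fin (b 0) → S) →ₗ[S] M
  surj : Function.Surjective ε
  exact_zero : ∀ v, ε v = 0 ↔ ∃ w, Matrix.vecMul w (D 0) = v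
  exact_succ : ∀ i v, Matrix.vecMul v (D i) = 0 ↔ ∃ w, Matrix.vecMul w (D (i + 1)) = v

variable {S : Type u} [Ring S] {M : Type u} [AddCommGroup M] [Module S M]

namespace FreeResolution

variable (F : FreeResolution S M)

/-- The differential `S ^ b (i + 1) → S ^ b i`. -/
def diff (i : ℕ) : (Fin (F.b (i + 1)) → S) →ₗ[S] (Fin (F.b i) → S) where
  toFun v := Matrix.vecMul v (F.D i)
  map_add' _ _ := Matrix.add_vecMul _ _ _
  map_smul' _ _ := Matrix.smul_vecMul _ _ _

lemma diff_apply (i : ℕ) (v) : F.diff i v = Matrix.vecMul v (F.D i) := rfl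

/-- The chain complex of free modules. -/
def complex : ChainComplex (ModuleCat.{u} S) ℕ :=
  ChainComplex.of (fun i => ModuleCat.of S (Fin (F.b i) → S)) (fun i => ModuleCat.ofHom (F.diff i))
    (fun i => by
      ext1
      refine LinearMap.ext fun v => ?_
      exact (F.exact_succ i _).2 ⟨v, rfl⟩)

lemma complex_d (i : ℕ) : F.complex.d (i + 1) i = ModuleCat.ofHom (F.diff i) :=
  ChainComplex.of_d (fun i => ModuleCat.of S (Fin (F.b i) → S))
    (fun i => ModuleCat.ofHom (F.diff i)) i

lemma complex_exactAt (i : ℕ) : F.complex.ExactAt (i + 1) := by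
  rw [HomologicalComplex.exactAt_iff' _ (i + 1 + 1) (i + 1) i (by simp) (by simp)]
  rw [ShortComplex.moduleCat_exact_iff]
  intro v hv
  change F.complex.d (i + 1) i v = 0 at hv
  rw [complex_d] at hv
  obtain ⟨w, hw⟩ := (F.exact_succ i v).1 hv
  refine ⟨w, ?_⟩
  change F.complex.d (i + 1 + 1) (i + 1) w = v
  rw [complex_d]
  exact hw

/-- The augmentation, as a morphism in the category of `S`-modules. -/
def augHom : F.complex.X 0 ⟶ ModuleCat.of S M := ModuleCat.ofHom F.ε

lemma d_comp_augHom : F.complex.d 1 0 ≫ F.augHom = 0 := by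
  rw [complex_d]
  ext1
  refine LinearMap.ext fun v => ?_
  exact (F.exact_zero _).2 ⟨v, rfl⟩

lemma exact_augHom : (ShortComplex.mk _ _ F.d_comp_augHom).Exact := by
  rw [ShortComplex.moduleCat_exact_iff]
  intro v hv
  obtain ⟨w, hw⟩ := (F.exact_zero v).1 hv
  refine ⟨w, ?_⟩
  change F.complex.d (0 + 1) 0 w = v
  rw [complex_d]
  exact hw

instance : Epi F.augHom := (ModuleCat.epi_iff_surjective _).2 F.surj

/-- The projective resolution of `M` in the category of `S`-modules. -/
def toProjectiveResolution : ProjectiveResolution (ModuleCat.of S M) where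
  complex := F.complex
  projective i := by
    change Projective (ModuleCat.of S (Fin (F.b i) → S))
    infer_instance
  π := (ChainComplex.toSingle₀Equiv _ _).symm ⟨F.augHom, F.d_comp_augHom⟩
  quasiIso := ⟨fun i => by
    cases i with
    | zero =>
      rw [ChainComplex.quasiIsoAt₀_iff, ShortComplex.quasiIso_iff_of_zeros']
      · refine (ShortComplex.exact_and_epi_g_iff_of_iso ?_).2
          ⟨F.exact_augHom, inferInstanceAs (Epi F.augHom)⟩
        exact ShortComplex.isoMk (Iso.refl _) (Iso.refl _) (Iso.refl _)
          ((Category.id_comp _).trans (Category.comp_id _).symm)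
          ((Category.id_comp _).trans (Category.comp_id _).symm)
      all_goals rfl
    | succ i =>
      rw [quasiIsoAt_iff_exactAt']
      · exact F.complex_exactAt i
      · exact ChainComplex.exactAt_succ_single_obj _ _⟩

end FreeResolution

/-- The action of a matrix over `S` on columns with entries in a left `S`-module. -/
def colMul {N : Type u} [AddCommGroup N] [Module S N] {p q : ℕ}
    (D : Matrix (Fin q) (Fin p) S) : (Fin p → N) →+ (Fin q → N) where
  toFun y := fun i => ∑ j, D i j • y j
  map_zero' := by ext; simp
  map_add' y z := by ext; simp [Finset.sum_add_distrib]

namespace FreeResolution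

variable (F : FreeResolution S M) {N : Type u} [AddCommGroup N] [Module S N]

lemma linearCombination_comp_diff (i : ℕ) (y : Fin (F.b i) → N) :
    Fintype.linearCombination S y ∘ₗ F.diff i =
      Fintype.linearCombination S (colMul (F.D i) y) := by
  refine LinearMap.ext fun v => ?_
  simp only [LinearMap.comp_apply, Fintype.linearCombination_apply, diff_apply, colMul,
    AddMonoidHom.coe_mk, ZeroHom.coe_mk, Matrix.vecMul, dotProduct, Finset.sum_smul,
    Finset.smul_sum, mul_smul]
  exact Finset.sum_comm

lemma linearCombination_injective {b : ℕ} {y z : Fin b → N}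
    (h : Fintype.linearCombination S y = Fintype.linearCombination S z) : y = z := by
  ext p
  simpa [Fintype.linearCombination_apply_single] using
    LinearMap.congr_fun h (Pi.single p (1 : S))

lemma exists_linearCombination {b : ℕ} (f : (Fin b → S) →ₗ[S] N) :
    ∃ y : Fin b → N, Fintype.linearCombination S y = f :=
  ⟨fun p => f (Pi.single p 1), by
    refine LinearMap.pi_ext' fun p => LinearMap.ext_ring ?_
    simp⟩

/-- The morphism from the `i`-th term of the resolution given by a column. -/
def colHom (i : ℕ) (y : Fin (F.b i) → N) :
    F.toProjectiveResolution.complex.X i ⟶ ModuleCat.of S N :=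
  ModuleCat.ofHom (X := Fin (F.b i) → S) (Fintype.linearCombination S y)

lemma d_comp_colHom (i : ℕ) (y : Fin (F.b i) → N) :
    F.toProjectiveResolution.complex.d (i + 1) i ≫ F.colHom i y =
      F.colHom (i + 1) (colMul (F.D i) y) := by
  change F.complex.d (i + 1) i ≫ _ = _
  rw [complex_d]
  ext1
  exact F.linearCombination_comp_diff i y

lemma colHom_injective {i : ℕ} {y z : Fin (F.b i) → N} (h : F.colHom i y = F.colHom i z) :
    y = z :=
  linearCombination_injective (congrArg ModuleCat.Hom.hom h)

lemma colHom_surjective (i : ℕ)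
    (f : F.toProjectiveResolution.complex.X i ⟶ ModuleCat.of S N) : ∃ y, F.colHom i y = f := by
  obtain ⟨y, hy⟩ := exists_linearCombination (b := F.b i) (N := N) (ModuleCat.Hom.hom f)
  exact ⟨y, by ext1; exact hy⟩

lemma colHom_zero (i : ℕ) : F.colHom i (0 : Fin (F.b i) → N) = 0 := by
  ext1
  refine LinearMap.ext fun (v : Fin (F.b i) → S) => ?_
  change Fintype.linearCombination S _ v = 0
  simp [Fintype.linearCombination_apply]

lemma d_comp_colHom_of_eq_zero {i : ℕ} {y : Fin (F.b i) → N} (h : colMul (F.D i) y = 0) :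
    F.toProjectiveResolution.complex.d (i + 1) i ≫ F.colHom i y = 0 := by
  rw [d_comp_colHom, h, colHom_zero]

/-- The class in `Ext^i(M, N)` of a cocycle, a column with entries in `N`. -/
def extOf (i : ℕ) (y : Fin (F.b i) → N) (h : colMul (F.D i) y = 0) :
    Abelian.Ext (ModuleCat.of S M) (ModuleCat.of S N) i :=
  F.toProjectiveResolution.extMk (F.colHom i y) (i + 1) rfl (F.d_comp_colHom_of_eq_zero h)

lemma extOf_surjective (i : ℕ) (α : Abelian.Ext (ModuleCat.of S M) (ModuleCat.of S N) i) :
    ∃ y h, F.extOf i y h = α := by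
  obtain ⟨f, hf, rfl⟩ := F.toProjectiveResolution.extMk_surjective α (i + 1) rfl
  obtain ⟨y, rfl⟩ := F.colHom_surjective i f
  refine ⟨y, ?_, rfl⟩
  rw [d_comp_colHom, ← F.colHom_zero] at hf
  exact F.colHom_injective hf

lemma extOf_add (i : ℕ) (y z : Fin (F.b i) → N) (hy : colMul (F.D i) y = 0)
    (hz : colMul (F.D i) z = 0) :
    F.extOf i (y + z) (by rw [map_add, hy, hz, add_zero]) = F.extOf i y hy + F.extOf i z hz := by
  rw [extOf, extOf, extOf, ProjectiveResolution.add_extMk]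
  congr 1
  ext1
  refine LinearMap.ext fun (v : Fin (F.b i) → S) => ?_
  change Fintype.linearCombination S (y + z) v =
    Fintype.linearCombination S y v + Fintype.linearCombination S z v
  simp [Fintype.linearCombination_apply, Finset.sum_add_distrib]

lemma extOf_succ_eq_zero_iff (i : ℕ) (y : Fin (F.b (i + 1)) → N)
    (h : colMul (F.D (i + 1)) y = 0) :
    F.extOf (i + 1) y h = 0 ↔ ∃ z, colMul (F.D i) z = y := by
  rw [extOf, ProjectiveResolution.extMk_eq_zero_iff _ _ _ _ _ i rfl]
  constructor
  · rintro ⟨g, hg⟩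
    obtain ⟨z, rfl⟩ := F.colHom_surjective i g
    rw [d_comp_colHom] at hg
    exact ⟨z, F.colHom_injective hg⟩
  · rintro ⟨z, rfl⟩
    exact ⟨F.colHom i z, F.d_comp_colHom i z⟩

open CochainComplex HomComplex in
lemma extOf_zero_eq_zero_iff (y : Fin (F.b 0) → N) (h : colMul (F.D 0) y = 0) :
    F.extOf 0 y h = 0 ↔ y = 0 := by
  constructor
  · intro h0
    rw [extOf, ← F.toProjectiveResolution.extEquivCohomologyClass.apply_eq_iff_eq,
      ProjectiveResolution.extEquivCohomologyClass_extMk,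
      ProjectiveResolution.extEquivCohomologyClass_zero,
      CohomologyClass.mk_eq_zero_iff, Cocycle.toSingleMk_mem_coboundaries_iff _ _ _ _ _ 1 (by lia)]
      at h0
    obtain ⟨g, hg⟩ := h0
    have hz : F.toProjectiveResolution.cochainComplex.d (-(0 : ℕ)) 1 = 0 :=
      (CochainComplex.isZero_of_isStrictlyLE _ 0 1 (by lia)).eq_of_tgt _ _
    rw [hz, Limits.zero_comp] at hg
    apply F.colHom_injective
    rw [F.colHom_zero]
    rw [← cancel_epi (F.toProjectiveResolution.cochainComplexXIso (-(0:ℕ)) 0 rfl).hom]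
    rw [← hg, Limits.comp_zero]
  · rintro rfl
    simp [extOf, colHom_zero]

lemma extOf_comp_mk₀ {N' : Type u} [AddCommGroup N'] [Module S N'] (i : ℕ) (y : Fin (F.b i) → N)
    (h : colMul (F.D i) y = 0) (f : N →ₗ[S] N') (h' : colMul (F.D i) (f ∘ y) = 0) :
    (F.extOf i y h).comp (Abelian.Ext.mk₀ (ModuleCat.ofHom f)) (add_zero i) =
      F.extOf i (f ∘ y) h' := by
  rw [extOf, extOf, ProjectiveResolution.extMk_comp_mk₀]
  congr 1
  ext1
  refine LinearMap.ext fun (v : Fin (F.b i) → S) => ?_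
  change f (Fintype.linearCombination S _ v) = Fintype.linearCombination S _ v
  simp [Fintype.linearCombination_apply]

end FreeResolution

end Resolutions

/-! ### Quadratic algebras and their grading -/

section TensorAlgebraQuotients

variable {k : Type u} [Field k] {W : Type u} [AddCommGroup W] [Module k W]

/-- Elements identified in a quotient of a ring by relations differ by an element of any two-sided
ideal `J` that contains the relations. -/
lemma sub_mem_of_mkAlgHom_eq {T : Type u} [Ring T] [Algebra k T] (r : T → T → Prop)
    (J : Submodule k T) (hl : ∀ a, ∀ x ∈ J, a * x ∈ J) (hr : ∀ a, ∀ x ∈ J, x * a ∈ J)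
    (h : ∀ x y, r x y → x - y ∈ J) {x y : T}
    (hxy : RingQuot.mkAlgHom k r x = RingQuot.mkAlgHom k r y) : x - y ∈ J := by
  have hxy' : Relation.EqvGen (RingQuot.Rel r) x y := by
    apply Quot.eqvGen_exact
    simpa [RingQuot.mkAlgHom_def, RingQuot.mkRingHom_def] using hxy
  clear hxy
  induction hxy' with
  | rel x y hxy =>
    induction hxy with
    | of hxy => exact h _ _ hxy
    | add_left _ ih => simpa using ih
    | mul_left _ ih => simpa [sub_mul] using hr _ _ ih
    | mul_right _ ih => simpa [mul_sub] using hl _ _ ih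
  | refl x => simp
  | symm x y _ ih => simpa using J.neg_mem ih
  | trans x y z _ _ ih₁ ih₂ => simpa using J.add_mem ih₁ ih₂

/-- A submodule of an algebra generated by the image of `g` that contains `1` and is stable under
left multiplication by generators is everything. -/
lemma eq_top_of_gen_mul_mem {B : Type u} [Ring B] [Algebra k B] (g : W →ₗ[k] B)
    (hg : Function.Surjective (TensorAlgebra.lift k g)) (J : Submodule k B) (h1 : 1 ∈ J)
    (hmul : ∀ w, ∀ a ∈ J, g w * a ∈ J) : J = ⊤ := by
  let J' : Subalgebra k B :=
    { carrier := {b | ∀ a ∈ J, b * a ∈ J}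
      mul_mem' := fun ha hb c hc => by simpa [mul_assoc] using ha _ (hb c hc)
      add_mem' := fun ha hb c hc => by simpa [add_mul] using J.add_mem (ha c hc) (hb c hc)
      algebraMap_mem' := fun r c hc => by simpa [Algebra.smul_def] using J.smul_mem r hc }
  have key : ∀ t, TensorAlgebra.lift k g t ∈ J' := by
    intro t
    induction t using TensorAlgebra.induction with
    | algebraMap r => simp
    | ι w => rw [TensorAlgebra.lift_ι_apply]; exact hmul w
    | mul a b ha hb => simpa using J'.mul_mem ha hb
    | add a b ha hb => simpa using J'.add_mem ha hb
  refine eq_top_iff.2 fun b _ => ?_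
  obtain ⟨t, rfl⟩ := hg b
  simpa using key t 1 h1

lemma tensorTwo_tmul (v w : W) :
    tensorTwo k W (v ⊗ₜ w) = TensorAlgebra.ι k v * TensorAlgebra.ι k w := by
  simp [tensorTwo]

end TensorAlgebraQuotients

namespace QuadAlg

variable {k : Type u} [Field k] {W : Type u} [AddCommGroup W] [Module k W]
  (Q : Submodule k (W ⊗[k] W))

lemma mk_surjective : Function.Surjective (QuadAlg.mk Q) := RingQuot.mkAlgHom_surjective _ _

lemma mk_ι (w : W) : QuadAlg.mk Q (TensorAlgebra.ι k w) = gen Q w := rfl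

lemma lift_gen : TensorAlgebra.lift k (gen Q) = QuadAlg.mk Q := by
  ext w; simp [mk_ι]

lemma lift_gen_surjective : Function.Surjective (TensorAlgebra.lift k (gen Q)) := by
  rw [lift_gen]; exact mk_surjective Q

variable {Q}

lemma mk_tensorTwo_of_mem {r : W ⊗[k] W} (hr : r ∈ Q) : QuadAlg.mk Q (tensorTwo k W r) = 0 := by
  rw [QuadAlg.mk, RingQuot.mkAlgHom_rel k (QuadRel.of r hr), map_zero]

lemma lift_tensorTwo {B : Type u} [Ring B] [Algebra k B] (f : W →ₗ[k] B) (r : W ⊗[k] W) :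
    TensorAlgebra.lift k f (tensorTwo k W r) = LinearMap.mul' k B (TensorProduct.map f f r) := by
  induction r using TensorProduct.induction_on with
  | zero => simp
  | tmul v w => simp [tensorTwo]
  | add a b ha hb => simp only [map_add, ha, hb]

/-- The universal property of `T(W)/(Q)`. -/
def lift {B : Type u} [Ring B] [Algebra k B] (f : W →ₗ[k] B)
    (h : ∀ r ∈ Q, LinearMap.mul' k B (TensorProduct.map f f r) = 0) : QuadAlg Q →ₐ[k] B :=
  RingQuot.liftAlgHom k ⟨TensorAlgebra.lift k f, by
    rintro _ _ ⟨r, hr⟩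
    rw [lift_tensorTwo, h r hr, map_zero]⟩

@[simp] lemma lift_apply_gen {B : Type u} [Ring B] [Algebra k B] (f : W →ₗ[k] B)
    (h : ∀ r ∈ Q, LinearMap.mul' k B (TensorProduct.map f f r) = 0) (w : W) :
    lift f h (gen Q w) = f w := by
  simp [lift, gen, QuadAlg.mk]

@[simp] lemma aug_gen (w : W) : aug Q (gen Q w) = 0 := by
  simp [aug, gen, QuadAlg.mk]

instance : Nontrivial (QuadAlg Q) := (aug Q).toRingHom.domain_nontrivial

variable (Q) in
/-- The action of the generators in the representation `truncRep`. -/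
def truncMap : W →ₗ[k] Module.End k (k × W × ((W ⊗[k] W) ⧸ Q)) where
  toFun w := LinearMap.inr k k _ ∘ₗ
    (LinearMap.toSpanSingleton k W w).prodMap (Q.mkQ ∘ₗ TensorProduct.mk k W W w) ∘ₗ
      LinearMap.id.prodMap (LinearMap.fst k W _)
  map_add' v w := by
    refine LinearMap.ext fun p => ?_
    simp
  map_smul' c w := by
    refine LinearMap.ext fun p => ?_
    simp [smul_comm c p.1 w, -Submodule.mkQ_apply]

lemma truncMap_apply (w : W) (p) : truncMap Q w p = (0, p.1 • w, Q.mkQ (w ⊗ₜ p.2.1)) := rfl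

lemma mul_truncMap (r : W ⊗[k] W) :
    LinearMap.mul' k _ (TensorProduct.map (truncMap Q) (truncMap Q) r) =
      (LinearMap.inr k k _ ∘ₗ LinearMap.inr k W _ ∘ₗ
        LinearMap.toSpanSingleton k _ (Q.mkQ r)) ∘ₗ LinearMap.fst k k _ := by
  induction r using TensorProduct.induction_on with
  | zero => simp
  | tmul v w =>
    refine LinearMap.ext fun p => ?_
    rw [TensorProduct.map_tmul, LinearMap.mul'_apply, Module.End.mul_apply]
    simp [truncMap_apply, TensorProduct.tmul_smul]
  | add a b ha hb =>
    rw [map_add, map_add, ha, hb]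
    refine LinearMap.ext fun p => ?_
    simp

/-- The representation of `T(W)/(Q)` on its quotient `k ⊕ W ⊕ (W ⊗ W) / Q`. -/
def truncRep : QuadAlg Q →ₐ[k] Module.End k (k × W × ((W ⊗[k] W) ⧸ Q)) :=
  lift (truncMap Q) fun r hr => by
    have : Q.mkQ r = 0 := by simpa using hr
    rw [mul_truncMap, this]
    simp

lemma truncRep_gen (w : W) (p) :
    truncRep (Q := Q) (gen Q w) p = (0, p.1 • w, Q.mkQ (w ⊗ₜ p.2.1)) := by
  rw [truncRep, lift_apply_gen, truncMap_apply]

lemma gen_injective : Function.Injective (gen Q) := by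
  intro v w h
  have := congrArg (fun a => (truncRep a (1, 0, 0)).2.1) h
  simpa [truncRep_gen] using this

lemma mk_tensorTwo_eq_zero_iff {t : W ⊗[k] W} :
    QuadAlg.mk Q (tensorTwo k W t) = 0 ↔ t ∈ Q := by
  refine ⟨fun h => ?_, mk_tensorTwo_of_mem⟩
  have key : truncRep (QuadAlg.mk Q (tensorTwo k W t)) (1, 0, 0) = (0, 0, Q.mkQ t) := by
    clear h
    induction t using TensorProduct.induction_on with
    | zero => simp; rfl
    | tmul v w => simp [tensorTwo_tmul, mk_ι, truncRep_gen]
    | add a b ha hb => simp only [map_add, ha, hb, LinearMap.add_apply]; simp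
  rw [h] at key
  simpa using congrArg (fun p => p.2.2) key.symm

section Grading

lemma gen_mem_piece (w : W) : gen Q w ∈ piece Q 1 := by
  simp [piece]

lemma mem_piece_one {a : QuadAlg Q} : a ∈ piece Q 1 ↔ ∃ w, gen Q w = a := by
  simp [piece]

lemma piece_zero : piece Q 0 = 1 := by simp [piece]

lemma mem_piece_zero {a : QuadAlg Q} : a ∈ piece Q 0 ↔ ∃ c, algebraMap k _ c = a := by
  rw [piece_zero, Submodule.mem_one]

lemma one_mem_piece : (1 : QuadAlg Q) ∈ piece Q 0 := mem_piece_zero.2 ⟨1, by simp⟩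

lemma mul_mem_piece {i j : ℕ} {a b : QuadAlg Q} (ha : a ∈ piece Q i) (hb : b ∈ piece Q j) :
    a * b ∈ piece Q (i + j) := by
  rw [piece, pow_add]
  exact Submodule.mul_mem_mul ha hb

lemma gen_mul_mem_piece {i : ℕ} (w : W) {a : QuadAlg Q} (ha : a ∈ piece Q i) :
    gen Q w * a ∈ piece Q (i + 1) := by
  rw [add_comm]; exact mul_mem_piece (gen_mem_piece w) ha

lemma mul_gen_mem_piece {i : ℕ} (w : W) {a : QuadAlg Q} (ha : a ∈ piece Q i) :
    a * gen Q w ∈ piece Q (i + 1) := mul_mem_piece ha (gen_mem_piece w)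

lemma piece_succ_le {i : ℕ} {J : Submodule k (QuadAlg Q)}
    (h : ∀ a ∈ piece Q i, ∀ w, a * gen Q w ∈ J) : piece Q (i + 1) ≤ J := by
  rw [piece, pow_succ, Submodule.mul_le]
  rintro a ha _ ⟨w, rfl⟩
  exact h a ha w

lemma iSup_piece : ⨆ i, piece Q i = ⊤ := by
  refine eq_top_of_gen_mul_mem (gen Q) (lift_gen_surjective Q) _
    (Submodule.mem_iSup_of_mem 0 one_mem_piece) fun w a ha => ?_
  refine Submodule.iSup_induction (piece Q) (motive := fun a => gen Q w * a ∈ ⨆ i, piece Q i) ha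
    (fun i a ha => Submodule.mem_iSup_of_mem (i + 1) (gen_mul_mem_piece w ha)) (by simp) ?_
  intro a b ha hb
  rw [mul_add]
  exact Submodule.add_mem _ ha hb

/-- Induction on homogeneous elements. -/
@[elab_as_elim]
lemma homogeneous_induction {motive : QuadAlg Q → Prop} (a : QuadAlg Q)
    (mem : ∀ i, ∀ a ∈ piece Q i, motive a) (add : ∀ a b, motive a → motive b → motive (a + b)) :
    motive a := by
  have ha : a ∈ ⨆ i, piece Q i := by rw [iSup_piece]; trivial
  exact Submodule.iSup_induction (piece Q) (motive := motive) ha mem (mem 0 0 (zero_mem _)) add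

lemma exists_mk_of_mem_piece {i : ℕ} {a : QuadAlg Q} (ha : a ∈ piece Q i) :
    ∃ t ∈ LinearMap.range (TensorAlgebra.ι k (M := W)) ^ i, QuadAlg.mk Q t = a := by
  have : piece Q i = (LinearMap.range (TensorAlgebra.ι k (M := W)) ^ i).map
      (QuadAlg.mk Q).toLinearMap := by
    rw [Submodule.map_pow, ← LinearMap.range_comp]
    rfl
  rw [this] at ha
  exact ha

variable (Q) in
/-- The generators, placed in degree one. -/
def gradeGen : W →ₗ[k] Polynomial (QuadAlg Q) :=
  (Polynomial.monomial 1).restrictScalars k ∘ₗ gen Q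

lemma mul_gradeGen (r : W ⊗[k] W) :
    LinearMap.mul' k _ (TensorProduct.map (gradeGen Q) (gradeGen Q) r) =
      Polynomial.monomial 2 (QuadAlg.mk Q (tensorTwo k W r)) := by
  induction r using TensorProduct.induction_on with
  | zero => simp
  | tmul v w => simp [gradeGen, tensorTwo_tmul, mk_ι, Polynomial.monomial_mul_monomial]
  | add a b ha hb => simp only [map_add, ha, hb]

/-- The algebra map `a ↦ ∑ aᵢ Xⁱ`, for `aᵢ` the homogeneous components of `a`. -/
def gradeHom : QuadAlg Q →ₐ[k] Polynomial (QuadAlg Q) :=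
  lift (B := Polynomial (QuadAlg Q)) (gradeGen Q) fun r hr => by
    rw [mul_gradeGen, mk_tensorTwo_of_mem hr, map_zero]

@[simp] lemma gradeHom_gen (w : W) : gradeHom (gen Q w) = Polynomial.monomial 1 (gen Q w) := by
  simp [gradeHom, gradeGen]

lemma gradeHom_of_mem {i : ℕ} {a : QuadAlg Q} (ha : a ∈ piece Q i) :
    gradeHom a = Polynomial.monomial i a := by
  induction i generalizing a with
  | zero =>
    obtain ⟨c, rfl⟩ := mem_piece_zero.1 ha
    rw [AlgHom.commutes]
    rfl
  | succ i ih =>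
    let J : Submodule k (QuadAlg Q) := LinearMap.eqLocus (gradeHom (Q := Q)).toLinearMap
      ((Polynomial.monomial (i + 1)).restrictScalars k)
    refine piece_succ_le (J := J) (fun b hb w => ?_) ha
    change gradeHom _ = Polynomial.monomial _ _
    rw [map_mul, ih hb, gradeHom_gen, Polynomial.monomial_mul_monomial]

/-- The homogeneous component of degree `i`. -/
def proj (Q : Submodule k (W ⊗[k] W)) (i : ℕ) : QuadAlg Q →ₗ[k] QuadAlg Q :=
  (Polynomial.lcoeff (QuadAlg Q) i).restrictScalars k ∘ₗ (gradeHom (Q := Q)).toLinearMap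

lemma proj_apply (i : ℕ) (a : QuadAlg Q) : proj Q i a = (gradeHom a).coeff i := rfl

lemma proj_of_mem {i : ℕ} {a : QuadAlg Q} (ha : a ∈ piece Q i) (j : ℕ) :
    proj Q j a = if i = j then a else 0 := by
  rw [proj_apply, gradeHom_of_mem ha, Polynomial.coeff_monomial]

lemma proj_self {i : ℕ} {a : QuadAlg Q} (ha : a ∈ piece Q i) : proj Q i a = a := by
  rw [proj_of_mem ha, if_pos rfl]

lemma proj_ne {i j : ℕ} {a : QuadAlg Q} (ha : a ∈ piece Q i) (h : i ≠ j) : proj Q j a = 0 := by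
  rw [proj_of_mem ha, if_neg h]

lemma proj_mem (i : ℕ) (a : QuadAlg Q) : proj Q i a ∈ piece Q i := by
  induction a using homogeneous_induction with
  | mem j a ha =>
    rw [proj_of_mem ha]
    split_ifs with h
    · exact h ▸ ha
    · exact zero_mem _
  | add a b ha hb => rw [map_add]; exact add_mem ha hb

lemma exists_sum_proj (a : QuadAlg Q) :
    ∃ N, ∀ n ≥ N, ∑ i ∈ Finset.range n, proj Q i a = a := by
  induction a using homogeneous_induction with
  | mem j a ha =>
    refine ⟨j + 1, fun n hn => ?_⟩
    simp only [proj_of_mem ha]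
    rw [Finset.sum_ite_eq, if_pos (Finset.mem_range.2 (by omega))]
  | add a b ha hb =>
    obtain ⟨N, hN⟩ := ha
    obtain ⟨N', hN'⟩ := hb
    refine ⟨max N N', fun n hn => ?_⟩
    simp only [map_add, Finset.sum_add_distrib]
    rw [hN n (le_trans (le_max_left _ _) hn), hN' n (le_trans (le_max_right _ _) hn)]

lemma eq_zero_of_proj {a : QuadAlg Q} (h : ∀ i, proj Q i a = 0) : a = 0 := by
  obtain ⟨N, hN⟩ := exists_sum_proj a
  rw [← hN N le_rfl]
  simp [h]

lemma proj_gen_mul (i : ℕ) (w : W) (a : QuadAlg Q) :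
    proj Q (i + 1) (gen Q w * a) = gen Q w * proj Q i a := by
  rw [proj_apply, proj_apply, map_mul, gradeHom_gen, Polynomial.coeff_monomial_mul]

lemma proj_mul_gen (i : ℕ) (w : W) (a : QuadAlg Q) :
    proj Q (i + 1) (a * gen Q w) = proj Q i a * gen Q w := by
  rw [proj_apply, proj_apply, map_mul, gradeHom_gen, Polynomial.coeff_mul_monomial]

lemma proj_zero_gen_mul (w : W) (a : QuadAlg Q) : proj Q 0 (gen Q w * a) = 0 := by
  rw [proj_apply, map_mul, gradeHom_gen, Polynomial.mul_coeff_zero]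
  simp [Polynomial.coeff_monomial]

lemma proj_zero_mul_gen (w : W) (a : QuadAlg Q) : proj Q 0 (a * gen Q w) = 0 := by
  rw [proj_apply, map_mul, gradeHom_gen, Polynomial.mul_coeff_zero]
  simp [Polynomial.coeff_monomial]

lemma aug_of_mem {i : ℕ} {a : QuadAlg Q} (ha : a ∈ piece Q (i + 1)) : aug Q a = 0 := by
  have : piece Q (i + 1) ≤ LinearMap.ker (aug Q).toLinearMap :=
    piece_succ_le fun a _ w => by simp
  exact this ha

lemma proj_zero_eq (a : QuadAlg Q) : proj Q 0 a = algebraMap k _ (aug Q a) := by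
  induction a using homogeneous_induction with
  | mem j a ha =>
    cases j with
    | zero =>
      rw [proj_self ha]
      obtain ⟨c, rfl⟩ := mem_piece_zero.1 ha
      simp
    | succ j => rw [aug_of_mem ha, proj_ne ha (by omega), map_zero]
  | add a b ha hb => simp only [map_add, ha, hb]

end Grading
end QuadAlg

/-! ### The quadratic dual of a Koszul algebra -/

variable {k : Type u} [Field k] {V : Type u} [AddCommGroup V] [Module k V]

/-- The linear resolution of the trivial module that witnesses Koszulness, with the entries of its
matrices written as elements of `V`. Elements of the right module `A ^ b i` are columns, on which
the matrices act from the left. -/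
structure KoszulData (R : Submodule k (V ⊗[k] V)) where
  /-- The ranks. -/
  b : ℕ → ℕ
  /-- The matrices of the differentials. -/
  m : ∀ i, Matrix (Fin (b i)) (Fin (b (i + 1))) V
  b_zero : b 0 = 1
  exact_zero : ∀ v : Fin (b 0) → QuadAlg R, (∀ p, QuadAlg.aug R (v p) = 0) ↔
    ∃ w, ((m 0).map (QuadAlg.gen R)).mulVec w = v
  exact_succ : ∀ i, ∀ v : Fin (b (i + 1)) → QuadAlg R,
    ((m i).map (QuadAlg.gen R)).mulVec v = 0 ↔
      ∃ w, ((m (i + 1)).map (QuadAlg.gen R)).mulVec w = v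

lemma IsKoszul.exists_koszulData {R : Submodule k (V ⊗[k] V)} (h : IsKoszul R) :
    Nonempty (KoszulData R) := by
  obtain ⟨b, M, h0, h1, h2, h3⟩ := h
  choose m hm using fun i p q => QuadAlg.mem_piece_one.1 (h1 i p q)
  have hM : ∀ i, (Matrix.of (m i)).map (QuadAlg.gen R) = M i := fun i => by
    ext p q; exact hm i p q
  exact ⟨⟨b, fun i => Matrix.of (m i), h0, by simpa only [hM] using h2,
    by simpa only [hM] using h3⟩⟩

namespace KoszulData

open QuadAlg

variable {R : Submodule k (V ⊗[k] V)} (K : KoszulData R)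

/-- The matrix of the differential. -/
def M (i : ℕ) : Matrix (Fin (K.b i)) (Fin (K.b (i + 1))) (QuadAlg R) := (K.m i).map (gen R)

lemma mulVec_apply (i : ℕ) (v : Fin (K.b (i + 1)) → QuadAlg R) (p) :
    (K.M i).mulVec v p = ∑ q, gen R (K.m i p q) * v q := rfl

lemma vecMul_apply (i : ℕ) (v : Fin (K.b i) → QuadAlg R) (q) :
    Matrix.vecMul v (K.M i) q = ∑ p, v p * gen R (K.m i p q) := rfl

lemma proj_mulVec (i n : ℕ) (v : Fin (K.b (i + 1)) → QuadAlg R) (p) :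
    proj R (n + 1) ((K.M i).mulVec v p) = (K.M i).mulVec (fun q => proj R n (v q)) p := by
  simp only [mulVec_apply, map_sum, proj_gen_mul]

lemma proj_zero_mulVec (i : ℕ) (v : Fin (K.b (i + 1)) → QuadAlg R) (p) :
    proj R 0 ((K.M i).mulVec v p) = 0 := by
  simp only [mulVec_apply, map_sum, proj_zero_gen_mul, Finset.sum_const_zero]

lemma proj_vecMul (i n : ℕ) (v : Fin (K.b i) → QuadAlg R) (q) :
    proj R (n + 1) (Matrix.vecMul v (K.M i) q) =
      Matrix.vecMul (fun p => proj R n (v p)) (K.M i) q := by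
  simp only [vecMul_apply, map_sum, proj_mul_gen]

lemma proj_zero_vecMul (i : ℕ) (v : Fin (K.b i) → QuadAlg R) (q) :
    proj R 0 (Matrix.vecMul v (K.M i) q) = 0 := by
  simp only [vecMul_apply, map_sum, proj_zero_mul_gen, Finset.sum_const_zero]

lemma M_mul_M (i : ℕ) : K.M i * K.M (i + 1) = 0 := by
  refine Matrix.ext_of_mulVec_single fun q => ?_
  rw [← Matrix.mulVec_mulVec, Matrix.zero_mulVec]
  exact (K.exact_succ i _).2 ⟨_, rfl⟩

/-- Exactness in a positive internal degree. -/
lemma exists_of_mulVec_eq_zero {i n : ℕ} {v : Fin (K.b (i + 1)) → QuadAlg R}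
    (hv : ∀ p, v p ∈ piece R (n + 1)) (h : (K.M i).mulVec v = 0) :
    ∃ w : Fin (K.b (i + 2)) → QuadAlg R, (∀ p, w p ∈ piece R n) ∧ (K.M (i + 1)).mulVec w = v := by
  obtain ⟨w, hw⟩ := (K.exact_succ i v).1 h
  refine ⟨fun q => proj R n (w q), fun q => proj_mem _ _, ?_⟩
  ext p
  rw [← proj_mulVec, ← proj_self (hv p)]
  exact congrArg (fun u => proj R (n + 1) (u p)) hw

/-- Exactness in internal degree zero. -/
lemma eq_zero_of_mulVec_eq_zero {i : ℕ} {v : Fin (K.b (i + 1)) → QuadAlg R}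
    (hv : ∀ p, v p ∈ piece R 0) (h : (K.M i).mulVec v = 0) : v = 0 := by
  obtain ⟨w, hw⟩ := (K.exact_succ i v).1 h
  ext p
  rw [← proj_self (hv p), ← hw]
  exact K.proj_zero_mulVec _ _ _

lemma eq_zero_of_sum_smul_m {i : ℕ} {c : Fin (K.b (i + 1)) → k}
    (h : ∀ p, ∑ q, c q • K.m i p q = 0) : c = 0 := by
  have h1 : (K.M i).mulVec (fun q => algebraMap k _ (c q)) = 0 := by
    ext p
    rw [mulVec_apply, Pi.zero_apply, ← map_zero (gen R), ← h p, map_sum]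
    refine Finset.sum_congr rfl fun q _ => ?_
    rw [map_smul, ← Algebra.commutes, Algebra.smul_def]
  have h2 := K.eq_zero_of_mulVec_eq_zero (fun q => mem_piece_zero.2 ⟨c q, rfl⟩) h1
  ext q
  have := congrFun h2 q
  simpa using this

/-- As the resolution is linear, that it is a complex is a statement about `R`. -/
lemma sum_m_tmul_m_mem (i : ℕ) (p s) : ∑ q, K.m i p q ⊗ₜ[k] K.m (i + 1) q s ∈ R := by
  rw [← mk_tensorTwo_eq_zero_iff]
  have := congrFun (congrFun (K.M_mul_M i) p) s
  simpa [Matrix.mul_apply, tensorTwo_tmul, mk_ι, M] using this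

/-- Exactness in the lowest internal degree: the columns of `m (i + 1)` span the columns `v` of
elements of `V` for which the rows of `m i`, paired with `v`, lie in `R`. -/
lemma exists_smul_m_of_mem {i : ℕ} {v : Fin (K.b (i + 1)) → V}
    (h : ∀ s, ∑ p, K.m i s p ⊗ₜ[k] v p ∈ R) :
    ∃ c : Fin (K.b (i + 2)) → k, ∀ p, v p = ∑ q, c q • K.m (i + 1) p q := by
  obtain ⟨w, hw, hwv⟩ := K.exists_of_mulVec_eq_zero (i := i) (n := 0)
    (v := fun p => gen R (v p)) (fun p => gen_mem_piece _) (by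
      ext s
      have := mk_tensorTwo_eq_zero_iff.2 (h s)
      simpa [mulVec_apply, tensorTwo_tmul, mk_ι] using this)
  choose c hc using fun q => mem_piece_zero.1 (hw q)
  refine ⟨c, fun p => gen_injective (Q := R) ?_⟩
  rw [← congrFun hwv p, mulVec_apply, map_sum]
  refine Finset.sum_congr rfl fun q _ => ?_
  rw [← hc, map_smul, ← Algebra.commutes, Algebra.smul_def]

lemma exists_smul_m_zero (v : Fin (K.b 0) → V) :
    ∃ c : Fin (K.b 1) → k, ∀ p, v p = ∑ q, c q • K.m 0 p q := by
  obtain ⟨w, hw⟩ := (K.exact_zero fun p => gen R (v p)).1 fun p => aug_gen _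
  refine ⟨fun q => aug R (w q), fun p => gen_injective (Q := R) ?_⟩
  have := congrArg (fun u => proj R 1 (u p)) hw
  simp only at this
  rw [proj_self (gen_mem_piece _)] at this
  rw [← this]
  refine (K.proj_mulVec 0 0 w p).trans ?_
  rw [mulVec_apply, map_sum]
  refine Finset.sum_congr rfl fun q _ => ?_
  rw [proj_zero_eq, map_smul, ← Algebra.commutes, Algebra.smul_def]

section Dual

/-- Functionals dual to the columns of the matrix `m i`, which are linearly independent. -/
lemma exists_dualCol (i : ℕ) : ∃ y : Fin (K.b (i + 1)) → Fin (K.b i) → Module.Dual k V,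
    ∀ q q', ∑ p, y q p (K.m i p q') = if q' = q then 1 else 0 := by
  let f : (Fin (K.b (i + 1)) → k) →ₗ[k] (Fin (K.b i) → V) :=
    LinearMap.pi fun p => Fintype.linearCombination k (K.m i p)
  have hf : LinearMap.ker f = ⊥ := LinearMap.ker_eq_bot'.2 fun c hc =>
    K.eq_zero_of_sum_smul_m fun p => by
      simpa [f, Fintype.linearCombination_apply] using congrFun hc p
  obtain ⟨g, hg⟩ := f.exists_leftInverse_of_injective hf
  refine ⟨fun q p => LinearMap.proj q ∘ₗ g ∘ₗ LinearMap.single k (fun _ => V) p, fun q q' => ?_⟩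
  have h1 : f (Pi.single q' 1) = ∑ p, Pi.single p (K.m i p q') := by
    ext p
    simp [f, Fintype.linearCombination_apply_single, Finset.sum_pi_single]
  have h2 := congrFun (LinearMap.congr_fun hg (Pi.single q' 1)) q
  rw [LinearMap.comp_apply, h1, map_sum, Finset.sum_apply] at h2
  simpa [Pi.single_apply, eq_comm] using h2

/-- A choice of functionals dual to the columns of the matrix `m i`. -/
def dualCol (i : ℕ) : Fin (K.b (i + 1)) → Fin (K.b i) → Module.Dual k V :=
  (K.exists_dualCol i).choose

lemma sum_dualCol (i : ℕ) (q q') :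
    ∑ p, K.dualCol i q p (K.m i p q') = if q' = q then 1 else 0 :=
  (K.exists_dualCol i).choose_spec q q'

/-- The bases of the homogeneous components of `A^!` dual to the chosen bases of the free modules in
the resolution. -/
def e : ∀ i, Fin (K.b i) → DualAlg R
  | 0 => fun _ => 1
  | i + 1 => fun q => ∑ p, e i p * DualAlg.gen R (K.dualCol i q p)

lemma e_zero (p) : K.e 0 p = 1 := rfl

lemma e_succ (i : ℕ) (q) : K.e (i + 1) q = ∑ p, K.e i p * DualAlg.gen R (K.dualCol i q p) := rfl

lemma e_mem (i : ℕ) (p) : K.e i p ∈ DualAlg.piece R i := by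
  induction i with
  | zero => exact one_mem_piece
  | succ i ih => exact Submodule.sum_mem _ fun q _ => mul_gen_mem_piece _ (ih q)

/-- If the linear relations among the products of the `e i p` with generators hold, then the
multiplication rule follows. -/
lemma e_mul_gen_of {i : ℕ} (h : ∀ y : Fin (K.b i) → Module.Dual k V,
      (∀ q, ∑ p, y p (K.m i p q) = 0) → ∑ p, K.e i p * DualAlg.gen R (y p) = 0)
    (p) (f : Module.Dual k V) :
    K.e i p * DualAlg.gen R f = ∑ q, f (K.m i p q) • K.e (i + 1) q := by
  have := h (Pi.single p f - ∑ q, f (K.m i p q) • K.dualCol i q) fun q => by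
    simp only [Pi.sub_apply, LinearMap.sub_apply, Finset.sum_sub_distrib, Finset.sum_apply,
      Pi.smul_apply, LinearMap.sum_apply, LinearMap.smul_apply]
    rw [Finset.sum_comm]
    simp only [← Finset.smul_sum, sum_dualCol]
    rw [Finset.sum_eq_single p (fun p' _ hp => by simp [hp]) (by simp)]
    simp
  simp only [Pi.sub_apply, map_sub, mul_sub, Finset.sum_sub_distrib, Finset.sum_apply,
      Pi.smul_apply, map_sum, map_smul, Finset.mul_sum, mul_smul_comm] at this
  rw [Finset.sum_comm (γ := Fin (K.b i)), sub_eq_zero,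
    Finset.sum_eq_single p (fun p' _ hp => by simp [hp]) (by simp)] at this
  simpa [← Finset.smul_sum, ← e_succ] using this

/-- The contraction `(f ⊗ g) ↦ f(u) g`. -/
def contr (u : V) : Module.Dual k V ⊗[k] Module.Dual k V →ₗ[k] Module.Dual k V :=
  (TensorProduct.lid k _).toLinearMap ∘ₗ LinearMap.rTensor _ (Module.Dual.eval k V u)

lemma contr_tmul (u : V) (f g : Module.Dual k V) : contr u (f ⊗ₜ[k] g) = f u • g := by
  simp [contr]

lemma contr_apply (u v : V) (t : Module.Dual k V ⊗[k] Module.Dual k V) :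
    contr u t v = TensorProduct.dualDistrib k V V t (u ⊗ₜ v) := by
  induction t using TensorProduct.induction_on with
  | zero => simp
  | tmul f g => simp [contr_tmul]
  | add a b ha hb => simp [ha, hb]

variable [FiniteDimensional k V]

/-- A functional `y` that vanishes on the columns of `m i` gives a relation `∑ e i p y p = 0` in
`A^!`: by exactness of the resolution, `y` factors through the pairing with the rows of
`m (i - 1)` modulo `R`, so that the sum is a combination of relations from `R^⊥`. -/
lemma relation_e (i : ℕ) (y : Fin (K.b i) → Module.Dual k V)
    (hy : ∀ q, ∑ p, y p (K.m i p q) = 0) : ∑ p, K.e i p * DualAlg.gen R (y p) = 0 := by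
  induction i with
  | zero =>
    -- the columns of `m 0` span `V ^ b 0`
    have : ∀ p, y p = 0 := fun p => by
      refine LinearMap.ext fun v => ?_
      obtain ⟨c, hc⟩ := K.exists_smul_m_zero (Pi.single p v)
      have h1 : ∑ p', y p' (Pi.single (M := fun _ => V) p v p') = 0 := by
        simp only [hc, map_sum, map_smul]
        rw [Finset.sum_comm]
        simp only [← Finset.smul_sum, hy]
        simp
      rw [Finset.sum_eq_single p (fun p' _ hp => by simp [hp]) (by simp)] at h1
      simpa using h1
    simp [this]
  | succ i ih =>
    let Y : (Fin (K.b (i + 1)) → V) →ₗ[k] k := ∑ p, y p ∘ₗ LinearMap.proj p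
    let L : (Fin (K.b (i + 1)) → V) →ₗ[k] (Fin (K.b i) → (V ⊗[k] V) ⧸ R) :=
      LinearMap.pi fun s => R.mkQ ∘ₗ ∑ p, TensorProduct.mk k V V (K.m i s p) ∘ₗ LinearMap.proj p
    have hYL : Y ∈ (LinearMap.ker L).dualAnnihilator := by
      rw [Submodule.mem_dualAnnihilator]
      intro v hv
      -- `v` is a combination of the columns of `m (i + 1)`, on which `Y` vanishes
      obtain ⟨c, hc⟩ := K.exists_smul_m_of_mem (v := v) fun s => by
        have := congrFun hv s
        simpa [L, -Submodule.mkQ_apply, Submodule.mkQ_apply, ← map_sum] using this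
      simp only [Y, LinearMap.sum_apply, LinearMap.comp_apply, LinearMap.proj_apply, hc, map_sum,
        map_smul]
      rw [Finset.sum_comm]
      simp only [← Finset.smul_sum, hy]
      simp
    rw [← LinearMap.range_dualMap_eq_dualAnnihilator_ker] at hYL
    obtain ⟨ψ, hψ⟩ := hYL
    let t : Fin (K.b i) → Module.Dual k V ⊗[k] Module.Dual k V := fun s =>
      (TensorProduct.dualDistribEquiv k V V).symm (ψ ∘ₗ LinearMap.single k _ s ∘ₗ R.mkQ)
    have ht : ∀ s, TensorProduct.dualDistrib k V V (t s) =
        ψ ∘ₗ LinearMap.single k _ s ∘ₗ R.mkQ := fun s =>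
      (TensorProduct.dualDistribEquiv k V V).apply_symm_apply _
    have htR : ∀ s, t s ∈ orth R := fun s => by
      rw [orth, Submodule.mem_comap, ht, Submodule.mem_dualAnnihilator]
      intro r hr
      simp [(Submodule.Quotient.mk_eq_zero R).2 hr]
    have hyt : ∀ p, y p = ∑ s, contr (K.m i s p) (t s) := fun p => by
      refine LinearMap.ext fun v => ?_
      have h1 : Y (Pi.single p v) = y p v := by
        simp only [Y, LinearMap.sum_apply, LinearMap.comp_apply, LinearMap.proj_apply]
        rw [Finset.sum_eq_single p (fun p' _ hp => by simp [hp]) (by simp)]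
        simp
      rw [← h1, ← hψ, LinearMap.dualMap_apply, LinearMap.sum_apply]
      have h2 : L (Pi.single p v) = ∑ s, Pi.single s (R.mkQ (K.m i s p ⊗ₜ v)) := by
        ext s
        rw [Finset.sum_apply, Finset.sum_pi_single]
        simp only [L, LinearMap.pi_apply, LinearMap.comp_apply, LinearMap.sum_apply,
          LinearMap.proj_apply, TensorProduct.mk_apply]
        rw [Finset.sum_eq_single p (fun p' _ hp => by simp [hp]) (by simp)]
        simp
      rw [h2, map_sum]
      refine Finset.sum_congr rfl fun s _ => ?_
      rw [contr_apply, ht]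
      rfl
    have key : ∀ s (t : Module.Dual k V ⊗[k] Module.Dual k V),
        ∑ p, K.e (i + 1) p * DualAlg.gen R (contr (K.m i s p) t) =
          K.e i s * QuadAlg.mk (orth R) (tensorTwo k _ t) := by
      intro s t
      induction t using TensorProduct.induction_on with
      | zero => simp
      | tmul f g =>
        simp only [contr_tmul, tensorTwo_tmul, map_mul, mk_ι, map_smul]
        rw [← mul_assoc, K.e_mul_gen_of ih, Finset.sum_mul]
        simp
      | add a b ha hb => simp only [map_add, mul_add, Finset.sum_add_distrib, ha, hb]
    simp only [hyt, map_sum, Finset.mul_sum]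
    rw [Finset.sum_comm]
    simp [key, mk_tensorTwo_of_mem (htR _)]

/-- Right multiplication by generators is given by the matrices of the resolution. -/
lemma e_mul_gen (i : ℕ) (p) (f : Module.Dual k V) :
    K.e i p * DualAlg.gen R f = ∑ q, f (K.m i p q) • K.e (i + 1) q :=
  K.e_mul_gen_of (K.relation_e i) p f

lemma span_e (i : ℕ) : Submodule.span k (Set.range (K.e i)) = DualAlg.piece R i := by
  refine le_antisymm (Submodule.span_le.2 ?_) ?_
  · rintro _ ⟨p, rfl⟩; exact K.e_mem i p
  · induction i with
    | zero =>
      rw [DualAlg.piece, piece_zero, Submodule.one_le]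
      exact Submodule.subset_span ⟨⟨0, by rw [K.b_zero]; exact one_pos⟩, rfl⟩
    | succ i ih =>
      refine piece_succ_le fun a ha f => ?_
      refine Submodule.span_induction (p := fun a _ => a * DualAlg.gen R f ∈ _) ?_ (by simp)
        (fun a b _ _ ha hb => by rw [add_mul]; exact add_mem ha hb)
        (fun c a _ ha => by rw [smul_mul_assoc]; exact Submodule.smul_mem _ _ ha) (ih ha)
      rintro _ ⟨p, rfl⟩
      rw [e_mul_gen]
      exact Submodule.sum_mem _ fun q _ => Submodule.smul_mem _ _ (Submodule.subset_span ⟨q, rfl⟩)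

end Dual

section Rep

/-- The action of the generators of `A^!` in the representation `rep`. -/
def repGen : Module.Dual k V →ₗ[k] (Module.End k (∀ i, Fin (K.b i) → k))ᵐᵒᵖ :=
  (MulOpposite.opLinearEquiv k).toLinearMap ∘ₗ LinearMap.mk₂ k
    (fun f n i => match i with
      | 0 => 0
      | i + 1 => fun q => ∑ p, n i p * f (K.m i p q))
    (fun f g n => by ext i q; cases i <;> simp [mul_add, Finset.sum_add_distrib])
    (fun c f n => by ext i q; cases i <;> simp [Finset.mul_sum, mul_left_comm])
    (fun f n n' => by ext i q; cases i <;> simp [add_mul, Finset.sum_add_distrib])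
    (fun c f n => by ext i q; cases i <;> simp [Finset.mul_sum, mul_assoc])

lemma repGen_succ (f : Module.Dual k V) (n) (i : ℕ) (q) :
    (K.repGen f).unop n (i + 1) q = ∑ p, n i p * f (K.m i p q) := rfl

lemma repGen_zero (f : Module.Dual k V) (n) (q) : (K.repGen f).unop n 0 q = 0 := rfl

lemma mul_repGen (t : Module.Dual k V ⊗[k] Module.Dual k V) (n i s) :
    (LinearMap.mul' k _ (TensorProduct.map K.repGen K.repGen t)).unop n (i + 2) s =
      ∑ p, n i p * TensorProduct.dualDistrib k V V t (∑ q, K.m i p q ⊗ₜ K.m (i + 1) q s) := by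
  induction t using TensorProduct.induction_on with
  | zero => simp
  | tmul f g =>
    simp only [TensorProduct.map_tmul, LinearMap.mul'_apply, MulOpposite.unop_mul,
      Module.End.mul_apply, repGen_succ, map_sum, TensorProduct.dualDistrib_apply,
      Finset.mul_sum, Finset.sum_mul]
    rw [Finset.sum_comm]
    simp [mul_assoc]
  | add a b ha hb =>
    simp only [map_add, MulOpposite.unop_add, LinearMap.add_apply, Pi.add_apply, ha, hb, mul_add,
      Finset.sum_add_distrib]

/-- The right action of `A^!` on the sum of the duals of the spaces of generators of the resolution:
generators act by the matrices of the resolution. -/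
def rep : DualAlg R →ₐ[k] (Module.End k (∀ i, Fin (K.b i) → k))ᵐᵒᵖ :=
  lift K.repGen fun t ht => by
    refine MulOpposite.unop_injective (LinearMap.ext fun n => ?_)
    ext i s
    match i with
    | 0 | 1 =>
      clear ht
      induction t using TensorProduct.induction_on with
      | zero => simp
      | tmul f g => simp [repGen_zero, repGen_succ]
      | add a b ha hb => simp_all
    | i + 2 =>
      rw [mul_repGen]
      have : ∀ r ∈ R, TensorProduct.dualDistrib k V V t r = 0 :=
        (Submodule.mem_dualAnnihilator _).1 ht
      simp [-map_sum, this _ (K.sum_m_tmul_m_mem i _ s)]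

/-- The action of `a` on the generator in degree zero. -/
def orbit (i : ℕ) : DualAlg R →ₗ[k] (Fin (K.b i) → k) :=
  LinearMap.proj i ∘ₗ LinearMap.applyₗ (fun i _ => if i = 0 then (1 : k) else 0) ∘ₗ
    (MulOpposite.opLinearEquiv k).symm.toLinearMap ∘ₗ K.rep.toLinearMap

lemma orbit_mul_gen (i : ℕ) (a : DualAlg R) (f : Module.Dual k V) (q) :
    K.orbit (i + 1) (a * DualAlg.gen R f) q = ∑ p, K.orbit i a p * f (K.m i p q) := by
  simp [orbit, rep, repGen_succ]

/-- The products `e i p` are linearly independent, as they act independently on the generator of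
degree zero. -/
lemma orbit_e (i : ℕ) (p) : K.orbit i (K.e i p) = Pi.single p 1 := by
  induction i with
  | zero =>
    have : Subsingleton (Fin (K.b 0)) := by rw [K.b_zero]; infer_instance
    ext q
    obtain rfl : q = p := Subsingleton.elim _ _
    simp [orbit, e_zero]
  | succ i ih =>
    ext q
    simp only [e_succ, map_sum, Finset.sum_apply, orbit_mul_gen, ih]
    have := K.sum_dualCol i p q
    simpa [Pi.single_apply] using this

/-- The coordinates of the component of degree `i` in the basis `e i`. -/
def coord (i : ℕ) : DualAlg R →ₗ[k] (Fin (K.b i) → k) := K.orbit i ∘ₗ proj (orth R) i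

lemma coord_e (i : ℕ) (p) : K.coord i (K.e i p) = Pi.single p 1 := by
  rw [coord, LinearMap.comp_apply, proj_self (K.e_mem i p), orbit_e]

lemma coord_of_ne {i j : ℕ} (h : i ≠ j) {a : DualAlg R} (ha : a ∈ DualAlg.piece R i) :
    K.coord j a = 0 := by
  rw [coord, LinearMap.comp_apply, proj_ne ha h, map_zero]

variable [FiniteDimensional k V]

lemma sum_coord_smul_e {i : ℕ} {a : DualAlg R} (ha : a ∈ DualAlg.piece R i) :
    ∑ p, K.coord i a p • K.e i p = a := by
  rw [← K.span_e, Submodule.mem_span_range_iff_exists_fun] at ha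
  obtain ⟨c, rfl⟩ := ha
  refine Finset.sum_congr rfl fun p _ => ?_
  simp [coord_e, Finset.sum_apply, Pi.single_apply]

lemma eq_zero_of_coord {i : ℕ} {a : DualAlg R} (ha : a ∈ DualAlg.piece R i)
    (h : K.coord i a = 0) : a = 0 := by
  rw [← K.sum_coord_smul_e ha, h]
  simp

end Rep

end KoszulData

/-! ### Consequences of the Gorenstein condition -/

namespace KoszulData

open QuadAlg MulOpposite

variable {R : Submodule k (V ⊗[k] V)} (K : KoszulData R)

/-- The linear resolution, as a resolution of the trivial module over `Aᵐᵒᵖ`. -/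
@[reducible] def resolution : FreeResolution (QuadAlg R)ᵐᵒᵖ (trivialModule R) where
  b := K.b
  D i := Matrix.of fun q p => op (gen R (K.m i p q))
  ε :=
    { toFun := fun v => (∑ p, aug R (v p).unop : k)
      map_add' := fun v w => by simp [Finset.sum_add_distrib]; rfl
      map_smul' := fun s v => by
        change ∑ p, aug R (s * v p).unop = aug R s.unop * ∑ p, aug R (v p).unop
        simp [Finset.mul_sum, mul_comm] }
  surj c := ⟨fun _ => op (algebraMap k _ (c : k)), by
    change ∑ _p : Fin (K.b 0), aug R (algebraMap k (QuadAlg R) (c : k)) = (c : k)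
    simp only [K.b_zero, Finset.sum_const, Finset.card_univ, Fintype.card_fin, one_smul]
    exact (aug R).commutes (show k from c)⟩
  exact_zero v := by
    have h1 : (∑ p, aug R (v p).unop : k) = 0 ↔ ∀ p, aug R (v p).unop = 0 := by
      have : Unique (Fin (K.b 0)) := by rw [K.b_zero]; infer_instance
      rw [Fintype.sum_unique]
      exact ⟨fun h p => by rwa [Subsingleton.elim p default], fun h => h _⟩
    refine h1.trans ((K.exact_zero fun p => (v p).unop).trans ⟨?_, ?_⟩)
    · rintro ⟨w, hw⟩
      refine ⟨fun q => op (w q), ?_⟩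
      ext p
      refine unop_injective ?_
      rw [← congrFun hw p]
      simp [Matrix.vecMul, Matrix.mulVec, dotProduct]
    · rintro ⟨w, rfl⟩
      refine ⟨fun q => (w q).unop, ?_⟩
      ext p
      simp [Matrix.vecMul, Matrix.mulVec, dotProduct]
  exact_succ i v := by
    have h1 : Matrix.vecMul v (Matrix.of fun q p => op (gen R (K.m i p q))) = 0 ↔
        (K.M i).mulVec (fun p => (v p).unop) = 0 := by
      rw [funext_iff, funext_iff]
      refine forall_congr' fun p => ?_
      rw [← unop_injective.eq_iff]
      simp [Matrix.vecMul, Matrix.mulVec, dotProduct, M]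
    refine h1.trans ((K.exact_succ i fun p => (v p).unop).trans ⟨?_, ?_⟩)
    · rintro ⟨w, hw⟩
      refine ⟨fun q => op (w q), ?_⟩
      ext p
      refine unop_injective ?_
      rw [← congrFun hw p]
      simp [Matrix.vecMul, Matrix.mulVec, dotProduct]
    · rintro ⟨w, rfl⟩
      refine ⟨fun q => (w q).unop, ?_⟩
      ext p
      simp [Matrix.vecMul, Matrix.mulVec, dotProduct]

/-- The differentials of the linear resolution induce zero on `Hom(-, k)`. -/
lemma colMul_trivialModule (i : ℕ) (y : Fin (K.b i) → trivialModule R) :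
    colMul (K.resolution.D i) y = 0 := by
  ext q
  change ∑ p, op (gen R (K.m i p q)) • y p = (0 : trivialModule R)
  refine Finset.sum_eq_zero fun p _ => ?_
  change (aug R (gen R (K.m i p q)) * (show k from y p) : k) = 0
  rw [aug_gen, zero_mul]

lemma colMul_regular (i : ℕ) (y : Fin (K.b i) → QuadAlg R) :
    colMul (K.resolution.D i) y = Matrix.vecMul y (K.M i) := rfl

/-- By minimality of the resolution, a nonzero row over `k` gives a nonzero element of
`Ext^i(k, k)`. -/
lemma b_eq_zero_of_hasProjectiveDimensionLE {d : ℕ}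
    (h : HasProjectiveDimensionLE (trivialModule R) d) {i : ℕ} (hi : d < i) : K.b i = 0 := by
  obtain ⟨i, rfl⟩ : ∃ j, i = j + 1 := ⟨i - 1, by omega⟩
  by_contra hb
  let p : Fin (K.b (i + 1)) := ⟨0, Nat.pos_of_ne_zero hb⟩
  let y : Fin (K.b (i + 1)) → trivialModule R := fun _ => (show k from 1)
  have h2 : K.resolution.extOf (i + 1) y (K.colMul_trivialModule _ y) = 0 :=
    Abelian.Ext.eq_zero_of_hasProjectiveDimensionLT _ (d + 1) hi
  obtain ⟨z, hz⟩ := (K.resolution.extOf_succ_eq_zero_iff i y _).1 h2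
  rw [colMul_trivialModule] at hz
  exact one_ne_zero (α := k) (congrFun hz p).symm

/-- A row of scalars is never a boundary. -/
lemma eq_zero_of_extOf_eq_zero (i : ℕ) (c : Fin (K.b i) → k)
    (h : colMul (K.resolution.D i) (fun p => algebraMap k (QuadAlg R) (c p)) = 0)
    (h0 : K.resolution.extOf i (fun p => algebraMap k (QuadAlg R) (c p)) h = 0) : c = 0 := by
  ext p
  cases i with
  | zero =>
    have h1 : algebraMap k (QuadAlg R) (c p) = 0 :=
      congrFun ((K.resolution.extOf_zero_eq_zero_iff _ h).1 h0) p
    simpa using h1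
  | succ i =>
    obtain ⟨z, hz⟩ := (K.resolution.extOf_succ_eq_zero_iff i _ h).1 h0
    rw [colMul_regular] at hz
    have h1 := congrArg (fun u => proj R 0 (u p)) hz
    have h2 : proj R 0 (algebraMap k (QuadAlg R) (c p)) = 0 :=
      h1.symm.trans (K.proj_zero_vecMul _ _ _)
    rw [proj_self (mem_piece_zero.2 ⟨_, rfl⟩)] at h2
    simpa using h2

lemma smul_extOf (i : ℕ) (c : k) (y : Fin (K.b i) → QuadAlg R)
    (h : colMul (K.resolution.D i) y = 0) (h' : colMul (K.resolution.D i) (c • y) = 0) :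
    c • K.resolution.extOf i y h = K.resolution.extOf i (c • y) h' := by
  rw [Abelian.Ext.smul_eq_comp_mk₀]
  have key : ∀ (g : ModuleCat.of (QuadAlg R)ᵐᵒᵖ (QuadAlg R) ⟶ ModuleCat.of _ (QuadAlg R)) (y'),
      g.hom ∘ y = y' → ∀ h', (K.resolution.extOf i y h).comp (Abelian.Ext.mk₀ g) (add_zero i) =
          K.resolution.extOf i y' h' := by
    rintro g _ rfl h'
    exact K.resolution.extOf_comp_mk₀ i y h g.hom h'
  refine key _ _ ?_ h'
  ext p
  change y p * algebraMap k (QuadAlg R) c = c • y p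
  rw [← Algebra.commutes, Algebra.smul_def]

section Gorenstein

variable {d : ℕ}

lemma b_eq_zero (hG : IsASGorenstein R d) {i : ℕ} (hi : d < i) : K.b i = 0 :=
  K.b_eq_zero_of_hasProjectiveDimensionLE (hG.globalDimension.1 _) hi

lemma exists_vecMul_eq (hG : IsASGorenstein R d) {i : ℕ} (hi : i + 1 ≠ d)
    {r : Fin (K.b (i + 1)) → QuadAlg R}
    (h : Matrix.vecMul r (K.M (i + 1)) = 0) : ∃ z, Matrix.vecMul z (K.M i) = r := by
  have := hG.ext_eq_zero (i + 1) hi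
  exact (K.resolution.extOf_succ_eq_zero_iff i r h).1 (Subsingleton.elim _ _)

lemma eq_zero_of_vecMul_zero (hG : IsASGorenstein R d) (hd : d ≠ 0) {r : Fin (K.b 0) → QuadAlg R}
    (h : Matrix.vecMul r (K.M 0) = 0) : r = 0 := by
  have := hG.ext_eq_zero 0 hd.symm
  exact (K.resolution.extOf_zero_eq_zero_iff r h).1 (Subsingleton.elim _ _)

/-- Rows of scalars embed `k ^ b d` in `Ext^d(k, A)`, which is one-dimensional. -/
lemma b_top (hG : IsASGorenstein R d) : K.b d = 1 := by
  have hco : ∀ y : Fin (K.b d) → QuadAlg R, colMul (K.resolution.D d) y = 0 := fun y => by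
    ext q
    have hq := q.2
    change q.1 < K.b (d + 1) at hq
    rw [K.b_eq_zero hG (Nat.lt_succ_self d)] at hq
    omega
  obtain ⟨Φ⟩ := hG.ext_top
  refine le_antisymm ?_ (Nat.pos_of_ne_zero fun hb => ?_)
  · by_contra hb
    push Not at hb
    let c : Fin 2 → Fin (K.b d) → k := fun j => Pi.single ⟨j.1, by omega⟩ 1
    let y : Fin 2 → Fin (K.b d) → QuadAlg R := fun j p => algebraMap k _ (c j p)
    let E : Fin 2 → k := fun j => Φ (K.resolution.extOf d (y j) (hco _))
    have h1 : K.resolution.extOf d (fun p => algebraMap k (QuadAlg R) ((E 1 • c 0 - E 0 • c 1) p))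
        (hco _) = 0 := by
      apply Φ.injective
      have h2 : (fun p => algebraMap k (QuadAlg R) ((E 1 • c 0 - E 0 • c 1) p)) =
          E 1 • y 0 + (-E 0) • y 1 := by
        ext p
        simp [y, Algebra.smul_def, sub_eq_add_neg]
        exact (neg_mul (α := QuadAlg R) _ _).symm
      have h3 := K.resolution.extOf_add d (E 1 • y 0) ((-E 0) • y 1) (hco _) (hco _)
      rw [← K.smul_extOf d _ _ (hco _), ← K.smul_extOf d _ _ (hco _)] at h3
      simp only [h2]
      rw [h3, map_add, map_smul, map_smul, map_zero]
      change E 1 * E 0 + -E 0 * E 1 = 0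
      ring
    have h4 := K.eq_zero_of_extOf_eq_zero d _ (hco _) h1
    have hE1 : E 1 = 0 := by
      have := congrFun h4 ⟨0, by omega⟩
      simpa [c, Pi.single_apply, Fin.ext_iff] using this
    have h5 : K.resolution.extOf d (y 1) (hco _) = 0 :=
      Φ.injective (by rw [map_zero]; exact hE1)
    have := congrFun (K.eq_zero_of_extOf_eq_zero d (c 1) (hco _) h5) ⟨1, by omega⟩
    simp [c] at this
  · obtain ⟨y, hy, hy1⟩ := K.resolution.extOf_surjective d (Φ.symm 1)
    have : y = 0 := by
      ext p
      have hp := p.2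
      change p.1 < K.b d at hp
      omega
    have h1 := hy1 ▸ (K.smul_extOf d 0 y (hco _) (hco _))
    have h2 : K.resolution.extOf d y hy = 0 := by
      have h3 : (0 : k) • y = y := by rw [this, smul_zero]
      have h4 := K.smul_extOf d 0 y (hco _) (hco _)
      rw [zero_smul] at h4
      simp only [h3] at h4
      exact h4.symm
    rw [hy1] at h2
    simp at h2

/-- No element of `A^!` of degree less than `d` is annihilated by all generators. -/
lemma eq_zero_of_mul_gen (K : KoszulData R) [FiniteDimensional k V]
    (hG : IsASGorenstein R d) {i : ℕ} (hi : i < d)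
    {a : DualAlg R} (ha : a ∈ DualAlg.piece R i) (h : ∀ f, a * DualAlg.gen R f = 0) : a = 0 := by
  refine K.eq_zero_of_coord ha ?_
  set c := K.coord i a with hc
  have h1 : ∀ q, ∑ p, c p • K.m i p q = 0 := fun q => by
    rw [← Module.forall_dual_apply_eq_zero_iff k]
    intro f
    have h2 := congrArg (fun a => K.coord (i + 1) a q) (h f)
    rw [← K.sum_coord_smul_e ha, Finset.sum_mul] at h2
    simp only [smul_mul_assoc, K.e_mul_gen, map_sum, map_smul, K.coord_e, Finset.sum_apply,
      Pi.smul_apply, map_zero, Pi.zero_apply] at h2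
    simpa [Pi.single_apply] using h2
  have h2 : Matrix.vecMul (fun p => algebraMap k (QuadAlg R) (c p)) (K.M i) = 0 := by
    ext q
    rw [vecMul_apply, Pi.zero_apply, ← map_zero (gen R), ← h1 q, map_sum]
    refine Finset.sum_congr rfl fun p _ => ?_
    rw [map_smul, Algebra.smul_def]
  refine K.eq_zero_of_extOf_eq_zero i c h2 ?_
  have := hG.ext_eq_zero i (by omega)
  exact Subsingleton.elim _ _

end Gorenstein

end KoszulData

/-! ### The Frobenius form and the Nakayama automorphism of `A^!` -/

open QuadAlg

/-- `τ` is the functional on `A^!` that reads off the coefficient of the basis `ϖ` of `A^!_d`, and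
the form `τ(ab)` is nondegenerate on both sides. -/
structure IsFrobeniusTrace (R : Submodule k (V ⊗[k] V)) (d : ℕ) (ϖ : DualAlg R)
    (τ : DualAlg R →ₗ[k] k) : Prop where
  mem : ϖ ∈ DualAlg.piece R d
  apply_self : τ ϖ = 1
  eq_smul : ∀ a ∈ DualAlg.piece R d, a = τ a • ϖ
  of_ne : ∀ i, i ≠ d → ∀ a ∈ DualAlg.piece R i, τ a = 0
  left : ∀ a, (∀ y, τ (a * y) = 0) → a = 0
  right : ∀ a, (∀ y, τ (y * a) = 0) → a = 0

section Existence

variable {R : Submodule k (V ⊗[k] V)} {d : ℕ}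

lemma apply_eq_apply_proj {τ : DualAlg R →ₗ[k] k}
    (h : ∀ i, i ≠ d → ∀ a ∈ DualAlg.piece R i, τ a = 0) (a : DualAlg R) :
    τ a = τ (proj (orth R) d a) := by
  induction a using homogeneous_induction with
  | mem j a ha =>
    rw [proj_of_mem ha]
    split_ifs with hj
    · rfl
    · rw [h j hj a ha, map_zero]
  | add a b ha hb => rw [map_add, map_add, map_add, ha, hb]

variable [FiniteDimensional k V]

lemma KoszulData.piece_eq_bot (K : KoszulData R) (hG : IsASGorenstein R d) {i : ℕ} (hi : d < i) :
    DualAlg.piece R i = ⊥ := by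
  have : IsEmpty (Fin (K.b i)) := by rw [K.b_eq_zero hG hi]; infer_instance
  rw [← K.span_e, Set.range_eq_empty, Submodule.span_empty]

lemma KoszulData.finrank_piece (K : KoszulData R) (i : ℕ) :
    Module.finrank k (DualAlg.piece R i) = K.b i := by
  have hli : LinearIndependent k (K.e i) := by
    refine LinearIndependent.of_comp (K.coord i) ?_
    have : K.coord i ∘ K.e i = fun p => Pi.basisFun k (Fin (K.b i)) p := by
      ext p : 1
      simp [K.coord_e]
    rw [this]
    exact (Pi.basisFun k _).linearIndependent
  rw [← K.span_e, finrank_span_eq_card hli, Fintype.card_fin]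

lemma KoszulData.finite_dualAlg (K : KoszulData R) (hG : IsASGorenstein R d) :
    FiniteDimensional k (DualAlg R) := by
  let f : DualAlg R →ₗ[k] (∀ i : Fin (d + 1), Fin (K.b i) → k) :=
    LinearMap.pi fun i => K.coord i
  refine FiniteDimensional.of_injective f ((injective_iff_map_eq_zero f).2 fun a ha => ?_)
  refine eq_zero_of_proj fun i => ?_
  by_cases hi : i ≤ d
  · refine K.eq_zero_of_coord (proj_mem i a) ?_
    have h1 := congrFun ha ⟨i, Nat.lt_succ_of_le hi⟩
    change K.coord i a = 0 at h1
    rw [← h1, KoszulData.coord, LinearMap.comp_apply, LinearMap.comp_apply,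
      proj_self (proj_mem i a)]
  · have := proj_mem (Q := orth R) i a
    change _ ∈ DualAlg.piece R i at this
    rwa [K.piece_eq_bot hG (by omega), Submodule.mem_bot] at this

lemma KoszulData.exists_mul_ne_zero (K : KoszulData R) (hG : IsASGorenstein R d) {i j : ℕ}
    (hij : i + j = d) {a : DualAlg R} (ha : a ∈ DualAlg.piece R i) (h0 : a ≠ 0) :
    ∃ y ∈ DualAlg.piece R j, a * y ≠ 0 := by
  induction j generalizing i a with
  | zero => exact ⟨1, one_mem_piece, by simpa⟩
  | succ j ih =>
    obtain ⟨f, hf⟩ : ∃ f, a * DualAlg.gen R f ≠ 0 := by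
      by_contra h
      push Not at h
      exact h0 (K.eq_zero_of_mul_gen hG (by omega) ha h)
    obtain ⟨y, hy, hy0⟩ := ih (by omega) (mul_gen_mem_piece f ha) hf
    exact ⟨DualAlg.gen R f * y, gen_mul_mem_piece f hy, by rwa [← mul_assoc]⟩

/-- The coefficient of `ϖ` is a Frobenius form: it is nondegenerate on the left because no element
of degree less than `d` is annihilated by all generators, hence also on the right. -/
lemma KoszulData.exists_frobeniusTrace (K : KoszulData R) (hG : IsASGorenstein R d) {ϖ : DualAlg R}
    (hϖ : ϖ ∈ DualAlg.piece R d) (h0 : ϖ ≠ 0) : ∃ τ, IsFrobeniusTrace R d ϖ τ := by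
  have hfin := K.finite_dualAlg hG
  have hsub : ∀ p q : Fin (K.b d), p = q := by
    rw [K.b_top hG]; exact fun p q => Subsingleton.elim _ _
  let p : Fin (K.b d) := ⟨0, by rw [K.b_top hG]; exact one_pos⟩
  have hsum : ∀ a ∈ DualAlg.piece R d, K.coord d a p • K.e d p = a := fun a ha => by
    have h1 := K.sum_coord_smul_e ha
    rwa [Finset.sum_eq_single p (fun q _ hq => (hq (hsub _ _)).elim) (by simp)] at h1
  set c := K.coord d ϖ p with hc
  have hc0 : c ≠ 0 := fun h => h0 (by rw [← hsum ϖ hϖ, ← hc, h, zero_smul])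
  let τ : DualAlg R →ₗ[k] k := c⁻¹ • (LinearMap.proj p ∘ₗ K.coord d)
  have hτ : ∀ a, τ a = c⁻¹ * K.coord d a p := fun a => rfl
  have h1 : ∀ a ∈ DualAlg.piece R d, a = τ a • ϖ := fun a ha => by
    conv_lhs => rw [← hsum a ha]
    rw [← hsum ϖ hϖ, ← hc, hτ, smul_smul, mul_right_comm, inv_mul_cancel₀ hc0, one_mul]
  have h2 : ∀ i, i ≠ d → ∀ a ∈ DualAlg.piece R i, τ a = 0 := fun i hi a ha => by
    rw [hτ, K.coord_of_ne hi ha, Pi.zero_apply, mul_zero]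
  have hleft : ∀ a, (∀ y, τ (a * y) = 0) → a = 0 := by
    intro a ha
    refine eq_zero_of_proj fun i => ?_
    by_cases hi : i ≤ d
    · by_contra hne
      obtain ⟨y, hy, hy0⟩ := K.exists_mul_ne_zero hG (Nat.add_sub_of_le hi) (proj_mem i a) hne
      have hy1 : τ (a * y) = τ (proj (orth R) i a * y) := by
        clear ha hne hy0
        induction a using homogeneous_induction with
        | mem j a ha =>
          rw [proj_of_mem ha]
          split_ifs with hj
          · rfl
          · rw [zero_mul, map_zero, h2 _ _ _ (mul_mem_piece ha hy)]
            omega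
        | add a b ha hb => rw [map_add, add_mul, add_mul, map_add, map_add, ha, hb]
      rw [ha] at hy1
      have hmem : proj (orth R) i a * y ∈ DualAlg.piece R d := by
        have := mul_mem_piece (proj_mem i a) hy
        rwa [Nat.add_sub_of_le hi] at this
      exact hy0 (by rw [h1 _ hmem, ← hy1, zero_smul])
    · have := proj_mem (Q := orth R) i a
      change _ ∈ DualAlg.piece R i at this
      rwa [K.piece_eq_bot hG (by omega), Submodule.mem_bot] at this
  refine ⟨τ, hϖ, by rw [hτ, ← hc, inv_mul_cancel₀ hc0], h1, h2, hleft, fun a ha => ?_⟩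
  -- every functional is of the form `τ (y * ·)`, by the count of dimensions
  let Λ : DualAlg R →ₗ[k] Module.Dual k (DualAlg R) := LinearMap.mul k (DualAlg R) |>.compr₂ τ
  have hΛ : Function.Injective Λ := (injective_iff_map_eq_zero Λ).2 fun y hy =>
    hleft y fun z => LinearMap.congr_fun hy z
  have hΛ' : Function.Surjective Λ :=
    (LinearMap.injective_iff_surjective_of_finrank_eq_finrank
      (Subspace.dual_finrank_eq (K := k) (V := DualAlg R)).symm).1 hΛ
  rw [← Module.forall_dual_apply_eq_zero_iff k]
  intro f
  obtain ⟨y, rfl⟩ := hΛ' f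
  exact ha y

/-- In global dimension zero there are no generators, which makes the case `d = 0` of the
statements about `A^!_{d-1}` vacuous. -/
lemma KoszulData.n_eq_zero (K : KoszulData R) (hG : IsASGorenstein R d) {n : ℕ}
    (x : Module.Basis (Fin n) k V) (hd : d = 0) : n = 0 := by
  by_contra hn
  let i : Fin n := ⟨0, Nat.pos_of_ne_zero hn⟩
  have h1 : DualAlg.gen R (x.coord i) ∈ DualAlg.piece R 1 := gen_mem_piece _
  rw [K.piece_eq_bot hG (by omega), Submodule.mem_bot] at h1
  have h2 : x.coord i = 0 := gen_injective (h1.trans (map_zero _).symm)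
  simpa using LinearMap.congr_fun h2 (x i)

end Existence

namespace IsFrobeniusTrace

variable {R : Submodule k (V ⊗[k] V)} {d : ℕ} {ϖ : DualAlg R} {τ : DualAlg R →ₗ[k] k}
  (h : IsFrobeniusTrace R d ϖ τ)
include h

lemma right_of_mem {i j : ℕ} (hij : i + j = d) {a : DualAlg R} (ha : a ∈ DualAlg.piece R i)
    (h0 : ∀ y ∈ DualAlg.piece R j, τ (y * a) = 0) : a = 0 := by
  refine h.right a fun y => ?_
  induction y using homogeneous_induction with
  | mem j' y hy =>
    by_cases hj : j' = j
    · exact h0 y (hj ▸ hy)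
    · exact h.of_ne _ (by omega) _ (mul_mem_piece hy ha)
  | add y z hy hz => rw [add_mul, map_add, hy, hz, add_zero]

lemma left_of_mem {i j : ℕ} (hij : i + j = d) {a : DualAlg R} (ha : a ∈ DualAlg.piece R i)
    (h0 : ∀ y ∈ DualAlg.piece R j, τ (a * y) = 0) : a = 0 := by
  refine h.left a fun y => ?_
  induction y using homogeneous_induction with
  | mem j' y hy =>
    by_cases hj : j' = j
    · exact h0 y (hj ▸ hy)
    · exact h.of_ne _ (by omega) _ (mul_mem_piece ha hy)
  | add y z hy hz => rw [mul_add, map_add, hy, hz, add_zero]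

lemma eq_of_right {a b : DualAlg R} (hab : ∀ y, τ (y * a) = τ (y * b)) : a = b :=
  sub_eq_zero.1 <| h.right _ fun y => by rw [mul_sub, map_sub, hab, sub_self]

lemma eq_of_left {a b : DualAlg R} (hab : ∀ y, τ (a * y) = τ (b * y)) : a = b :=
  sub_eq_zero.1 <| h.left _ fun y => by rw [sub_mul, map_sub, hab, sub_self]

/-- The isomorphism `a ↦ τ (· a)` of `A^!` with its dual. -/
def rightEquiv [FiniteDimensional k (DualAlg R)] : DualAlg R ≃ₗ[k] Module.Dual k (DualAlg R) :=
  LinearEquiv.ofInjectiveOfFinrankEq ((LinearMap.mul k (DualAlg R)).flip.compr₂ τ)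
    ((injective_iff_map_eq_zero _).2 fun a ha => h.right a fun y => LinearMap.congr_fun ha y)
    (Subspace.dual_finrank_eq (K := k) (V := DualAlg R)).symm

lemma rightEquiv_apply [FiniteDimensional k (DualAlg R)] (a y) : h.rightEquiv a y = τ (y * a) := rfl

/-- The isomorphism `a ↦ τ (a ·)` of `A^!` with its dual. -/
def leftEquiv [FiniteDimensional k (DualAlg R)] : DualAlg R ≃ₗ[k] Module.Dual k (DualAlg R) :=
  LinearEquiv.ofInjectiveOfFinrankEq ((LinearMap.mul k (DualAlg R)).compr₂ τ)
    ((injective_iff_map_eq_zero _).2 fun a ha => h.left a fun y => LinearMap.congr_fun ha y)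
    (Subspace.dual_finrank_eq (K := k) (V := DualAlg R)).symm

lemma leftEquiv_apply [FiniteDimensional k (DualAlg R)] (a y) : h.leftEquiv a y = τ (a * y) := rfl

/-- The Nakayama automorphism is characterized by the trace. -/
lemma apply_mul_of_isNakayamaAut {φ : DualAlg R ≃ₐ[k] DualAlg R} (hφ : IsNakayamaAut R d φ) (y b) :
    τ (y * φ b) = τ (b * y) := by
  obtain ⟨-, Θ, h1, h2, h3⟩ := hφ
  have h4 : ∀ a y, Θ a y = Θ 1 (y * a) := fun a y => by rw [← h1, mul_one]
  have h5 : ∀ i, i ≠ d → ∀ a ∈ DualAlg.piece R i, Θ 1 a = 0 := fun i hi a ha =>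
    h3 0 i (by omega) 1 one_mem_piece a ha
  have h6 : ∀ a, Θ 1 a = Θ 1 ϖ * τ a := fun a => by
    rw [apply_eq_apply_proj h5 a, apply_eq_apply_proj h.of_ne a]
    conv_lhs => rw [h.eq_smul _ (proj_mem d a)]
    rw [map_smul, smul_eq_mul, mul_comm]
  have h7 : Θ 1 ϖ ≠ 0 := fun h0 => by
    have : Θ 1 = 0 := LinearMap.ext fun a => by rw [h6, h0, zero_mul]; rfl
    exact one_ne_zero (Θ.map_eq_zero_iff.1 this)
  have h8 := h2 1 b y
  rw [one_mul, h4, h6 (y * φ b), h6 (b * y)] at h8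
  exact mul_left_cancel₀ h7 h8

lemma isNakayamaAut_of_apply_mul [FiniteDimensional k (DualAlg R)]
    {φ : DualAlg R ≃ₐ[k] DualAlg R} (hφ : ∀ y b, τ (y * φ b) = τ (b * y)) :
    IsNakayamaAut R d φ := by
  refine ⟨fun i b hb => ?_, h.rightEquiv, fun a b y => ?_, fun a b y => ?_,
    fun i j hij a ha y hy => ?_⟩
  · suffices φ b = proj (orth R) i (φ b) by rw [this]; exact proj_mem _ _
    refine h.eq_of_right fun y => ?_
    induction y using homogeneous_induction with
    | mem j y hy =>
      by_cases hj : j + i = d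
      · have h1 : ∀ c : DualAlg R, τ (y * c) = τ (y * proj (orth R) i c) := fun c => by
          induction c using homogeneous_induction with
          | mem l c hc =>
            rw [proj_of_mem hc]
            split_ifs with hl
            · rfl
            · rw [mul_zero, map_zero, h.of_ne _ _ _ (mul_mem_piece hy hc)]
              omega
          | add c c' hc hc' => rw [map_add, mul_add, mul_add, map_add, map_add, hc, hc']
        exact h1 _
      · rw [hφ, h.of_ne _ (by omega) _ (mul_mem_piece hb hy),
          h.of_ne _ hj _ (mul_mem_piece hy (proj_mem _ _))]
    | add y z hy hz => rw [add_mul, add_mul, map_add, map_add, hy, hz]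
  · rw [rightEquiv_apply, rightEquiv_apply, mul_assoc]
  · rw [rightEquiv_apply, rightEquiv_apply, ← mul_assoc, hφ, mul_assoc]
  · rw [rightEquiv_apply]
    exact h.of_ne _ (by omega) _ (mul_mem_piece hy ha)

/-- The Nakayama automorphism compares the two isomorphisms of `A^!` with its dual. -/
lemma exists_isNakayamaAut [FiniteDimensional k (DualAlg R)] : ∃! φ, IsNakayamaAut R d φ := by
  let f : DualAlg R ≃ₗ[k] DualAlg R := h.leftEquiv.trans h.rightEquiv.symm
  have hf : ∀ y b, τ (y * f b) = τ (b * y) := fun y b => by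
    rw [← h.rightEquiv_apply, ← h.leftEquiv_apply, LinearEquiv.trans_apply,
      LinearEquiv.apply_symm_apply]
  let φ : DualAlg R ≃ₐ[k] DualAlg R := AlgEquiv.ofLinearEquiv f
    (h.eq_of_right fun y => by rw [hf, one_mul, mul_one])
    (fun a b => h.eq_of_right fun y => by
      rw [hf, ← mul_assoc y, hf, ← mul_assoc, hf, mul_assoc])
  refine ⟨φ, h.isNakayamaAut_of_apply_mul hf, fun φ' hφ' => ?_⟩
  ext b
  refine h.eq_of_right fun y => ?_
  rw [h.apply_mul_of_isNakayamaAut hφ']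
  exact (hf y b).symm

section DualBasis

variable {n : ℕ} (x : Module.Basis (Fin n) k V)

omit h in
lemma gen_eq_sum (f : Module.Dual k V) :
    DualAlg.gen R f = ∑ i, f (x i) • DualAlg.gen R (x.coord i) := by
  conv_lhs => rw [← x.sum_dual_apply_smul_coord f]
  rw [map_sum]
  simp only [map_smul]

lemma mul_eq_of_mem {i : Fin n} {a : DualAlg R} (hd : d ≠ 0)
    (ha : a ∈ DualAlg.piece R (d - 1)) :
    DualAlg.gen R (x.coord i) * a = τ (DualAlg.gen R (x.coord i) * a) • ϖ := by
  refine h.eq_smul _ ?_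
  have := gen_mul_mem_piece (x.coord i) ha
  rwa [Nat.sub_add_cancel (Nat.pos_of_ne_zero hd)] at this

lemma eq_zero_of_coord_mul {a : DualAlg R} (hd : d ≠ 0) (ha : a ∈ DualAlg.piece R (d - 1))
    (h0 : ∀ i, τ (DualAlg.gen R (x.coord i) * a) = 0) : a = 0 := by
  refine h.right_of_mem (j := 1) (by omega) ha fun y hy => ?_
  obtain ⟨f, rfl⟩ := mem_piece_one.1 hy
  rw [gen_eq_sum x, Finset.sum_mul, map_sum]
  refine Finset.sum_eq_zero fun i _ => ?_
  rw [smul_mul_assoc, map_smul, h0, smul_zero]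

/-- The elements `wⱼ` represent the functionals `f ↦ f(xⱼ)` on `A^!_1` through the Frobenius
form. -/
lemma existsUnique_isDualBasisTo [FiniteDimensional k (DualAlg R)] (hn : d = 0 → n = 0) :
    ∃! w, IsDualBasisTo R x d ϖ w := by
  by_cases hd : d = 0
  · obtain rfl := hn hd
    refine ⟨Fin.elim0, ⟨linearIndependent_empty_type, ?_, fun i => i.elim0⟩,
      fun w _ => funext fun i => i.elim0⟩
    rw [if_pos hd, Set.range_eq_empty, Submodule.span_empty]
  · obtain ⟨g, hg⟩ := (DualAlg.gen R).exists_leftInverse_of_injective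
      (LinearMap.ker_eq_bot.2 gen_injective)
    let w : Fin n → DualAlg R := fun j => proj (orth R) (d - 1) (h.rightEquiv.symm
      (Module.Dual.eval k V (x j) ∘ₗ g))
    have hw : ∀ j, w j ∈ DualAlg.piece R (d - 1) := fun j => proj_mem _ _
    have hproj : ∀ (f : Module.Dual k V) (a : DualAlg R),
        τ (DualAlg.gen R f * proj (orth R) (d - 1) a) = τ (DualAlg.gen R f * a) := by
      intro f a
      rw [apply_eq_apply_proj h.of_ne (DualAlg.gen R f * a)]
      obtain ⟨d, rfl⟩ : ∃ e, d = e + 1 := ⟨d - 1, by omega⟩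
      rw [proj_gen_mul, Nat.add_sub_cancel]
    have hτ : ∀ i j, τ (DualAlg.gen R (x.coord i) * w j) = if i = j then 1 else 0 := by
      intro i j
      rw [hproj, ← h.rightEquiv_apply, LinearEquiv.apply_symm_apply, LinearMap.comp_apply]
      have := LinearMap.congr_fun hg (x.coord i)
      rw [LinearMap.comp_apply, LinearMap.id_apply] at this
      rw [this]
      simp [Finsupp.single_apply, eq_comm]
    have hmul : ∀ i j, DualAlg.gen R (x.coord i) * w j = if i = j then ϖ else 0 := by
      intro i j
      rw [h.mul_eq_of_mem x hd (hw j), hτ]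
      split_ifs <;> simp
    refine ⟨w, ⟨?_, ?_, hmul⟩, fun w' hw' => ?_⟩
    · rw [Fintype.linearIndependent_iff]
      intro c hc i
      have := congrArg (fun a => τ (DualAlg.gen R (x.coord i) * a)) hc
      simpa [Finset.mul_sum, hτ] using this
    · rw [if_neg hd]
      refine le_antisymm (Submodule.span_le.2 ?_) fun a ha => ?_
      · rintro _ ⟨j, rfl⟩; exact hw j
      · have : a - ∑ j, τ (DualAlg.gen R (x.coord j) * a) • w j = 0 := by
          refine h.eq_zero_of_coord_mul x hd (sub_mem ha (Submodule.sum_mem _ fun j _ =>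
            Submodule.smul_mem _ _ (hw j))) fun i => ?_
          simp [mul_sub, Finset.mul_sum, hτ]
        rw [sub_eq_zero.1 this]
        exact Submodule.sum_mem _ fun j _ => Submodule.smul_mem _ _
          (Submodule.subset_span ⟨j, rfl⟩)
    · ext j
      have hw'mem : w' j ∈ DualAlg.piece R (d - 1) := by
        have := hw'.span_eq
        rw [if_neg hd] at this
        rw [← this]
        exact Submodule.subset_span ⟨j, rfl⟩
      refine sub_eq_zero.1 (h.eq_zero_of_coord_mul x hd (sub_mem hw'mem (hw j)) fun i => ?_)
      rw [mul_sub, hw'.mul_eq, hmul, sub_self, map_zero]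

lemma existsUnique_smul {w : Fin n → DualAlg R} (hn : d = 0 → n = 0)
    (hw : IsDualBasisTo R x d ϖ w) {δ : DualAlg R → DualAlg R}
    (hδ : ∀ i, ∀ a ∈ DualAlg.piece R i, δ a ∈ DualAlg.piece R (i + 1)) :
    ∃! l : Fin n → k, ∀ i, δ (w i) = l i • ϖ := by
  refine ⟨fun i => τ (δ (w i)), fun i => h.eq_smul _ ?_, fun l hl => funext fun i => ?_⟩
  · by_cases hd : d = 0
    · obtain rfl := hn hd
      exact i.elim0
    · have hwi : w i ∈ DualAlg.piece R (d - 1) := by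
        have := hw.span_eq
        rw [if_neg hd] at this
        rw [← this]
        exact Submodule.subset_span ⟨i, rfl⟩
      have := hδ _ _ hwi
      rwa [Nat.sub_add_cancel (Nat.pos_of_ne_zero hd)] at this
  · rw [hl, map_smul, h.apply_self, smul_eq_mul, mul_one]

/-- The functional `τ ∘ δ` is represented by the element `∑ λⱼ xⱼ*` of degree one. -/
lemma apply_derivation {w : Fin n → DualAlg R}
    (hw : IsDualBasisTo R x d ϖ w) {δ : DualAlg R →ₗ[k] DualAlg R}
    (hδ : ∀ i, ∀ a ∈ DualAlg.piece R i, δ a ∈ DualAlg.piece R (i + 1))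
    {l : Fin n → k} (hl : ∀ i, δ (w i) = l i • ϖ) (y : DualAlg R) :
    τ (δ y) = τ ((∑ j, l j • DualAlg.gen R (x.coord j)) * y) := by
  have hlam : ∑ j, l j • DualAlg.gen R (x.coord j) ∈ DualAlg.piece R 1 :=
    Submodule.sum_mem _ fun j _ => Submodule.smul_mem _ _ (gen_mem_piece _)
  induction y using homogeneous_induction with
  | mem i y hy =>
    by_cases hi : i + 1 = d
    · have hd : d ≠ 0 := by omega
      have hspan := hw.span_eq
      rw [if_neg hd, show d - 1 = i by omega] at hspan
      change y ∈ DualAlg.piece R i at hy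
      rw [← hspan] at hy
      induction hy using Submodule.span_induction with
      | mem y hy =>
        obtain ⟨j, rfl⟩ := hy
        simp [hl, Finset.sum_mul, hw.mul_eq, apply_ite, h.apply_self]
      | zero => simp
      | add a b _ _ ha hb => rw [map_add, map_add, mul_add, map_add, ha, hb]
      | smul c a _ ha => rw [map_smul, map_smul, mul_smul_comm, map_smul, ha]
    · rw [h.of_ne _ hi _ (hδ i y hy), h.of_ne _ (by omega) _ (mul_mem_piece hlam hy)]
  | add a b ha hb => rw [map_add, map_add, mul_add, map_add, ha, hb]

end DualBasis

end IsFrobeniusTrace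

/-! ### The deformed algebra and the PBW property in low degrees -/

namespace DefAlg

variable {R : Submodule k (V ⊗[k] V)} (ν : R →ₗ[k] V) (θ : R →ₗ[k] k)

lemma mk_surjective : Function.Surjective (DefAlg.mk ν θ) := RingQuot.mkAlgHom_surjective _ _

lemma lift_gen : TensorAlgebra.lift k (gen ν θ) = DefAlg.mk ν θ := by
  ext w; simp [gen]

lemma lift_gen_surjective : Function.Surjective (TensorAlgebra.lift k (gen ν θ)) := by
  rw [lift_gen]; exact mk_surjective ν θ

lemma mk_tensorTwo (t : V ⊗[k] V) : DefAlg.mk ν θ (tensorTwo k V t) =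
    LinearMap.mul' k _ (TensorProduct.map (gen ν θ) (gen ν θ) t) := by
  rw [← lift_gen, lift_tensorTwo]

lemma mul_gen (r : R) : LinearMap.mul' k _ (TensorProduct.map (gen ν θ) (gen ν θ) (r : V ⊗[k] V)) =
    gen ν θ (ν r) + algebraMap k _ (θ r) := by
  rw [← mk_tensorTwo, DefAlg.mk, RingQuot.mkAlgHom_rel k (DefRel.of r), map_add, AlgHom.commutes]
  rfl

variable {ν θ}

/-- The universal property of `U`. -/
def lift {B : Type u} [Ring B] [Algebra k B] (f : V →ₗ[k] B)
    (h : ∀ r : R, LinearMap.mul' k B (TensorProduct.map f f (r : V ⊗[k] V)) =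
      f (ν r) + algebraMap k B (θ r)) : DefAlg ν θ →ₐ[k] B :=
  RingQuot.liftAlgHom k ⟨TensorAlgebra.lift k f, by
    rintro _ _ ⟨r⟩
    rw [lift_tensorTwo, h r, map_add, TensorAlgebra.lift_ι_apply, AlgHom.commutes]⟩

@[simp] lemma lift_apply_gen {B : Type u} [Ring B] [Algebra k B] (f : V →ₗ[k] B)
    (h : ∀ r : R, LinearMap.mul' k B (TensorProduct.map f f (r : V ⊗[k] V)) =
      f (ν r) + algebraMap k B (θ r)) (v : V) : lift f h (gen ν θ v) = f v := by
  simp [lift, gen, DefAlg.mk]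

end DefAlg

section PBW

variable {R : Submodule k (V ⊗[k] V)} {ν : R →ₗ[k] V} {θ : R →ₗ[k] k}

lemma tensorTwo_mem (t : V ⊗[k] V) :
    tensorTwo k V t ∈ LinearMap.range (TensorAlgebra.ι k (M := V)) ^ 2 := by
  induction t using TensorProduct.induction_on with
  | zero => simp
  | tmul v w =>
    rw [tensorTwo_tmul, pow_two]
    exact Submodule.mul_mem_mul ⟨v, rfl⟩ ⟨w, rfl⟩
  | add a b ha hb => rw [map_add]; exact add_mem ha hb

/-- The leading term of a relation of degree two among the generators of `U` lies in `R`. -/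
lemma IsPBWDeformation.mem_of_eq (hU : IsPBWDeformation ν θ) {t : V ⊗[k] V} {v : V} {c : k}
    (h : DefAlg.mk ν θ (tensorTwo k V t) + DefAlg.gen ν θ v + algebraMap k _ c = 0) : t ∈ R := by
  rw [← mk_tensorTwo_eq_zero_iff]
  refine hU 2 _ (tensorTwo_mem t) ?_
  have h1 : DefAlg.mk ν θ (tensorTwo k V t) = -(DefAlg.gen ν θ v + algebraMap k _ c) :=
    eq_neg_of_add_eq_zero_left (by rw [← add_assoc]; exact h)
  rw [h1, DefAlg.filtrationBelow, pow_one]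
  refine neg_mem (add_mem ?_ ?_)
  · exact Submodule.mem_sup_right ⟨v, rfl⟩
  · exact Submodule.mem_sup_left (Submodule.mem_one.2 ⟨c, rfl⟩)

/-- The generators of `U` and `1` satisfy no linear relation. -/
lemma IsPBWDeformation.eq_zero_of_eq (hU : IsPBWDeformation ν θ) {v : V} {c : k}
    (h : DefAlg.gen ν θ v + algebraMap k _ c = 0) : v = 0 ∧ c = 0 := by
  have hv : v = 0 := by
    refine gen_injective (Q := R) ?_
    rw [map_zero]
    refine hU 1 (TensorAlgebra.ι k v) (by rw [pow_one]; exact ⟨v, rfl⟩) ?_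
    rw [DefAlg.filtrationBelow, pow_zero]
    refine Submodule.mem_one.2 ⟨-c, ?_⟩
    rw [map_neg]
    exact (eq_neg_of_add_eq_zero_left h).symm
  refine ⟨hv, ?_⟩
  rw [hv, map_zero, zero_add] at h
  have := hU 0 (algebraMap k _ c) (by rw [pow_zero]; exact Submodule.mem_one.2 ⟨c, rfl⟩) (by
    rw [AlgHom.commutes, h]; exact zero_mem _)
  rw [AlgHom.commutes] at this
  simpa using this

end PBW

section DegreeTwo

variable (R : Submodule k (V ⊗[k] V))

variable {R} in
lemma Represents.unique {a a' : DualAlg R} {g : Module.Dual k R} (h : Represents R a g)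
    (h' : Represents R a' g) : a = a' := by
  obtain ⟨t, rfl, ht⟩ := h
  obtain ⟨t', rfl, ht'⟩ := h'
  rw [← sub_eq_zero, ← map_sub, ← map_sub]
  refine mk_tensorTwo_of_mem ((Submodule.mem_dualAnnihilator _).2 fun r hr => ?_)
  rw [map_sub, LinearMap.sub_apply, ht ⟨r, hr⟩, ht' ⟨r, hr⟩, sub_self]

variable [FiniteDimensional k V]

/-- The identification of `R^*` with `A^!_2`. A functional on `R` is first extended to `V ⊗ V`; the
result does not depend on the extension. -/
def ofDual : Module.Dual k R →ₗ[k] DualAlg R :=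
  (QuadAlg.mk (orth R)).toLinearMap ∘ₗ tensorTwo k _ ∘ₗ
    (TensorProduct.dualDistribEquiv k V V).symm.toLinearMap ∘ₗ
      (R.subtype.exists_leftInverse_of_injective R.ker_subtype).choose.dualMap

lemma represents_ofDual (g : Module.Dual k R) : Represents R (ofDual R g) g := by
  refine ⟨_, rfl, fun r => ?_⟩
  refine (LinearMap.congr_fun
    ((TensorProduct.dualDistribEquiv k V V).apply_symm_apply _) _).trans ?_
  have h := (R.subtype.exists_leftInverse_of_injective R.ker_subtype).choose_spec
  have := LinearMap.congr_fun h r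
  rw [LinearMap.comp_apply, LinearMap.id_apply, Submodule.subtype_apply] at this
  rw [LinearMap.dualMap_apply, this]

variable {R}

lemma Represents.eq_ofDual {a : DualAlg R} {g : Module.Dual k R} (h : Represents R a g) :
    a = ofDual R g := h.unique (represents_ofDual R g)

lemma mk_tensorTwo_eq_ofDual (t : Module.Dual k V ⊗[k] Module.Dual k V) :
    QuadAlg.mk (orth R) (tensorTwo k _ t) =
      ofDual R (TensorProduct.dualDistrib k V V t ∘ₗ R.subtype) :=
  Represents.eq_ofDual ⟨t, rfl, fun _ => rfl⟩

lemma ofDual_mem (g : Module.Dual k R) : ofDual R g ∈ DualAlg.piece R 2 := by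
  have := tensorTwo_mem ((TensorProduct.dualDistribEquiv k V V).symm
    ((R.subtype.exists_leftInverse_of_injective R.ker_subtype).choose.dualMap g))
  have h2 := Submodule.mem_map_of_mem (f := (QuadAlg.mk (orth R)).toLinearMap) this
  rw [Submodule.map_pow, ← LinearMap.range_comp] at h2
  exact h2

lemma ofDual_injective : Function.Injective (ofDual R) := by
  refine (injective_iff_map_eq_zero _).2 fun g hg => ?_
  obtain ⟨t, ht, htg⟩ := represents_ofDual R g
  rw [hg] at ht
  have := (Submodule.mem_dualAnnihilator _).1 (mk_tensorTwo_eq_zero_iff.1 ht.symm)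
  refine LinearMap.ext fun r => ?_
  rw [← htg]
  exact this _ r.2

end DegreeTwo

/-! ### The Maurer–Cartan equation -/

section MaurerCartan

variable [FiniteDimensional k V] {R : Submodule k (V ⊗[k] V)} (ν : R →ₗ[k] V) (θ : R →ₗ[k] k)
  {n : ℕ} (x : Module.Basis (Fin n) k V) {B : Type u} [Ring B] [Algebra k B] (f : V →ₗ[k] B)

/-- The element `∑ᵢ f(xᵢ) ⊗ xᵢ*` of `B ⊗ A^!`. -/
def canonicalElt : B ⊗[k] DualAlg R := ∑ i, f (x i) ⊗ₜ DualAlg.gen R (x.coord i)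

/-- The canonical element of `R ⊗ R^*`, written in a basis of `V` and in a basis of `R`. -/
lemma sum_tmul_mul (g : V ⊗[k] V →ₗ[k] B) :
    ∑ i, ∑ j, g (x i ⊗ₜ x j) ⊗ₜ[k] (DualAlg.gen R (x.coord i) * DualAlg.gen R (x.coord j)) =
      ∑ s, g (Module.finBasis k R s : V ⊗[k] V) ⊗ₜ[k] ofDual R ((Module.finBasis k R).coord s) := by
  set r := Module.finBasis k R
  have h1 : ∀ i j, DualAlg.gen R (x.coord i) * DualAlg.gen R (x.coord j) =
      ∑ s, TensorProduct.dualDistrib k V V (x.coord i ⊗ₜ x.coord j) (r s : V ⊗[k] V) •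
        ofDual R (r.coord s) := by
    intro i j
    have h2 := mk_tensorTwo_eq_ofDual (R := R) (x.coord i ⊗ₜ x.coord j)
    rw [tensorTwo_tmul, map_mul, mk_ι, mk_ι] at h2
    rw [h2, ← r.sum_dual_apply_smul_coord (TensorProduct.dualDistrib k V V _ ∘ₗ R.subtype), map_sum]
    simp only [map_smul]
    rfl
  have h3 : ∀ t : V ⊗[k] V, t = ∑ i, ∑ j,
      TensorProduct.dualDistrib k V V (x.coord i ⊗ₜ x.coord j) t • (x i ⊗ₜ[k] x j) := by
    intro t
    conv_lhs => rw [← (x.tensorProduct x).sum_repr t]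
    rw [Fintype.sum_prod_type]
    refine Finset.sum_congr rfl fun i _ => Finset.sum_congr rfl fun j _ => ?_
    rw [Module.Basis.tensorProduct_apply]
    congr 1
    induction t using TensorProduct.induction_on with
    | zero => simp
    | tmul v w => simp [mul_comm]
    | add a b ha hb => simp only [map_add, Finsupp.add_apply, ha, hb]
  have h4 : ∀ s, g (r s : V ⊗[k] V) = ∑ i, ∑ j,
      TensorProduct.dualDistrib k V V (x.coord i ⊗ₜ x.coord j) (r s : V ⊗[k] V) •
        g (x i ⊗ₜ[k] x j) := by
    intro s
    conv_lhs => rw [h3 (r s : V ⊗[k] V)]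
    simp only [map_sum, map_smul]
  simp only [h1, h4, TensorProduct.tmul_sum, TensorProduct.sum_tmul, TensorProduct.tmul_smul,
    TensorProduct.smul_tmul']
  exact (Finset.sum_congr rfl fun i _ => Finset.sum_comm).trans Finset.sum_comm

/-- The product of the canonical element with itself, in a basis of `R`. -/
lemma canonicalElt_mul_self : canonicalElt (R := R) x f * canonicalElt x f =
    ∑ s, LinearMap.mul' k B (TensorProduct.map f f (Module.finBasis k R s : V ⊗[k] V)) ⊗ₜ[k]
      ofDual R ((Module.finBasis k R).coord s) := by
  refine Eq.trans ?_ (sum_tmul_mul x (LinearMap.mul' k B ∘ₗ TensorProduct.map f f))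
  simp only [canonicalElt, Finset.sum_mul, Finset.mul_sum, Algebra.TensorProduct.tmul_mul_tmul,
    LinearMap.comp_apply, TensorProduct.map_tmul, LinearMap.mul'_apply]
  exact Finset.sum_comm

/-- The map `V^* → A^!_2` transpose to `ν`. -/
def eta : Module.Dual k V →ₗ[k] DualAlg R := ofDual R ∘ₗ ν.dualMap

/-- The right-hand side of the Maurer–Cartan equation, in a basis of `R`. -/
lemma sum_tmul_eta : ∑ i, f (x i) ⊗ₜ[k] eta ν (x.coord i) + (1 : B) ⊗ₜ[k] ofDual R θ =
    ∑ s, (f (ν (Module.finBasis k R s)) + algebraMap k B (θ (Module.finBasis k R s))) ⊗ₜ[k]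
      ofDual R ((Module.finBasis k R).coord s) := by
  set r := Module.finBasis k R
  simp only [TensorProduct.add_tmul, Finset.sum_add_distrib]
  congr 1
  · have h1 : ∀ i, eta ν (x.coord i) =
        ∑ s, x.coord i (ν (r s)) • ofDual R (r.coord s) := fun i => by
      rw [eta, LinearMap.comp_apply, ← r.sum_dual_apply_smul_coord (ν.dualMap (x.coord i)), map_sum]
      simp only [map_smul]
      rfl
    have h2 : ∀ s, f (ν (r s)) = ∑ i, x.coord i (ν (r s)) • f (x i) := fun s => by
      conv_lhs => rw [← x.sum_repr (ν (r s))]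
      rw [map_sum]
      simp only [map_smul, Module.Basis.coord_apply]
    simp only [h1, h2, TensorProduct.tmul_sum, TensorProduct.sum_tmul, TensorProduct.tmul_smul,
      TensorProduct.smul_tmul']
    exact Finset.sum_comm
  · conv_lhs => rw [← r.sum_dual_apply_smul_coord θ, map_sum]
    simp only [map_smul, TensorProduct.tmul_sum, TensorProduct.tmul_smul,
      TensorProduct.smul_tmul', Algebra.algebraMap_eq_smul_one]

/-- Evaluation of the second factor of a tensor product at a functional. -/
def slice {E : Type u} [AddCommGroup E] [Module k E] (χ : Module.Dual k E) : B ⊗[k] E →ₗ[k] B :=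
  (TensorProduct.rid k B).toLinearMap ∘ₗ LinearMap.lTensor B χ

@[simp] lemma slice_tmul {E : Type u} [AddCommGroup E] [Module k E] (χ : Module.Dual k E) (b : B)
    (a : E) : slice χ (b ⊗ₜ[k] a) = χ a • b := by
  simp [slice]

/-- A linear map `f : V → B` extends to an algebra map `U → B` if and only if its canonical element
satisfies the Maurer–Cartan equation. -/
lemma maurerCartan_iff :
    canonicalElt (R := R) x f * canonicalElt x f =
      ∑ i, f (x i) ⊗ₜ[k] eta ν (x.coord i) + (1 : B) ⊗ₜ[k] ofDual R θ ↔
    ∀ r : R, LinearMap.mul' k B (TensorProduct.map f f (r : V ⊗[k] V)) =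
      f (ν r) + algebraMap k B (θ r) := by
  rw [canonicalElt_mul_self, sum_tmul_eta]
  constructor
  · intro h
    obtain ⟨q, hq⟩ := (ofDual R).exists_leftInverse_of_injective
      (LinearMap.ker_eq_bot.2 ofDual_injective)
    have h1 : ∀ s, LinearMap.mul' k B
        (TensorProduct.map f f (Module.finBasis k R s : V ⊗[k] V)) =
        f (ν (Module.finBasis k R s)) + algebraMap k B (θ (Module.finBasis k R s)) := by
      intro s
      have h2 := congrArg (slice (Module.Dual.eval k R (Module.finBasis k R s) ∘ₗ q)) h
      have hq' : ∀ g, q (ofDual R g) = g := fun g => LinearMap.congr_fun hq g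
      simpa [hq', Finsupp.single_apply, -smul_add] using h2
    intro r
    have h3 : LinearMap.mul' k B ∘ₗ TensorProduct.map f f ∘ₗ R.subtype =
        f ∘ₗ ν + Algebra.linearMap k B ∘ₗ θ := (Module.finBasis k R).ext h1
    exact LinearMap.congr_fun h3 r
  · intro h
    simp only [h]

end MaurerCartan

/-! ### The dual curved differential graded algebra -/

section RingIdentities

variable {A : Type*} [Ring A]

lemma neg_mul_neg_add_mul_zero (a b c : A) : -a * -b + c * 0 = a * b := by simp

lemma neg_mul_add_mul (a b c e : A) : -a * b + c * e = c * e - a * b := by noncomm_ring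

lemma add_neg_one_pow_one_mul (x y : A) : x + (-1) ^ 1 * y = x - y := by simp [sub_eq_add_neg]

lemma add_neg_one_pow_two_mul (x y : A) : x + (-1) ^ 2 * y = x + y := by simp

lemma neg_one_pow_mul_mul_neg (i : ℕ) (a b e : A) :
    (-1) ^ i * a * -b + e * 0 = (-1) ^ (i + 1) * (a * b) := by
  simp [pow_succ, mul_assoc]

lemma neg_one_pow_mul_mem {K : Type*} [CommRing K] [Algebra K A] (J : Submodule K A) (i : ℕ)
    {a : A} (ha : a ∈ J) : (-1) ^ i * a ∈ J := by
  rcases neg_one_pow_eq_or A i with h | h <;> simpa [h] using ha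

lemma commutator_leibniz (f a c x y : A) :
    (f * c - c * f) * a + x * y - (x * y - f * (a * c - c * a)) = f * a * c - c * (f * a) := by
  noncomm_ring

lemma sum_sum_sub_smul {K M ι : Type*} [Ring K] [AddCommGroup M] [Module K M] [Fintype ι]
    (p q : ι → ι → K) (v : ι → ι → M) :
    ∑ j, ∑ i, (p i j - q i j) • v i j = ∑ i, ∑ j, p i j • v i j - ∑ i, ∑ j, q i j • v i j := by
  rw [Finset.sum_comm]
  simp only [sub_smul, Finset.sum_sub_distrib]

lemma sub_sub_add_eq_zero {M : Type*} [AddCommGroup M] {p q e s t z : M} (h1 : q - p = e + z)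
    (h2 : p + s = q + t) : e - (s - t) + z = 0 := by
  rw [sub_eq_iff_eq_add] at h1
  subst h1
  have h3 : s = e + z + t := by
    rw [add_comm (e + z) p, add_assoc] at h2
    exact add_left_cancel h2
  rw [h3]
  abel

end RingIdentities

section Derivation

variable {R : Submodule k (V ⊗[k] V)} {ν : R →ₗ[k] V} {θ : R →ₗ[k] k}
  {n : ℕ} (x : Module.Basis (Fin n) k V)

/-- The upper triangular matrices whose product encodes the graded Leibniz rule. -/
def triangle (g : Module.Dual k V →ₗ[k] DualAlg R) :
    Module.Dual k V →ₗ[k] Matrix (Fin 2) (Fin 2) (DualAlg R) where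
  toFun f := !![-DualAlg.gen R f, g f; 0, DualAlg.gen R f]
  map_add' f f' := by
    ext i j; fin_cases i <;> fin_cases j <;> simp [add_comm]
  map_smul' c f := by
    ext i j; fin_cases i <;> fin_cases j <;> simp

lemma mul_triangle (g : Module.Dual k V →ₗ[k] DualAlg R)
    (t : Module.Dual k V ⊗[k] Module.Dual k V) :
    LinearMap.mul' k _ (TensorProduct.map (triangle g) (triangle g) t) =
      !![QuadAlg.mk (orth R) (tensorTwo k _ t),
        LinearMap.mul' k _ (TensorProduct.map g (DualAlg.gen R) t) -
          LinearMap.mul' k _ (TensorProduct.map (DualAlg.gen R) g t);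
        0, QuadAlg.mk (orth R) (tensorTwo k _ t)] := by
  induction t using TensorProduct.induction_on with
  | zero => ext i j; fin_cases i <;> fin_cases j <;> simp
  | tmul f f' =>
    rw [tensorTwo_tmul, map_mul, mk_ι, mk_ι]
    simp only [TensorProduct.map_tmul, LinearMap.mul'_apply, triangle, LinearMap.coe_mk,
      AddHom.coe_mk]
    ext i j
    rw [Matrix.mul_apply, Fin.sum_univ_two]
    fin_cases i <;> fin_cases j
    · exact neg_mul_neg_add_mul_zero _ _ _
    · exact neg_mul_add_mul _ _ _ _
    · exact (congrArg₂ (· + ·) (zero_mul _) (mul_zero _)).trans (add_zero _)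
    · exact (congrArg (· + _) (zero_mul _)).trans (zero_add _)
  | add a b ha hb =>
    rw [map_add, map_add, ha, hb]
    ext i j
    fin_cases i <;> fin_cases j <;> simp
    abel

/-- The algebra map `a ↦ !![±a, δ a; 0, a]` that defines the derivation `δ`. -/
def triangleHom (g : Module.Dual k V →ₗ[k] DualAlg R)
    (h : ∀ t ∈ orth R, LinearMap.mul' k _ (TensorProduct.map (DualAlg.gen R) g t) =
      LinearMap.mul' k _ (TensorProduct.map g (DualAlg.gen R) t)) :
    DualAlg R →ₐ[k] Matrix (Fin 2) (Fin 2) (DualAlg R) :=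
  lift (triangle g) fun t ht => by
    rw [mul_triangle, mk_tensorTwo_of_mem ht, h t ht, sub_self]
    ext i j; fin_cases i <;> fin_cases j <;> simp

/-- The graded derivation of degree one of `A^!` with prescribed values on generators. -/
lemma exists_derivation (g : Module.Dual k V →ₗ[k] DualAlg R)
    (hg : ∀ f, g f ∈ DualAlg.piece R 2)
    (h : ∀ t ∈ orth R, LinearMap.mul' k _ (TensorProduct.map (DualAlg.gen R) g t) =
      LinearMap.mul' k _ (TensorProduct.map g (DualAlg.gen R) t)) :
    ∃ δ : DualAlg R →ₗ[k] DualAlg R, (∀ f, δ (DualAlg.gen R f) = g f) ∧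
      (∀ i, ∀ a ∈ DualAlg.piece R i, δ a ∈ DualAlg.piece R (i + 1)) ∧
      ∀ i, ∀ a ∈ DualAlg.piece R i, ∀ b, δ (a * b) = δ a * b + (-1) ^ i * (a * δ b) := by
  let Δ := triangleHom g h
  have hgen : ∀ f, Δ (DualAlg.gen R f) = !![-DualAlg.gen R f, g f; 0, DualAlg.gen R f] :=
    fun f => lift_apply_gen _ _ _
  have key : ∀ i, ∀ a ∈ DualAlg.piece R i, Δ a 0 0 = (-1) ^ i * a ∧ Δ a 1 1 = a ∧
      Δ a 1 0 = 0 ∧ Δ a 0 1 ∈ DualAlg.piece R (i + 1) := by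
    intro i
    induction i with
    | zero =>
      intro a ha
      obtain ⟨c, rfl⟩ := mem_piece_zero.1 ha
      rw [AlgHom.commutes]
      simp [Matrix.algebraMap_matrix_apply]
    | succ i ih =>
      let J : Submodule k (DualAlg R) :=
        { carrier := {a | Δ a 0 0 = (-1) ^ (i + 1) * a ∧ Δ a 1 1 = a ∧ Δ a 1 0 = 0 ∧
            Δ a 0 1 ∈ DualAlg.piece R (i + 1 + 1)}
          zero_mem' := by simp
          add_mem' := by
            rintro a b ⟨ha1, ha2, ha3, ha4⟩ ⟨hb1, hb2, hb3, hb4⟩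
            simp only [Set.mem_ofPred_eq, map_add, Matrix.add_apply, ha1, ha2, ha3, hb1, hb2, hb3,
              mul_add, add_zero, true_and]
            exact add_mem ha4 hb4
          smul_mem' := by
            rintro c a ⟨ha1, ha2, ha3, ha4⟩
            simp only [Set.mem_ofPred_eq, map_smul, Matrix.smul_apply, ha1, ha2, ha3,
              mul_smul_comm, smul_zero, true_and]
            exact Submodule.smul_mem _ _ ha4 }
      refine piece_succ_le (J := J) fun a ha f => ?_
      obtain ⟨h1, h2, h3, h4⟩ := ih a ha
      have h5 : ∀ p q, Δ (a * DualAlg.gen R f) p q = Δ a p 0 *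
          (!![-DualAlg.gen R f, g f; 0, DualAlg.gen R f] :
            Matrix (Fin 2) (Fin 2) (DualAlg R)) 0 q +
          Δ a p 1 *
          (!![-DualAlg.gen R f, g f; 0, DualAlg.gen R f] :
            Matrix (Fin 2) (Fin 2) (DualAlg R)) 1 q :=
        fun p q => by rw [map_mul, Matrix.mul_apply, Fin.sum_univ_two, hgen]
      refine ⟨?_, ?_, ?_, ?_⟩
      · rw [h5, h1]
        exact neg_one_pow_mul_mul_neg _ _ _ _
      · rw [h5, h2, h3]
        exact (congrArg (· + _) (zero_mul _)).trans (zero_add _)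
      · rw [h5, h2, h3]
        exact (congrArg₂ (· + ·) (zero_mul _) (mul_zero _)).trans (add_zero _)
      · rw [h5, h1, mul_assoc]
        exact add_mem (neg_one_pow_mul_mem _ _ (mul_mem_piece (i := i) (j := 2) ha (hg f)))
          (mul_gen_mem_piece f h4)
  have h11 : ∀ b, Δ b 1 1 = b := fun b => by
    induction b using homogeneous_induction with
    | mem i a ha => exact (key i a ha).2.1
    | add a b ha hb => rw [map_add, Matrix.add_apply, ha, hb]
  refine ⟨Matrix.entryLinearMap k (DualAlg R) 0 1 ∘ₗ Δ.toLinearMap, fun f => ?_,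
    fun i a ha => (key i a ha).2.2.2, fun i a ha b => ?_⟩
  · change Δ _ 0 1 = _
    rw [hgen]
    rfl
  · change Δ _ 0 1 = Δ a 0 1 * b + _ * (a * Δ b 0 1)
    rw [map_mul, Matrix.mul_apply, Fin.sum_univ_two, (key i a ha).1, h11, add_comm, mul_assoc]

lemma derivation_one {δ : DualAlg R →ₗ[k] DualAlg R}
    (hδ : ∀ i, ∀ a ∈ DualAlg.piece R i, ∀ b, δ (a * b) = δ a * b + (-1) ^ i * (a * δ b)) :
    δ 1 = 0 := by
  have := hδ 0 1 one_mem_piece 1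
  rw [pow_zero, one_mul, one_mul, one_mul, mul_one] at this
  exact left_eq_add.1 this

lemma derivation_ext {δ δ' : DualAlg R →ₗ[k] DualAlg R}
    (hδ : ∀ i, ∀ a ∈ DualAlg.piece R i, ∀ b, δ (a * b) = δ a * b + (-1) ^ i * (a * δ b))
    (hδ' : ∀ i, ∀ a ∈ DualAlg.piece R i, ∀ b, δ' (a * b) = δ' a * b + (-1) ^ i * (a * δ' b))
    (h : ∀ f, δ (DualAlg.gen R f) = δ' (DualAlg.gen R f)) : δ = δ' := by
  have : LinearMap.eqLocus δ δ' = ⊤ := by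
    refine eq_top_of_gen_mul_mem (DualAlg.gen R) (lift_gen_surjective _) _ ?_ fun f a ha => ?_
    · rw [LinearMap.mem_eqLocus, derivation_one hδ, derivation_one hδ']
    · rw [LinearMap.mem_eqLocus] at ha ⊢
      rw [hδ 1 _ (gen_mem_piece f), hδ' 1 _ (gen_mem_piece f), ha, h]
  exact LinearMap.eqLocus_eq_top.1 this

/-- Both `δ²` and the commutator with `c` are derivations, so it suffices to compare them on
generators. -/
lemma sq_derivation {δ : DualAlg R →ₗ[k] DualAlg R} {c : DualAlg R}
    (hdeg : ∀ i, ∀ a ∈ DualAlg.piece R i, δ a ∈ DualAlg.piece R (i + 1))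
    (hδ : ∀ i, ∀ a ∈ DualAlg.piece R i, ∀ b, δ (a * b) = δ a * b + (-1) ^ i * (a * δ b))
    (h : ∀ f, δ (δ (DualAlg.gen R f)) = DualAlg.gen R f * c - c * DualAlg.gen R f)
    (a : DualAlg R) : δ (δ a) = a * c - c * a := by
  let L : DualAlg R →ₗ[k] DualAlg R :=
    (LinearMap.mul k (DualAlg R)).flip c - LinearMap.mul k (DualAlg R) c
  have : LinearMap.eqLocus (δ ∘ₗ δ) L = ⊤ := by
    refine eq_top_of_gen_mul_mem (DualAlg.gen R) (lift_gen_surjective _) _ ?_ fun f a ha => ?_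
    · rw [LinearMap.mem_eqLocus, LinearMap.comp_apply, derivation_one hδ]
      change δ 0 = 1 * c - c * 1
      rw [map_zero, one_mul, mul_one, sub_self]
    · rw [LinearMap.mem_eqLocus] at ha ⊢
      have ha' : δ (δ a) = a * c - c * a := ha
      change δ (δ _) = _ * c - c * _
      have h1 : δ (δ (DualAlg.gen R f) * a) = δ (δ (DualAlg.gen R f)) * a +
          δ (DualAlg.gen R f) * δ a :=
        (hδ 2 _ (hdeg 1 _ (gen_mem_piece f)) a).trans (add_neg_one_pow_two_mul _ _)
      have h2 : δ (DualAlg.gen R f * δ a) = δ (DualAlg.gen R f) * δ a -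
          DualAlg.gen R f * δ (δ a) :=
        (hδ 1 _ (gen_mem_piece f) (δ a)).trans (add_neg_one_pow_one_mul _ _)
      have h3 : δ (DualAlg.gen R f * a) = δ (DualAlg.gen R f) * a - DualAlg.gen R f * δ a :=
        (hδ 1 _ (gen_mem_piece f) a).trans (add_neg_one_pow_one_mul _ _)
      rw [h3, map_sub, h1, h2, h, ha']
      exact commutator_leibniz _ _ _ _ _
  have := this.symm ▸ Submodule.mem_top (x := a)
  exact this

variable [FiniteDimensional k V]

lemma maurerCartan_gen (ν : R →ₗ[k] V) (θ : R →ₗ[k] k) :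
    canonicalElt (R := R) x (DefAlg.gen ν θ) * canonicalElt x (DefAlg.gen ν θ) =
      ∑ i, DefAlg.gen ν θ (x i) ⊗ₜ[k] eta ν (x.coord i) + 1 ⊗ₜ[k] ofDual R θ :=
  (maurerCartan_iff ν θ x _).2 (DefAlg.mul_gen ν θ)

/-- The two ways to multiply three copies of the canonical element. -/
lemma maurerCartan_assoc (ν : R →ₗ[k] V) (θ : R →ₗ[k] k) :
    ∑ i, ∑ j, (DefAlg.gen ν θ (x i) * DefAlg.gen ν θ (x j)) ⊗ₜ[k]
        (DualAlg.gen R (x.coord i) * eta ν (x.coord j)) +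
      ∑ i, DefAlg.gen ν θ (x i) ⊗ₜ[k] (DualAlg.gen R (x.coord i) * ofDual R θ) =
    ∑ i, ∑ j, (DefAlg.gen ν θ (x i) * DefAlg.gen ν θ (x j)) ⊗ₜ[k]
        (eta ν (x.coord i) * DualAlg.gen R (x.coord j)) +
      ∑ i, DefAlg.gen ν θ (x i) ⊗ₜ[k] (ofDual R θ * DualAlg.gen R (x.coord i)) := by
  have h := mul_assoc (canonicalElt (R := R) x (DefAlg.gen ν θ))
    (canonicalElt x (DefAlg.gen ν θ)) (canonicalElt x (DefAlg.gen ν θ))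
  rw [maurerCartan_gen, canonicalElt] at h
  simp only [add_mul, mul_add, Finset.sum_mul, Finset.mul_sum, Algebra.TensorProduct.tmul_mul_tmul,
    one_mul, mul_one, Finset.sum_add_distrib] at h
  rw [Finset.sum_comm, ← h]
  congr 1
  exact Finset.sum_comm

/-- The obstruction to extending `eta ν` to a graded derivation vanishes, by the PBW property. -/
lemma IsPBWDeformation.eta_mul (hU : IsPBWDeformation ν θ) (x : Module.Basis (Fin n) k V)
    {t : Module.Dual k V ⊗[k] Module.Dual k V} (ht : t ∈ orth R) :
    LinearMap.mul' k _ (TensorProduct.map (DualAlg.gen R) (eta ν) t) =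
      LinearMap.mul' k _ (TensorProduct.map (eta ν) (DualAlg.gen R) t) := by
  rw [← sub_eq_zero, ← Module.forall_dual_apply_eq_zero_iff k]
  intro χ
  have h1 := congrArg (slice χ) (maurerCartan_assoc x ν θ)
  have h2 : ∑ i, ∑ j, χ (DualAlg.gen R (x.coord i) * eta ν (x.coord j) -
      eta ν (x.coord i) * DualAlg.gen R (x.coord j)) • (x i ⊗ₜ[k] x j) ∈ R := by
    refine hU.mem_of_eq (v := ∑ i, χ (DualAlg.gen R (x.coord i) * ofDual R θ -
        ofDual R θ * DualAlg.gen R (x.coord i)) • x i) (c := 0) ?_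
    rw [map_zero, add_zero]
    simp only [map_add, map_sum, slice_tmul] at h1
    simp only [DefAlg.mk_tensorTwo, map_sum, map_smul, map_sub, sub_smul, TensorProduct.map_tmul,
      LinearMap.mul'_apply, Finset.sum_sub_distrib]
    rw [sub_add_sub_comm, sub_eq_zero]
    exact h1
  have h3 := (Submodule.mem_dualAnnihilator _).1 ht _ h2
  rw [← h3]
  clear h1 h2 h3 ht
  set Z := ∑ i, ∑ j, χ (DualAlg.gen R (x.coord i) * eta ν (x.coord j) -
      eta ν (x.coord i) * DualAlg.gen R (x.coord j)) • (x i ⊗ₜ[k] x j) with hZ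
  suffices χ ∘ₗ (LinearMap.mul' k (DualAlg R) ∘ₗ TensorProduct.map (DualAlg.gen R) (eta ν) -
      LinearMap.mul' k (DualAlg R) ∘ₗ TensorProduct.map (eta ν) (DualAlg.gen R)) =
      LinearMap.applyₗ Z ∘ₗ TensorProduct.dualDistrib k V V from LinearMap.congr_fun this t
  refine (x.dualBasis.tensorProduct x.dualBasis).ext fun ⟨a, b⟩ => ?_
  simp [hZ, Finsupp.single_apply]

/-- The curved differential graded algebra dual to a PBW-deformation. -/
lemma IsPBWDeformation.exists_isDualCurvedDGA (hU : IsPBWDeformation ν θ)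
    (x : Module.Basis (Fin n) k V) :
    ∃! D : (DualAlg R →ₗ[k] DualAlg R) × DualAlg R, IsDualCurvedDGA ν θ D.1 D.2 := by
  obtain ⟨δ, hgen, hdeg, hδ⟩ := exists_derivation (R := R) (eta ν) (fun f => ofDual_mem _)
    fun t ht => hU.eta_mul x ht
  set c := ofDual R θ
  -- the images under `1 ⊗ δ` of both sides of the Maurer–Cartan equation
  have h1 := congrArg (LinearMap.lTensor (DefAlg ν θ) δ) (maurerCartan_gen x ν θ)
  have h2 : ∀ i j, δ (DualAlg.gen R (x.coord i) * DualAlg.gen R (x.coord j)) =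
      eta ν (x.coord i) * DualAlg.gen R (x.coord j) -
        DualAlg.gen R (x.coord i) * eta ν (x.coord j) := fun i j => by
    have := hδ 1 _ (gen_mem_piece (x.coord i)) (DualAlg.gen R (x.coord j))
    rw [hgen, hgen] at this
    exact this.trans (add_neg_one_pow_one_mul _ _)
  have h3 := maurerCartan_assoc x ν θ
  have h4 : ∀ χ : Module.Dual k (DualAlg R),
      (∀ i, χ (δ (eta ν (x.coord i))) = χ (DualAlg.gen R (x.coord i) * c -
        c * DualAlg.gen R (x.coord i))) ∧ χ (δ c) = 0 := by
    intro χ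
    have h1' := congrArg (slice χ) h1
    have h3' := congrArg (slice χ) h3
    simp only [canonicalElt, Finset.sum_mul, Finset.mul_sum, Algebra.TensorProduct.tmul_mul_tmul,
      map_sum, map_add, LinearMap.lTensor_tmul, slice_tmul, h2, map_sub] at h1' h3'
    have h5 : DefAlg.gen ν θ (∑ i, (χ (δ (eta ν (x.coord i))) - χ (DualAlg.gen R (x.coord i) * c -
        c * DualAlg.gen R (x.coord i))) • x i) + algebraMap k _ (χ (δ c)) = 0 := by
      simp only [map_sum, map_smul, map_sub, sub_smul, Finset.sum_sub_distrib,
        Algebra.algebraMap_eq_smul_one]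
      exact sub_sub_add_eq_zero ((sum_sum_sub_smul _ _ _).symm.trans h1') h3'
    obtain ⟨h6, h7⟩ := hU.eq_zero_of_eq h5
    refine ⟨fun i => sub_eq_zero.1 ?_, h7⟩
    exact Fintype.linearIndependent_iff.1 x.linearIndependent _ h6 i
  have hclosed : δ c = 0 := by
    rw [← Module.forall_dual_apply_eq_zero_iff k]
    exact fun χ => (h4 χ).2
  have hsq : ∀ f, δ (δ (DualAlg.gen R f)) = DualAlg.gen R f * c - c * DualAlg.gen R f := by
    intro f
    suffices δ ∘ₗ δ ∘ₗ DualAlg.gen R = ((LinearMap.mul k (DualAlg R)).flip c -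
        LinearMap.mul k (DualAlg R) c) ∘ₗ DualAlg.gen R from LinearMap.congr_fun this f
    refine x.dualBasis.ext fun i => ?_
    rw [Module.Basis.coe_dualBasis]
    change δ (δ (DualAlg.gen R (x.coord i))) = DualAlg.gen R (x.coord i) * c -
      c * DualAlg.gen R (x.coord i)
    rw [hgen, ← sub_eq_zero, ← Module.forall_dual_apply_eq_zero_iff k]
    intro χ
    rw [map_sub, (h4 χ).1 i, sub_self]
  refine ⟨(δ, c), ⟨hdeg, hδ, fun f => ?_, represents_ofDual R θ, sq_derivation hdeg hδ hsq,
    hclosed⟩, ?_⟩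
  · rw [hgen]; exact represents_ofDual R _
  · rintro ⟨δ', c'⟩ hD
    refine Prod.ext (derivation_ext hD.leibniz hδ fun f => ?_) hD.curvature.eq_ofDual
    rw [hgen]
    exact (hD.restrict f).eq_ofDual

end Derivation

/-! ### The Nakayama automorphism of `U` -/

section NakayamaInverse

variable {R : Submodule k (V ⊗[k] V)} {d : ℕ} {φ : DualAlg R ≃ₐ[k] DualAlg R}

lemma IsNakayamaAut.symm_mem (hφ : IsNakayamaAut R d φ) {i : ℕ} {a : DualAlg R}
    (ha : a ∈ DualAlg.piece R i) : φ.symm a ∈ DualAlg.piece R i := by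
  have h1 : ∀ b, φ (proj (orth R) i b) = proj (orth R) i (φ b) := fun b => by
    induction b using homogeneous_induction with
    | mem j b hb =>
      rw [proj_of_mem hb, proj_of_mem (hφ.1 j b hb)]
      split_ifs
      · rfl
      · exact map_zero φ
    | add a b ha hb => simp only [map_add, ha, hb]
  have h2 := h1 (φ.symm a)
  rw [AlgEquiv.apply_symm_apply, proj_self ha, ← φ.eq_symm_apply] at h2
  rw [← h2]
  exact proj_mem _ _

variable {n : ℕ} {x : Module.Basis (Fin n) k V} {P : Matrix (Fin n) (Fin n) k}

lemma linearIndependent_gen_coord (x : Module.Basis (Fin n) k V) :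
    LinearIndependent k fun i => DualAlg.gen R (x.coord i) := by
  have h1 : LinearIndependent k x.coord := by
    rw [← Module.Basis.coe_dualBasis]
    exact x.dualBasis.linearIndependent
  exact h1.map' _ (LinearMap.ker_eq_bot.2 gen_injective)

lemma eq_of_sum_smul_gen_coord (x : Module.Basis (Fin n) k V) {p q : Fin n → k}
    (h : ∑ i, p i • DualAlg.gen R (x.coord i) = ∑ i, q i • DualAlg.gen R (x.coord i)) : p = q :=
  (linearIndependent_gen_coord (R := R) x).fintypeLinearCombination_injective h

lemma IsNakayamaAut.existsUnique_hasMatrix (hφ : IsNakayamaAut R d φ)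
    (x : Module.Basis (Fin n) k V) : ∃! P : Matrix (Fin n) (Fin n) k, HasMatrix R x φ P := by
  have h1 : ∀ j, ∃ f, DualAlg.gen R f = φ (DualAlg.gen R (x.coord j)) := fun j =>
    mem_piece_one.1 (hφ.1 1 _ (gen_mem_piece _))
  choose f hf using h1
  refine ⟨fun i j => f j (x i), fun j => ?_, fun Q hQ => ?_⟩
  · rw [← hf]
    exact IsFrobeniusTrace.gen_eq_sum x (f j)
  · ext i j
    exact congrFun (eq_of_sum_smul_gen_coord x ((hQ j).symm.trans ((hf j).symm.trans
      (IsFrobeniusTrace.gen_eq_sum x (f j))))) i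

lemma IsNakayamaAut.isUnit_det (hφ : IsNakayamaAut R d φ) (hP : HasMatrix R x φ P) :
    IsUnit P.det := by
  have h1 : ∀ j, ∃ f, DualAlg.gen R f = φ.symm (DualAlg.gen R (x.coord j)) := fun j =>
    mem_piece_one.1 (hφ.symm_mem (gen_mem_piece _))
  choose f hf using h1
  let Q : Matrix (Fin n) (Fin n) k := fun i j => f j (x i)
  refine Matrix.isUnit_det_of_right_inverse (B := Q) ?_
  ext m j
  have h2 : DualAlg.gen R (x.coord j) =
      ∑ m, (P * Q) m j • DualAlg.gen R (x.coord m) := by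
    calc DualAlg.gen R (x.coord j) = φ (DualAlg.gen R (f j)) := by
          rw [hf, AlgEquiv.apply_symm_apply]
      _ = ∑ i, ∑ m, f j (x i) • P m i • DualAlg.gen R (x.coord m) := by
          rw [IsFrobeniusTrace.gen_eq_sum x (f j), map_sum]
          refine Finset.sum_congr rfl fun i _ => ?_
          rw [map_smul, hP i, Finset.smul_sum]
      _ = _ := by
          rw [Finset.sum_comm]
          refine Finset.sum_congr rfl fun m _ => ?_
          rw [Matrix.mul_apply, Finset.sum_smul]
          refine Finset.sum_congr rfl fun i _ => ?_
          rw [smul_smul, mul_comm]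
  have h4 : ∑ m, (1 : Matrix _ _ k) m j • DualAlg.gen R (x.coord m) =
      DualAlg.gen R (x.coord j) := by
    rw [Finset.sum_eq_single j]
    · rw [Matrix.one_apply_eq, one_smul]
    · intro m _ hm
      rw [Matrix.one_apply_ne hm, zero_smul]
    · simp
  exact congrFun (eq_of_sum_smul_gen_coord x (h2.symm.trans h4.symm)) m

/-- The columns of `P⁻¹` give the inverse of the Nakayama automorphism. -/
lemma IsNakayamaAut.symm_gen (hφ : IsNakayamaAut R d φ) (hP : HasMatrix R x φ P) (i : Fin n) :
    φ.symm (DualAlg.gen R (x.coord i)) = ∑ j, P⁻¹ j i • DualAlg.gen R (x.coord j) := by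
  have hu := hφ.isUnit_det hP
  rw [AlgEquiv.symm_apply_eq, map_sum]
  have h1 : ∀ j, φ (P⁻¹ j i • DualAlg.gen R (x.coord j)) =
      ∑ m, (P m j * P⁻¹ j i) • DualAlg.gen R (x.coord m) := fun j => by
    rw [map_smul, hP j, Finset.smul_sum]
    refine Finset.sum_congr rfl fun m _ => ?_
    rw [smul_smul, mul_comm]
  simp only [h1]
  rw [Finset.sum_comm]
  have h2 : ∀ m, ∑ j, (P m j * P⁻¹ j i) • DualAlg.gen R (x.coord m) =
      (1 : Matrix _ _ k) m i • DualAlg.gen R (x.coord m) := fun m => by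
    rw [← Finset.sum_smul, ← Matrix.mul_apply, Matrix.mul_nonsing_inv P hu]
  simp only [h2]
  rw [Finset.sum_eq_single i]
  · rw [Matrix.one_apply_eq, one_smul]
  · intro m _ hm
    rw [Matrix.one_apply_ne hm, zero_smul]
  · simp

end NakayamaInverse

section Twist

lemma neg_one_pow_mul_eq_smul {K A : Type*} [CommRing K] [Ring A] [Algebra K A] (j : ℕ) (a : A) :
    (-1) ^ j * a = (-1 : K) ^ j • a := by
  rw [Algebra.smul_def, map_pow, map_neg, map_one]

variable {R : Submodule k (V ⊗[k] V)} {d : ℕ} {ϖ : DualAlg R} {τ : DualAlg R →ₗ[k] k}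
  {φ : DualAlg R ≃ₐ[k] DualAlg R} {ν : R →ₗ[k] V} {θ : R →ₗ[k] k}
  {δ : DualAlg R →ₗ[k] DualAlg R} {c lam : DualAlg R}

lemma IsFrobeniusTrace.eq_zero_of_lt (h : IsFrobeniusTrace R d ϖ τ) {i : ℕ} (hi : d < i)
    {a : DualAlg R} (ha : a ∈ DualAlg.piece R i) : a = 0 := by
  refine h.left a fun y => ?_
  induction y using homogeneous_induction with
  | mem j y hy => exact h.of_ne _ (by omega) _ (mul_mem_piece ha hy)
  | add a b ha hb => rw [mul_add, map_add, ha, hb, add_zero]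

lemma IsFrobeniusTrace.apply_symm_mul (h : IsFrobeniusTrace R d ϖ τ) (hφ : IsNakayamaAut R d φ)
    (b y : DualAlg R) : τ (φ.symm b * y) = τ (y * b) := by
  rw [← h.apply_mul_of_isNakayamaAut hφ, AlgEquiv.apply_symm_apply]

lemma IsDualCurvedDGA.apply_mul_one (hD : IsDualCurvedDGA ν θ δ c) {a : DualAlg R}
    (ha : a ∈ DualAlg.piece R 1) (b : DualAlg R) : δ (a * b) = δ a * b - a * δ b :=
  (hD.leibniz 1 a ha b).trans (add_neg_one_pow_one_mul _ _)

/-- The effect of the Nakayama automorphism on the curvature. -/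
lemma IsFrobeniusTrace.symm_curvature (h : IsFrobeniusTrace R d ϖ τ) (hφ : IsNakayamaAut R d φ)
    (hD : IsDualCurvedDGA ν θ δ c) (hlam : lam ∈ DualAlg.piece R 1)
    (hδ : ∀ y, τ (δ y) = τ (lam * y)) : φ.symm c + lam * lam = δ lam + c := by
  refine h.eq_of_left fun y => ?_
  have h1 := congrArg τ (hD.sq y)
  rw [hδ, map_sub] at h1
  have h2 := hδ (lam * y)
  rw [hD.apply_mul_one hlam, map_sub, h1] at h2
  rw [add_mul, add_mul, map_add, map_add, h.apply_symm_mul hφ, mul_assoc, ← h2]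
  abel

/-- The effect of the Nakayama automorphism on the differential of a generator. -/
lemma IsFrobeniusTrace.symm_derivation (h : IsFrobeniusTrace R d ϖ τ) (hφ : IsNakayamaAut R d φ)
    (hD : IsDualCurvedDGA ν θ δ c) (hlam : lam ∈ DualAlg.piece R 1)
    (hδ : ∀ y, τ (δ y) = τ (lam * y)) {g : DualAlg R} (hg : g ∈ DualAlg.piece R 1) :
    φ.symm (δ g) + (-1 : k) ^ (d + 1) • (φ.symm g * lam + lam * φ.symm g) =
      (-1 : k) ^ (d + 1) • δ (φ.symm g) := by
  set w := φ.symm g with hw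
  have hw1 : w ∈ DualAlg.piece R 1 := hφ.symm_mem hg
  have hmem : φ.symm (δ g) + (-1 : k) ^ (d + 1) • (w * lam + lam * w) -
      (-1 : k) ^ (d + 1) • δ w ∈ DualAlg.piece R 2 := by
    refine sub_mem (add_mem (hφ.symm_mem (hD.degree 1 _ hg)) (Submodule.smul_mem _ _ ?_))
      (Submodule.smul_mem _ _ (hD.degree 1 _ hw1))
    exact add_mem (mul_mem_piece (i := 1) (j := 1) hw1 hlam)
      (mul_mem_piece (i := 1) (j := 1) hlam hw1)
  rw [← sub_eq_zero]
  rcases lt_or_ge d 2 with hd | hd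
  · exact h.eq_zero_of_lt hd hmem
  obtain ⟨j, rfl⟩ := Nat.exists_eq_add_of_le hd
  refine h.left_of_mem (j := j) rfl hmem fun y hy => ?_
  have h1 : τ (w * (lam * y)) = τ (w * δ y) + (-1) ^ j * τ (φ.symm (δ g) * y) := by
    have h2 : δ (y * g) = δ y * g + (-1 : k) ^ j • (y * δ g) := by
      rw [hD.leibniz j y hy]
      exact congrArg (_ + ·) (neg_one_pow_mul_eq_smul j (y * δ g))
    rw [h.apply_symm_mul hφ, mul_assoc, ← hδ, h2, map_add, map_smul, smul_eq_mul,
      h.apply_symm_mul hφ, h.apply_symm_mul hφ]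
  have h3 := hδ (w * y)
  rw [hD.apply_mul_one hw1, map_sub] at h3
  rw [sub_mul, add_mul, smul_mul_assoc, smul_mul_assoc, add_mul, map_sub, map_add, map_smul,
    map_smul, map_add, mul_assoc, mul_assoc, ← h3, h1, smul_eq_mul, smul_eq_mul]
  have h4 : (-1 : k) ^ (2 + j + 1) = -(-1) ^ j := by
    rw [pow_succ, pow_add]; ring
  have h5 : (-1 : k) ^ j * (-1) ^ j = 1 := by rw [← mul_pow]; simp
  rw [h4]
  linear_combination (-τ (φ.symm (δ g) * y)) * h5

end Twist

/-- A linear map that maps a finite-dimensional subspace onto itself is injective on it. -/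
lemma eq_zero_of_map_eq {B : Type u} [AddCommGroup B] [Module k B] {L : Submodule k B}
    (hL : L.FG) {f : B →ₗ[k] B} (hf : L.map f = L) {a : B} (ha : a ∈ L) (h0 : f a = 0) : a = 0 := by
  have hfd : FiniteDimensional k L := Module.Finite.iff_fg.2 hL
  let g : L →ₗ[k] L := f.restrict fun b hb => hf.le (Submodule.mem_map_of_mem hb)
  have hg : Function.Surjective g := fun ⟨b, hb⟩ => by
    obtain ⟨b', hb', rfl⟩ := hf.ge hb
    exact ⟨⟨b', hb'⟩, rfl⟩
  have h1 : g ⟨a, ha⟩ = g 0 := Subtype.ext (h0.trans (map_zero f).symm)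
  exact congrArg Subtype.val (LinearMap.injective_iff_surjective.2 hg h1)

namespace DefAlg

variable {R : Submodule k (V ⊗[k] V)} (ν : R →ₗ[k] V) (θ : R →ₗ[k] k)

/-- The first step `k + V` of the filtration of `U`. -/
def base : Submodule k (DefAlg ν θ) := 1 ⊔ LinearMap.range (gen ν θ)

lemma one_mem_base : 1 ∈ base ν θ := Submodule.mem_sup_left (Submodule.mem_one.2 ⟨1, map_one _⟩)

lemma gen_mem_base (v : V) : gen ν θ v ∈ base ν θ := Submodule.mem_sup_right ⟨v, rfl⟩

lemma base_pow_mono : Monotone fun n => base ν θ ^ n := by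
  refine monotone_nat_of_le_succ fun n => ?_
  rw [pow_succ]
  intro a ha
  simpa using Submodule.mul_mem_mul ha (one_mem_base ν θ)

lemma exists_mem_base_pow (a : DefAlg ν θ) : ∃ n, a ∈ base ν θ ^ n := by
  obtain ⟨t, rfl⟩ := mk_surjective ν θ a
  induction t using TensorAlgebra.induction with
  | algebraMap c =>
    refine ⟨0, ?_⟩
    rw [AlgHom.commutes, pow_zero]
    exact Submodule.mem_one.2 ⟨c, rfl⟩
  | ι v => exact ⟨1, by rw [pow_one]; exact gen_mem_base ν θ v⟩
  | mul a b ha hb =>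
    obtain ⟨m, ha⟩ := ha
    obtain ⟨n, hb⟩ := hb
    exact ⟨m + n, by rw [map_mul, pow_add]; exact Submodule.mul_mem_mul ha hb⟩
  | add a b ha hb =>
    obtain ⟨m, ha⟩ := ha
    obtain ⟨n, hb⟩ := hb
    refine ⟨max m n, ?_⟩
    rw [map_add]
    exact add_mem (base_pow_mono ν θ (le_max_left m n) ha) (base_pow_mono ν θ (le_max_right m n) hb)

variable {ν θ}

lemma base_fg [FiniteDimensional k V] : (base ν θ).FG := by
  refine Submodule.FG.sup ?_ (Module.Finite.iff_fg.1 (Module.Finite.range _))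
  rw [Submodule.one_eq_span]
  exact Submodule.fg_span_singleton _

/-- An endomorphism of `U` that maps `k + V` onto itself is bijective. -/
lemma bijective_of_map_base [FiniteDimensional k V] {f : DefAlg ν θ →ₐ[k] DefAlg ν θ}
    (hf : (base ν θ).map f.toLinearMap = base ν θ) : Function.Bijective f := by
  have hmap : ∀ n, (base ν θ ^ n).map f.toLinearMap = base ν θ ^ n := fun n => by
    rw [Submodule.map_pow, hf]
  constructor
  · refine (injective_iff_map_eq_zero f).2 fun a ha => ?_
    obtain ⟨n, hn⟩ := exists_mem_base_pow ν θ a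
    exact eq_zero_of_map_eq (base_fg.pow n) (hmap n) hn ha
  · intro b
    obtain ⟨n, hn⟩ := exists_mem_base_pow ν θ b
    rw [← hmap n] at hn
    obtain ⟨b', -, hb'⟩ := hn
    exact ⟨b', hb'⟩

end DefAlg

section NakayamaMap

lemma sign_smul_add_mul_self {K A : Type*} [CommRing K] [Ring A] [Algebra K A] {s : K}
    (hs : s * s = 1) (X Y : A) :
    (s • X + Y) * (s • X + Y) = X * X + (s • (X * Y) + s • (Y * X)) + Y * Y := by
  simp only [add_mul, mul_add, smul_mul_assoc, mul_smul_comm, smul_add, smul_smul, hs, one_smul]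
  abel

variable {R : Submodule k (V ⊗[k] V)} {d : ℕ} {ϖ : DualAlg R} {τ : DualAlg R →ₗ[k] k}
  {φ : DualAlg R ≃ₐ[k] DualAlg R} {ν : R →ₗ[k] V} {θ : R →ₗ[k] k}
  {δ : DualAlg R →ₗ[k] DualAlg R} {c : DualAlg R}
  {n : ℕ} {x : Module.Basis (Fin n) k V} {P : Matrix (Fin n) (Fin n) k}

/-- The candidate for the restriction to `V` of the Nakayama automorphism of `U`. -/
def nakayamaGen (ν : R →ₗ[k] V) (θ : R →ₗ[k] k) (d : ℕ) (x : Module.Basis (Fin n) k V)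
    (P : Matrix (Fin n) (Fin n) k) (l : Fin n → k) : V →ₗ[k] DefAlg ν θ :=
  x.constr k fun j => (-1 : k) ^ (d + 1) • ∑ i, (P⁻¹).transpose i j • DefAlg.gen ν θ (x i) +
    algebraMap k (DefAlg ν θ) (l j)

lemma nakayamaGen_apply (l : Fin n → k) (j : Fin n) : nakayamaGen ν θ d x P l (x j) =
    (-1 : k) ^ (d + 1) • ∑ i, (P⁻¹).transpose i j • DefAlg.gen ν θ (x i) +
      algebraMap k (DefAlg ν θ) (l j) := by
  rw [nakayamaGen, Module.Basis.constr_basis]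

lemma canonicalElt_nakayamaGen (hφ : IsNakayamaAut R d φ) (hP : HasMatrix R x φ P)
    (l : Fin n → k) : canonicalElt (R := R) x (nakayamaGen ν θ d x P l) =
      (-1 : k) ^ (d + 1) •
        ∑ i, DefAlg.gen ν θ (x i) ⊗ₜ[k] φ.symm (DualAlg.gen R (x.coord i)) +
      1 ⊗ₜ[k] ∑ j, l j • DualAlg.gen R (x.coord j) := by
  simp only [canonicalElt, nakayamaGen_apply, hφ.symm_gen hP, TensorProduct.add_tmul,
    Finset.sum_add_distrib, Algebra.algebraMap_eq_smul_one, TensorProduct.tmul_sum,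
    TensorProduct.tmul_smul, TensorProduct.smul_tmul', TensorProduct.sum_tmul,
    Matrix.transpose_apply, Finset.smul_sum]
  rw [Finset.sum_comm]

lemma IsDualCurvedDGA.eq_ofDual [FiniteDimensional k V] (hD : IsDualCurvedDGA ν θ δ c) :
    c = ofDual R θ := hD.curvature.eq_ofDual

lemma IsDualCurvedDGA.apply_gen [FiniteDimensional k V] (hD : IsDualCurvedDGA ν θ δ c)
    (f : Module.Dual k V) : δ (DualAlg.gen R f) = eta ν f := (hD.restrict f).eq_ofDual

/-- The substitution that defines the Nakayama automorphism of `U` satisfies the Maurer–Cartan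
equation. Its canonical element is `± (1 ⊗ φ⁻¹)(X) + 1 ⊗ λ`, for `X` the canonical element of `U`
and `λ = ∑ λⱼ xⱼ*`, and the behaviour of `φ⁻¹` with respect to `δ` and the curvature gives the
rest. -/
lemma maurerCartan_nakayamaGen [FiniteDimensional k V] (h : IsFrobeniusTrace R d ϖ τ)
    (hφ : IsNakayamaAut R d φ) (hP : HasMatrix R x φ P) (hD : IsDualCurvedDGA ν θ δ c)
    {l : Fin n → k} (hδ : ∀ y, τ (δ y) = τ ((∑ j, l j • DualAlg.gen R (x.coord j)) * y)) :
    canonicalElt (R := R) x (nakayamaGen ν θ d x P l) *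
        canonicalElt x (nakayamaGen ν θ d x P l) =
      ∑ i, nakayamaGen ν θ d x P l (x i) ⊗ₜ[k] eta ν (x.coord i) + 1 ⊗ₜ[k] ofDual R θ := by
  have hlam : ∑ j, l j • DualAlg.gen R (x.coord j) ∈ DualAlg.piece R 1 :=
    Submodule.sum_mem _ fun j _ => Submodule.smul_mem _ _ (gen_mem_piece _)
  have h1 : ∑ i, nakayamaGen ν θ d x P l (x i) ⊗ₜ[k] eta ν (x.coord i) =
      LinearMap.lTensor (DefAlg ν θ) δ (canonicalElt x (nakayamaGen ν θ d x P l)) := by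
    simp only [canonicalElt, map_sum, LinearMap.lTensor_tmul, hD.apply_gen]
  rw [h1, canonicalElt_nakayamaGen hφ hP, ← hD.eq_ofDual]
  set lam := ∑ j, l j • DualAlg.gen R (x.coord j)
  set X : DefAlg ν θ ⊗[k] DualAlg R :=
    ∑ i, DefAlg.gen ν θ (x i) ⊗ₜ[k] φ.symm (DualAlg.gen R (x.coord i)) with hX
  have h2 : X * X = ∑ i, DefAlg.gen ν θ (x i) ⊗ₜ[k] φ.symm (δ (DualAlg.gen R (x.coord i))) +
      1 ⊗ₜ[k] φ.symm c := by
    have h3 := congrArg (Algebra.TensorProduct.map (AlgHom.id k (DefAlg ν θ)) φ.symm.toAlgHom)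
      (maurerCartan_gen x ν θ)
    rw [map_mul, ← hD.eq_ofDual] at h3
    simp only [canonicalElt, map_add, map_sum, Algebra.TensorProduct.map_tmul, AlgHom.id_apply,
      map_one, ← hD.apply_gen] at h3
    exact h3
  have h4 : ∀ i, DefAlg.gen ν θ (x i) ⊗ₜ[k] φ.symm (δ (DualAlg.gen R (x.coord i))) +
      ((-1 : k) ^ (d + 1) •
        (DefAlg.gen ν θ (x i) ⊗ₜ[k] (φ.symm (DualAlg.gen R (x.coord i)) * lam)) +
      (-1 : k) ^ (d + 1) •
        (DefAlg.gen ν θ (x i) ⊗ₜ[k] (lam * φ.symm (DualAlg.gen R (x.coord i))))) =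
      (-1 : k) ^ (d + 1) • DefAlg.gen ν θ (x i) ⊗ₜ[k] δ (φ.symm (DualAlg.gen R (x.coord i))) := by
    intro i
    rw [← smul_add, ← TensorProduct.tmul_add, ← TensorProduct.tmul_smul, ← TensorProduct.tmul_add,
      h.symm_derivation hφ hD hlam hδ (gen_mem_piece _), TensorProduct.tmul_smul]
  have h5 : ∀ Y : DefAlg ν θ ⊗[k] DualAlg R,
      ((-1 : k) ^ (d + 1) • X + Y) * ((-1 : k) ^ (d + 1) • X + Y) =
      X * X + ((-1 : k) ^ (d + 1) • (X * Y) + (-1 : k) ^ (d + 1) • (Y * X)) + Y * Y := by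
    exact fun Y => sign_smul_add_mul_self (by rw [← mul_pow]; simp) X Y
  rw [h5, h2, map_add, map_smul, hX]
  simp only [Finset.sum_mul, Finset.mul_sum, Algebra.TensorProduct.tmul_mul_tmul, one_mul, mul_one,
    map_sum, LinearMap.lTensor_tmul, Finset.smul_sum, ← h4, Finset.sum_add_distrib]
  have h7 := congrArg (fun z => (1 : DefAlg ν θ) ⊗ₜ[k] z) (h.symm_curvature hφ hD hlam hδ)
  simp only [TensorProduct.tmul_add] at h7
  rw [add_assoc (_ + _) _ (_ ⊗ₜ[k] c), ← h7]
  abel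

/-- The Nakayama automorphism of `U`. -/
lemma exists_nakayamaEquiv [FiniteDimensional k V] (h : IsFrobeniusTrace R d ϖ τ)
    (hφ : IsNakayamaAut R d φ) (hP : HasMatrix R x φ P) (hD : IsDualCurvedDGA ν θ δ c)
    {l : Fin n → k} (hδ : ∀ y, τ (δ y) = τ ((∑ j, l j • DualAlg.gen R (x.coord j)) * y)) :
    ∃ ξ : DefAlg ν θ ≃ₐ[k] DefAlg ν θ, ∀ v, ξ (DefAlg.gen ν θ v) = nakayamaGen ν θ d x P l v := by
  let f := DefAlg.lift (nakayamaGen ν θ d x P l)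
    ((maurerCartan_iff ν θ x _).1 (maurerCartan_nakayamaGen h hφ hP hD hδ))
  have hf : ∀ v, f (DefAlg.gen ν θ v) = nakayamaGen ν θ d x P l v := DefAlg.lift_apply_gen _ _
  have hu := hφ.isUnit_det hP
  have h1 : ∀ c : k, algebraMap k (DefAlg ν θ) c ∈ DefAlg.base ν θ := fun c =>
    Submodule.mem_sup_left (Submodule.mem_one.2 ⟨c, rfl⟩)
  have hmap : (DefAlg.base ν θ).map f.toLinearMap = DefAlg.base ν θ := by
    refine le_antisymm ?_ ?_
    · rw [DefAlg.base, Submodule.map_sup, sup_le_iff]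
      constructor
      · rintro _ ⟨_, ha, rfl⟩
        obtain ⟨c, rfl⟩ := Submodule.mem_one.1 ha
        change f _ ∈ _
        rw [AlgHom.commutes]
        exact h1 c
      · rw [← LinearMap.range_comp, LinearMap.range_le_iff_comap, ← top_le_iff, ← x.span_eq,
          Submodule.span_le]
        rintro _ ⟨j, rfl⟩
        change f (DefAlg.gen ν θ (x j)) ∈ DefAlg.base ν θ
        rw [hf, nakayamaGen_apply]
        refine add_mem (Submodule.smul_mem _ _ (Submodule.sum_mem _ fun i _ =>
          Submodule.smul_mem _ _ (DefAlg.gen_mem_base _ _ _))) (h1 _)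
    · have h2 : ∀ c : k, algebraMap k (DefAlg ν θ) c ∈ (DefAlg.base ν θ).map f.toLinearMap :=
        fun c => ⟨algebraMap k _ c, h1 c, f.commutes c⟩
      conv_lhs => rw [DefAlg.base]
      rw [sup_le_iff]
      constructor
      · intro a ha
        obtain ⟨c, rfl⟩ := Submodule.mem_one.1 ha
        exact h2 c
      · rw [LinearMap.range_eq_map, ← x.span_eq, Submodule.map_span, Submodule.span_le]
        rintro _ ⟨_, ⟨m, rfl⟩, rfl⟩
        -- `P` inverts the linear part of the substitution
        have h3 : DefAlg.gen ν θ (x m) = (-1 : k) ^ (d + 1) • ∑ j, P m j •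
            (f (DefAlg.gen ν θ (x j)) - algebraMap k _ (l j)) := by
          have h6 : (-1 : k) ^ (d + 1) * (-1) ^ (d + 1) = 1 := by rw [← mul_pow]; simp
          have h7 : ∀ j, f (DefAlg.gen ν θ (x j)) - algebraMap k _ (l j) =
              (-1 : k) ^ (d + 1) • ∑ i, P⁻¹ j i • DefAlg.gen ν θ (x i) := fun j => by
            rw [hf, nakayamaGen_apply, add_sub_cancel_right]
            rfl
          simp only [h7, Finset.smul_sum, smul_smul]
          rw [Finset.sum_comm]
          have h8 : ∀ i, ∑ j, ((-1 : k) ^ (d + 1) * (P m j * ((-1) ^ (d + 1) * P⁻¹ j i))) •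
              DefAlg.gen ν θ (x i) = (1 : Matrix _ _ k) m i • DefAlg.gen ν θ (x i) := fun i => by
            rw [← Finset.sum_smul, ← Matrix.mul_nonsing_inv P hu, Matrix.mul_apply]
            congr 1
            refine Finset.sum_congr rfl fun j _ => ?_
            linear_combination (P m j * P⁻¹ j i) * h6
          simp only [h8]
          rw [Finset.sum_eq_single m]
          · rw [Matrix.one_apply_eq, one_smul]
          · intro i _ hi
            rw [Matrix.one_apply_ne' hi, zero_smul]
          · simp
        change DefAlg.gen ν θ (x m) ∈ _
        rw [h3]
        refine Submodule.smul_mem _ _ (Submodule.sum_mem _ fun j _ => Submodule.smul_mem _ _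
          (sub_mem ⟨_, DefAlg.gen_mem_base _ _ _, rfl⟩ (h2 _)))
  exact ⟨AlgEquiv.ofBijective f (DefAlg.bijective_of_map_base hmap), hf⟩

end NakayamaMap

/-! ### The Koszul bimodule complex -/

section TwistedDifferential

variable {S E : Type u} {ι : Type*} [Ring S] [Algebra k S] [Ring E] [Algebra k E] [Fintype ι]
  (X Y : ι → S) (g : ι → E) (δ : E →ₗ[k] E) (s : k)

/-- The operator `t ⊗ a ↦ ∑ⱼ Xⱼ t ⊗ gⱼ a - s ∑ⱼ Yⱼ t ⊗ a gⱼ - t ⊗ δ a` on `S ⊗ E`; here `s` is the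
sign `(-1)^i` when it is restricted to elements `a` of degree `i`. -/
def twistedDiff : S ⊗[k] E →ₗ[k] S ⊗[k] E :=
  ∑ j, TensorProduct.map (LinearMap.mulLeft k (X j)) (LinearMap.mulLeft k (g j)) -
    s • ∑ j, TensorProduct.map (LinearMap.mulLeft k (Y j)) (LinearMap.mulRight k (g j)) -
    LinearMap.lTensor S δ

variable {X Y g δ s}

lemma twistedDiff_tmul (t : S) (a : E) : twistedDiff X Y g δ s (t ⊗ₜ a) =
    ∑ j, (X j * t) ⊗ₜ[k] (g j * a) - s • ∑ j, (Y j * t) ⊗ₜ[k] (a * g j) - t ⊗ₜ[k] δ a := by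
  simp [twistedDiff]

lemma slice_twistedDiff_tmul (χ : Module.Dual k E) (t : S) (a : E) :
    slice χ (twistedDiff X Y g δ s (t ⊗ₜ a)) = slice χ (twistedDiff X Y g δ s (1 ⊗ₜ a)) * t := by
  simp [twistedDiff_tmul, sub_mul, Finset.sum_mul]

/-- The operator squares to zero: the two Maurer–Cartan equations contribute curvature terms `c a`
and `- a c`, which cancel against `δ² a = a c - c a`. -/
lemma twistedDiff_sq {η : ι → E} {c a : E} (hs : s * s = 1) (hXY : ∀ i j, X i * Y j = Y j * X i)
    (hX : ∑ i, ∑ j, (X i * X j) ⊗ₜ[k] (g i * g j) = ∑ i, X i ⊗ₜ[k] η i + 1 ⊗ₜ[k] c)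
    (hY : ∑ i, ∑ j, (Y j * Y i) ⊗ₜ[k] (g i * g j) = ∑ i, Y i ⊗ₜ[k] η i + 1 ⊗ₜ[k] c)
    (h1 : ∀ j, δ (g j * a) = η j * a - g j * δ a)
    (h2 : ∀ j, δ (a * g j) = δ a * g j + s • (a * η j)) (h3 : δ (δ a) = a * c - c * a) :
    twistedDiff X Y g δ (-s) (twistedDiff X Y g δ s (1 ⊗ₜ a)) = 0 := by
  have hX' := congrArg (LinearMap.lTensor S (LinearMap.mulRight k a)) hX
  have hY' := congrArg (LinearMap.lTensor S (LinearMap.mulLeft k a)) hY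
  simp only [map_sum, map_add, LinearMap.lTensor_tmul, LinearMap.mulRight_apply,
    LinearMap.mulLeft_apply] at hX' hY'
  rw [twistedDiff_tmul, map_sub, map_sub, map_smul, map_sum, map_sum]
  simp only [twistedDiff_tmul, mul_one, h1, h2, h3, TensorProduct.tmul_sub, TensorProduct.tmul_add,
    Finset.sum_sub_distrib, Finset.sum_add_distrib, TensorProduct.tmul_smul, ← Finset.smul_sum]
  have e1 : ∑ j, ∑ i, (X i * X j) ⊗ₜ[k] (g i * (g j * a)) =
      ∑ i, X i ⊗ₜ[k] (η i * a) + 1 ⊗ₜ[k] (c * a) := by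
    rw [← hX', Finset.sum_comm]
    simp only [mul_assoc]
  have e2 : ∑ j, ∑ i, (Y i * Y j) ⊗ₜ[k] (a * g j * g i) =
      ∑ i, Y i ⊗ₜ[k] (a * η i) + 1 ⊗ₜ[k] (a * c) := by
    rw [← hY']
    simp only [mul_assoc]
  have e3 : ∑ j, ∑ i, (X i * Y j) ⊗ₜ[k] (g i * (a * g j)) =
      ∑ j, ∑ i, (Y i * X j) ⊗ₜ[k] (g j * a * g i) := by
    rw [Finset.sum_comm]
    simp only [mul_assoc, hXY]
  rw [e1, e2, e3]
  simp only [smul_sub, smul_add, smul_smul, hs, neg_smul, smul_neg, one_smul]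
  abel

lemma twistedDiff_eq_sum_slice {β : Type*} [Fintype β] (e : β → E) (χ : β → Module.Dual k E) {a : E}
    (h1 : ∀ j, ∑ q, χ q (g j * a) • e q = g j * a) (h2 : ∀ j, ∑ q, χ q (a * g j) • e q = a * g j)
    (h3 : ∑ q, χ q (δ a) • e q = δ a) : twistedDiff X Y g δ s (1 ⊗ₜ a) =
      ∑ q, slice (χ q) (twistedDiff X Y g δ s (1 ⊗ₜ a)) ⊗ₜ[k] e q := by
  have h : ∀ (t : S) {a : E}, ∑ q, χ q a • e q = a → ∑ q, (χ q a • t) ⊗ₜ[k] e q = t ⊗ₜ[k] a :=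
    fun t a ha => by
      conv_rhs => rw [← ha, TensorProduct.tmul_sum]
      simp only [TensorProduct.smul_tmul]
  rw [twistedDiff_tmul]
  simp only [map_sub, map_sum, map_smul, slice_tmul, TensorProduct.sub_tmul, TensorProduct.sum_tmul,
    Finset.sum_sub_distrib, ← TensorProduct.smul_tmul', ← Finset.smul_sum]
  simp only [TensorProduct.smul_tmul', Finset.smul_sum]
  rw [Finset.sum_comm, Finset.sum_comm (f := fun q j => (s • χ q (a * g j) • (Y j * 1)) ⊗ₜ[k] e q)]
  simp only [← TensorProduct.smul_tmul' s, ← Finset.smul_sum, h _ (h1 _), h _ (h2 _), h _ h3]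

end TwistedDifferential

section KoszulDifferential

variable [FiniteDimensional k V] {R : Submodule k (V ⊗[k] V)} (K : KoszulData R)
  {ν : R →ₗ[k] V} {θ : R →ₗ[k] k} {δ : DualAlg R →ₗ[k] DualAlg R} {c : DualAlg R}
  {n : ℕ} (x : Module.Basis (Fin n) k V)

/-- The part of the differential of the Koszul bimodule complex that acts on the left factor of
`U ⊗ U^op`, including the contribution of the derivation `δ`. -/
def KoszulData.leftPart (ν : R →ₗ[k] V) (θ : R →ₗ[k] k) (δ : DualAlg R →ₗ[k] DualAlg R) (i : ℕ)
    (q : Fin (K.b (i + 1))) (p : Fin (K.b i)) : DefAlg ν θ :=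
  ∑ j, K.coord (i + 1) (DualAlg.gen R (x.coord j) * K.e i p) q • DefAlg.gen ν θ (x j) -
    algebraMap k (DefAlg ν θ) (K.coord (i + 1) (δ (K.e i p)) q)

/-- The differential of the Koszul bimodule complex `⋯ → U^e ⊗ (A^!_1)^* → U^e` of `U`, in the
bases `K.e i` of `A^!_i`. -/
def KoszulData.diff (ν : R →ₗ[k] V) (θ : R →ₗ[k] k) (δ : DualAlg R →ₗ[k] DualAlg R) (i : ℕ) :
    Matrix (Fin (K.b (i + 1))) (Fin (K.b i)) (Env k (DefAlg ν θ)) := fun q p =>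
  K.leftPart x ν θ δ i q p ⊗ₜ 1 -
    (-1 : k) ^ i • (1 ⊗ₜ MulOpposite.op (DefAlg.gen ν θ (K.m i p q)))

/-- The differential as an operator on `U^e ⊗ A^!`. -/
abbrev diffOp (ν : R →ₗ[k] V) (θ : R →ₗ[k] k) (δ : DualAlg R →ₗ[k] DualAlg R) (i : ℕ) :
    Env k (DefAlg ν θ) ⊗[k] DualAlg R →ₗ[k] Env k (DefAlg ν θ) ⊗[k] DualAlg R :=
  twistedDiff (fun j => DefAlg.gen ν θ (x j) ⊗ₜ 1)
    (fun j => 1 ⊗ₜ MulOpposite.op (DefAlg.gen ν θ (x j)))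
    (fun j => DualAlg.gen R (x.coord j)) δ ((-1) ^ i)

lemma KoszulData.diff_eq_slice (i : ℕ) (q : Fin (K.b (i + 1))) (p : Fin (K.b i)) :
    K.diff x ν θ δ i q p =
      slice (LinearMap.proj q ∘ₗ K.coord (i + 1)) (diffOp x ν θ δ i (1 ⊗ₜ K.e i p)) := by
  have h1 : ∀ j, K.coord (i + 1) (K.e i p * DualAlg.gen R (x.coord j)) q =
      x.coord j (K.m i p q) := fun j => by
    rw [K.e_mul_gen, map_sum, Finset.sum_apply, Finset.sum_eq_single q]
    · rw [map_smul, K.coord_e, Pi.smul_apply, Pi.single_eq_same, smul_eq_mul, mul_one]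
    · intro q' _ hq'
      rw [map_smul, K.coord_e, Pi.smul_apply, Pi.single_eq_of_ne hq'.symm, smul_zero]
    · simp
  have h2 : DefAlg.gen ν θ (K.m i p q) =
      ∑ j, x.coord j (K.m i p q) • DefAlg.gen ν θ (x j) := by
    conv_lhs => rw [← x.sum_repr (K.m i p q)]
    rw [map_sum]
    simp only [map_smul, Module.Basis.coord_apply]
  rw [diffOp, twistedDiff_tmul, map_sub, map_sub, map_smul, map_sum, map_sum]
  simp only [slice_tmul, LinearMap.comp_apply, LinearMap.proj_apply, mul_one, h1]
  rw [KoszulData.diff, KoszulData.leftPart, h2, TensorProduct.sub_tmul, TensorProduct.sum_tmul,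
    Finset.op_sum, TensorProduct.tmul_sum, Algebra.algebraMap_eq_smul_one, sub_right_comm]
  simp only [← TensorProduct.smul_tmul', MulOpposite.op_smul, TensorProduct.tmul_smul]
  rfl

variable (hD : IsDualCurvedDGA ν θ δ c)
include hD

lemma KoszulData.diffOp_e (i : ℕ) (p : Fin (K.b i)) :
    diffOp x ν θ δ i (1 ⊗ₜ K.e i p) = ∑ q, K.diff x ν θ δ i q p ⊗ₜ[k] K.e (i + 1) q := by
  simp only [K.diff_eq_slice]
  exact twistedDiff_eq_sum_slice _ _
    (fun j => K.sum_coord_smul_e (gen_mul_mem_piece _ (K.e_mem i p)))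
    (fun j => K.sum_coord_smul_e (mul_gen_mem_piece _ (K.e_mem i p)))
    (K.sum_coord_smul_e (hD.degree _ _ (K.e_mem i p)))

/-- The square of the operator on elements of degree `i`. -/
lemma diffOp_sq {i : ℕ} {a : DualAlg R} (ha : a ∈ DualAlg.piece R i) :
    diffOp x ν θ δ (i + 1) (diffOp x ν θ δ i (1 ⊗ₜ a)) = 0 := by
  have h0 : (-1 : k) ^ (i + 1) = -(-1) ^ i := by rw [pow_succ, mul_neg_one]
  have hMC := maurerCartan_gen x ν θ
  simp only [canonicalElt, Finset.sum_mul, Finset.mul_sum, Algebra.TensorProduct.tmul_mul_tmul]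
    at hMC
  rw [Finset.sum_comm, ← hD.eq_ofDual] at hMC
  rw [diffOp, h0]
  refine twistedDiff_sq (η := fun j => eta ν (x.coord j)) (c := c)
    (by rw [← mul_pow]; simp) (fun i j => ?_) ?_ ?_ (fun j => ?_) (fun j => ?_) (hD.sq a)
  · rw [Algebra.TensorProduct.tmul_mul_tmul, Algebra.TensorProduct.tmul_mul_tmul, mul_one, one_mul,
      mul_one, one_mul]
  · have h1 := congrArg (LinearMap.rTensor (DualAlg R)
      ((TensorProduct.mk k (DefAlg ν θ) (DefAlg ν θ)ᵐᵒᵖ).flip 1)) hMC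
    simp only [map_sum, map_add, LinearMap.rTensor_tmul, LinearMap.flip_apply,
      TensorProduct.mk_apply] at h1
    simp only [Algebra.TensorProduct.tmul_mul_tmul, mul_one]
    exact h1
  · have h1 := congrArg (LinearMap.rTensor (DualAlg R)
      (TensorProduct.mk k (DefAlg ν θ) (DefAlg ν θ)ᵐᵒᵖ 1 ∘ₗ
        (MulOpposite.opLinearEquiv k).toLinearMap)) hMC
    simp only [map_sum, map_add, LinearMap.rTensor_tmul, LinearMap.comp_apply,
      TensorProduct.mk_apply, LinearEquiv.coe_coe, MulOpposite.coe_opLinearEquiv,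
      MulOpposite.op_mul, MulOpposite.op_one] at h1
    simp only [Algebra.TensorProduct.tmul_mul_tmul, mul_one]
    exact h1
  · rw [hD.apply_mul_one (gen_mem_piece _), hD.apply_gen]
  · rw [hD.leibniz i a ha, hD.apply_gen]
    exact congrArg (_ + ·) (neg_one_pow_mul_eq_smul i _)

/-- The Koszul bimodule complex is a complex. -/
lemma KoszulData.diff_mul_diff (i : ℕ) : K.diff x ν θ δ (i + 1) * K.diff x ν θ δ i = 0 := by
  ext r p
  have h1 := congrArg (slice (LinearMap.proj r ∘ₗ K.coord (i + 1 + 1)))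
    (diffOp_sq x hD (K.e_mem i p))
  rw [K.diffOp_e x hD, map_sum, map_sum, map_zero] at h1
  rw [Matrix.mul_apply, Matrix.zero_apply, ← h1]
  refine Finset.sum_congr rfl fun q _ => ?_
  rw [slice_twistedDiff_tmul, K.diff_eq_slice x (i + 1)]

end KoszulDifferential

/-! ### From graded to filtered exactness -/

section Filtration

variable {R : Submodule k (V ⊗[k] V)} (ν : R →ₗ[k] V) (θ : R →ₗ[k] k)

namespace DefAlg

lemma filtrationBelow_succ (n : ℕ) : filtrationBelow ν θ (n + 1) = base ν θ ^ n := rfl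

lemma filtrationBelow_le_succ (n : ℕ) : filtrationBelow ν θ n ≤ filtrationBelow ν θ (n + 1) := by
  cases n with
  | zero => exact bot_le
  | succ n => exact base_pow_mono ν θ n.le_succ

lemma exists_mem_filtrationBelow (a : DefAlg ν θ) : ∃ n, a ∈ filtrationBelow ν θ n := by
  obtain ⟨n, hn⟩ := exists_mem_base_pow ν θ a
  exact ⟨n + 1, hn⟩

variable {ν θ}

lemma filtrationBelow_mono : Monotone (filtrationBelow ν θ) :=
  monotone_nat_of_le_succ (filtrationBelow_le_succ ν θ)

lemma gen_mul_mem_filtrationBelow (v : V) {n : ℕ} {a : DefAlg ν θ}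
    (ha : a ∈ filtrationBelow ν θ n) : gen ν θ v * a ∈ filtrationBelow ν θ (n + 1) := by
  cases n with
  | zero =>
    rw [(Submodule.mem_bot k).1 ha, mul_zero]
    exact zero_mem _
  | succ n =>
    rw [filtrationBelow_succ, pow_succ']
    exact Submodule.mul_mem_mul (gen_mem_base ν θ v) ha

lemma mul_gen_mem_filtrationBelow (v : V) {n : ℕ} {a : DefAlg ν θ}
    (ha : a ∈ filtrationBelow ν θ n) : a * gen ν θ v ∈ filtrationBelow ν θ (n + 1) := by
  cases n with
  | zero =>
    rw [(Submodule.mem_bot k).1 ha, zero_mul]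
    exact zero_mem _
  | succ n =>
    rw [filtrationBelow_succ, pow_succ]
    exact Submodule.mul_mem_mul ha (gen_mem_base ν θ v)

lemma exists_sub_mk_mem {n : ℕ} {a : DefAlg ν θ} (ha : a ∈ filtrationBelow ν θ (n + 1)) :
    ∃ t ∈ LinearMap.range (TensorAlgebra.ι k (M := V)) ^ n,
      a - mk ν θ t ∈ filtrationBelow ν θ n := by
  rw [filtrationBelow_succ] at ha
  induction ha using Submodule.pow_induction_on_left' with
  | algebraMap c =>
    refine ⟨algebraMap k _ c, by rw [pow_zero]; exact Submodule.mem_one.2 ⟨c, rfl⟩, ?_⟩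
    rw [AlgHom.commutes, sub_self]
    exact zero_mem _
  | add a b i ha hb iha ihb =>
    obtain ⟨s, hs, hs'⟩ := iha
    obtain ⟨t, ht, ht'⟩ := ihb
    refine ⟨s + t, add_mem hs ht, ?_⟩
    rw [map_add, add_sub_add_comm]
    exact add_mem hs' ht'
  | mem_mul m hm i a ha iha =>
    obtain ⟨t, ht, ht'⟩ := iha
    obtain ⟨_, hc, _, ⟨v, rfl⟩, rfl⟩ := Submodule.mem_sup.1 hm
    obtain ⟨c, rfl⟩ := Submodule.mem_one.1 hc
    refine ⟨TensorAlgebra.ι k v * t, ?_, ?_⟩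
    · rw [pow_succ']; exact Submodule.mul_mem_mul ⟨v, rfl⟩ ht
    · have h1 : (algebraMap k (DefAlg ν θ) c + gen ν θ v) * a -
          mk ν θ (TensorAlgebra.ι k v * t) = c • a + gen ν θ v * (a - mk ν θ t) := by
        rw [map_mul, add_mul, Algebra.smul_def, mul_sub, add_sub_assoc]
        rfl
      rw [h1]
      exact add_mem (Submodule.smul_mem _ _ ha) (gen_mul_mem_filtrationBelow v ht')

/-- The algebra map `T(V) → U[X]` that multiplies tensors of degree `n` by `X^n`. -/
def homogenize (ν : R →ₗ[k] V) (θ : R →ₗ[k] k) :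
    TensorAlgebra k V →ₐ[k] Polynomial (DefAlg ν θ) :=
  TensorAlgebra.lift k ((Polynomial.monomial 1).restrictScalars k ∘ₗ gen ν θ)

lemma homogenize_of_mem {n : ℕ} {t : TensorAlgebra k V}
    (ht : t ∈ LinearMap.range (TensorAlgebra.ι k (M := V)) ^ n) :
    homogenize ν θ t = Polynomial.monomial n (mk ν θ t) := by
  induction ht using Submodule.pow_induction_on_left' with
  | algebraMap c => rw [AlgHom.commutes, AlgHom.commutes]; rfl
  | add a b i ha hb iha ihb => rw [map_add, map_add, map_add, iha, ihb]
  | mem_mul m hm i a ha iha =>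
    obtain ⟨v, rfl⟩ := hm
    rw [map_mul, map_mul, iha, homogenize, TensorAlgebra.lift_ι_apply, Nat.succ_eq_add_one,
      add_comm i 1]
    exact Polynomial.monomial_mul_monomial _ _ _ _

/-- The canonical map `A → gr U` is well defined. -/
lemma mk_mem_of_mk_eq_zero {n : ℕ} {t : TensorAlgebra k V}
    (ht : t ∈ LinearMap.range (TensorAlgebra.ι k (M := V)) ^ n) (h0 : QuadAlg.mk R t = 0) :
    mk ν θ t ∈ filtrationBelow ν θ n := by
  let J : Submodule k (TensorAlgebra k V) :=
    { carrier := {t | ∀ m, (homogenize ν θ t).coeff m ∈ filtrationBelow ν θ m}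
      zero_mem' := fun m => by rw [map_zero, Polynomial.coeff_zero]; exact zero_mem _
      add_mem' := fun {a b} ha hb m => by
        rw [map_add, Polynomial.coeff_add]; exact add_mem (ha m) (hb m)
      smul_mem' := fun c a ha m => by
        rw [map_smul, Polynomial.coeff_smul]; exact Submodule.smul_mem _ _ (ha m) }
  have hι : ∀ v, homogenize ν θ (TensorAlgebra.ι k v) = Polynomial.monomial 1 (gen ν θ v) :=
    fun v => TensorAlgebra.lift_ι_apply _ _
  have hl : ∀ a s, s ∈ J → a * s ∈ J := by
    intro a
    induction a using TensorAlgebra.induction with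
    | algebraMap c =>
      intro s hs
      rw [← Algebra.smul_def]
      exact J.smul_mem c hs
    | ι v =>
      intro s hs m
      rw [map_mul, hι]
      cases m with
      | zero =>
        rw [← Polynomial.C_mul_X_eq_monomial, mul_assoc, Polynomial.coeff_C_mul,
          Polynomial.coeff_X_mul_zero, mul_zero]
        exact zero_mem _
      | succ m =>
        rw [← Polynomial.C_mul_X_eq_monomial, mul_assoc, Polynomial.coeff_C_mul,
          Polynomial.coeff_X_mul]
        exact gen_mul_mem_filtrationBelow v (hs m)
    | mul a b ha hb => intro s hs; rw [mul_assoc]; exact ha _ (hb _ hs)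
    | add a b ha hb => intro s hs; rw [add_mul]; exact add_mem (ha _ hs) (hb _ hs)
  have hr : ∀ a s, s ∈ J → s * a ∈ J := by
    intro a
    induction a using TensorAlgebra.induction with
    | algebraMap c =>
      intro s hs
      rw [← Algebra.commutes, ← Algebra.smul_def]
      exact J.smul_mem c hs
    | ι v =>
      intro s hs m
      rw [map_mul, hι]
      cases m with
      | zero =>
        rw [← Polynomial.C_mul_X_eq_monomial, ← Polynomial.X_mul_C, ← mul_assoc,
          Polynomial.coeff_mul_C, Polynomial.coeff_mul_X_zero, zero_mul]
        exact zero_mem _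
      | succ m =>
        rw [← Polynomial.C_mul_X_eq_monomial, ← Polynomial.X_mul_C, ← mul_assoc,
          Polynomial.coeff_mul_C, Polynomial.coeff_mul_X]
        exact mul_gen_mem_filtrationBelow v (hs m)
    | mul a b ha hb => intro s hs; rw [← mul_assoc]; exact hb _ (ha _ hs)
    | add a b ha hb => intro s hs; rw [mul_add]; exact add_mem (ha _ hs) (hb _ hs)
  have h1 := sub_mem_of_mkAlgHom_eq (QuadRel R) J hl hr (by
    rintro _ _ ⟨r, hr⟩ m
    rw [sub_zero, homogenize_of_mem (tensorTwo_mem r), Polynomial.coeff_monomial]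
    split_ifs with hm
    · subst hm
      rw [mk_tensorTwo, mul_gen ν θ ⟨r, hr⟩, filtrationBelow_succ, pow_one]
      exact add_mem (gen_mem_base _ _ _) (Submodule.mem_sup_left (Submodule.mem_one.2 ⟨_, rfl⟩))
    · exact zero_mem _) (h0.trans (map_zero _).symm) n
  rwa [sub_zero, homogenize_of_mem ht, Polynomial.coeff_monomial, if_pos rfl] at h1

end DefAlg

/-- A graded exactness statement over `A` yields a filtered one over `U`. The maps `LT`, `LA`, `LU`
are the multiplications by an element of `V` on `T(V)`, `A` and `U`, all on the left or all on
the right. -/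
lemma exists_sub_sum_mem {ν : R →ₗ[k] V} {θ : R →ₗ[k] k} (hU : IsPBWDeformation ν θ)
    {α β γ : Type*} [Fintype β] [Fintype γ]
    {LT : V → TensorAlgebra k V →ₗ[k] TensorAlgebra k V} {LA : V → QuadAlg R →ₗ[k] QuadAlg R}
    {LU : V → DefAlg ν θ →ₗ[k] DefAlg ν θ}
    (hLA : ∀ v t, QuadAlg.mk R (LT v t) = LA v (QuadAlg.mk R t))
    (hLU : ∀ v t, DefAlg.mk ν θ (LT v t) = LU v (DefAlg.mk ν θ t))
    (hT : ∀ v n, ∀ t ∈ LinearMap.range (TensorAlgebra.ι k (M := V)) ^ n,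
      LT v t ∈ LinearMap.range (TensorAlgebra.ι k (M := V)) ^ (n + 1))
    (hF : ∀ v n, ∀ a ∈ DefAlg.filtrationBelow ν θ n, LU v a ∈ DefAlg.filtrationBelow ν θ (n + 1))
    {f : α → β → V} {g : β → γ → V}
    (h0 : ∀ v : β → QuadAlg R, (∀ q, v q ∈ piece R 0) → (∀ p, ∑ q, LA (f p q) (v q) = 0) → v = 0)
    (h1 : ∀ n, ∀ v : β → QuadAlg R, (∀ q, v q ∈ piece R (n + 1)) →
      (∀ p, ∑ q, LA (f p q) (v q) = 0) →
        ∃ w : γ → QuadAlg R, (∀ r, w r ∈ piece R n) ∧ ∀ q, ∑ r, LA (g q r) (w r) = v q)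
    (n : ℕ) (a : β → DefAlg ν θ) (ha : ∀ q, a q ∈ DefAlg.filtrationBelow ν θ (n + 1))
    (ha' : ∀ p, ∑ q, LU (f p q) (a q) ∈ DefAlg.filtrationBelow ν θ (n + 1)) :
    ∃ w : γ → DefAlg ν θ, (∀ r, w r ∈ DefAlg.filtrationBelow ν θ n) ∧
      ∀ q, a q - ∑ r, LU (g q r) (w r) ∈ DefAlg.filtrationBelow ν θ n := by
  choose t ht hat using fun q => DefAlg.exists_sub_mk_mem (ha q)
  have htA : ∀ q, QuadAlg.mk R (t q) ∈ piece R n := fun q => by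
    have h2 := Submodule.mem_map_of_mem (f := (QuadAlg.mk R).toLinearMap) (ht q)
    rw [Submodule.map_pow, ← LinearMap.range_comp] at h2
    exact h2
  have hker : ∀ p, ∑ q, LA (f p q) (QuadAlg.mk R (t q)) = 0 := fun p => by
    simp only [← hLA, ← map_sum]
    refine hU (n + 1) _ (Submodule.sum_mem _ fun q _ => hT _ _ _ (ht q)) ?_
    rw [map_sum]
    have h2 : ∑ q, DefAlg.mk ν θ (LT (f p q) (t q)) =
        ∑ q, LU (f p q) (a q) - ∑ q, LU (f p q) (a q - DefAlg.mk ν θ (t q)) := by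
      simp only [map_sub, hLU, Finset.sum_sub_distrib]
      abel
    rw [h2]
    exact sub_mem (ha' p) (Submodule.sum_mem _ fun q _ => hF _ _ _ (hat q))
  cases n with
  | zero =>
    refine ⟨0, fun r => zero_mem _, fun q => ?_⟩
    have h2 := DefAlg.mk_mem_of_mk_eq_zero (ν := ν) (θ := θ) (ht q) (congrFun (h0 _ htA hker) q)
    simp only [Pi.zero_apply, map_zero, Finset.sum_const_zero, sub_zero]
    have h3 := add_mem (hat q) h2
    rwa [sub_add_cancel] at h3
  | succ n =>
    obtain ⟨w, hw, hwt⟩ := h1 n _ htA hker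
    choose s hs hsw using fun r => exists_mk_of_mem_piece (hw r)
    refine ⟨fun r => DefAlg.mk ν θ (s r), fun r => ?_, fun q => ?_⟩
    · have h2 := Submodule.mem_map_of_mem (f := (DefAlg.mk ν θ).toLinearMap) (hs r)
      rw [Submodule.map_pow, ← LinearMap.range_comp] at h2
      exact (pow_le_pow_left' le_sup_right n : LinearMap.range (DefAlg.gen ν θ) ^ n ≤ _) h2
    · have h2 : t q - ∑ r, LT (g q r) (s r) ∈
          LinearMap.range (TensorAlgebra.ι k (M := V)) ^ (n + 1) :=
        sub_mem (ht q) (Submodule.sum_mem _ fun r _ => hT _ _ _ (hs r))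
      have h3 : QuadAlg.mk R (t q - ∑ r, LT (g q r) (s r)) = 0 := by
        rw [map_sub, map_sum, ← hwt, sub_eq_zero]
        exact Finset.sum_congr rfl fun r _ => by rw [hLA, hsw]
      have h4 := add_mem (hat q) (DefAlg.mk_mem_of_mk_eq_zero (ν := ν) (θ := θ) h2 h3)
      rw [map_sub, map_sum, sub_add_sub_cancel] at h4
      simpa only [hLU] using h4

end Filtration

/-! ### Filtrations of tensor products -/

section TensorFiltration

variable (L : Type u) {N : Type u} [AddCommGroup L] [Module k L] [AddCommGroup N] [Module k N]

/-- The image of `L ⊗ G` in `L ⊗ N`. -/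
def tensorFil (G : Submodule k N) : Submodule k (L ⊗[k] N) := LinearMap.range (G.subtype.lTensor L)

variable {L}

lemma tmul_mem_tensorFil {G : Submodule k N} (l : L) {a : N} (ha : a ∈ G) :
    l ⊗ₜ[k] a ∈ tensorFil L G := ⟨l ⊗ₜ ⟨a, ha⟩, rfl⟩

lemma tensorFil_le {G : Submodule k N} {J : Submodule k (L ⊗[k] N)}
    (h : ∀ (l : L), ∀ a ∈ G, l ⊗ₜ[k] a ∈ J) : tensorFil L G ≤ J := by
  rintro _ ⟨z, rfl⟩
  induction z using TensorProduct.induction_on with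
  | zero => rw [map_zero]; exact zero_mem _
  | tmul l a => exact h l a a.2
  | add a b ha hb => rw [map_add]; exact add_mem ha hb

lemma tensorFil_mono : Monotone (tensorFil (k := k) (N := N) L) := fun _ _ hG =>
  tensorFil_le fun l _ ha => tmul_mem_tensorFil l (hG ha)

lemma tensorFil_bot : tensorFil (k := k) (N := N) L ⊥ = ⊥ := by
  rw [eq_bot_iff]
  refine tensorFil_le fun l a ha => ?_
  rw [(Submodule.mem_bot k).1 ha, TensorProduct.tmul_zero]
  exact zero_mem _

lemma exists_mem_tensorFil {G : ℕ → Submodule k N} (hmono : Monotone G) (hG : ∀ a, ∃ n, a ∈ G n)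
    (z : L ⊗[k] N) : ∃ n, z ∈ tensorFil L (G n) := by
  induction z using TensorProduct.induction_on with
  | zero => exact ⟨0, zero_mem _⟩
  | tmul l a => exact (hG a).imp fun n hn => tmul_mem_tensorFil l hn
  | add a b ha hb =>
    obtain ⟨m, ha⟩ := ha
    obtain ⟨n, hb⟩ := hb
    exact ⟨max m n, add_mem (tensorFil_mono (hmono (le_max_left m n)) ha)
      (tensorFil_mono (hmono (le_max_right m n)) hb)⟩

section Basis

/-- The coordinates in `N` of an element of `L ⊗ N`, for a basis of `L`. -/
def coordLeft : L ⊗[k] N ≃ₗ[k] Module.Basis.ofVectorSpaceIndex k L →₀ N :=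
  letI := Classical.decEq (Module.Basis.ofVectorSpaceIndex k L)
  TensorProduct.equivFinsuppOfBasisLeft (Module.Basis.ofVectorSpace k L)

lemma coordLeft_tmul (l : L) (a : N) (j) : coordLeft (k := k) (l ⊗ₜ[k] a) j =
    (Module.Basis.ofVectorSpace k L).repr l j • a :=
  letI := Classical.decEq (Module.Basis.ofVectorSpaceIndex k L)
  TensorProduct.equivFinsuppOfBasisLeft_apply_tmul_apply _ _ _ _

lemma coordLeft_lTensor (A : N →ₗ[k] N) (z : L ⊗[k] N) (j) :
    coordLeft (k := k) (A.lTensor L z) j = A (coordLeft (k := k) z j) := by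
  induction z using TensorProduct.induction_on with
  | zero => simp
  | tmul l a => simp [coordLeft_tmul]
  | add a b ha hb => simp only [map_add, Finsupp.add_apply, ha, hb]

lemma mem_tensorFil_iff {G : Submodule k N} {z : L ⊗[k] N} :
    z ∈ tensorFil L G ↔ ∀ j, coordLeft (k := k) z j ∈ G := by
  constructor
  · rintro ⟨w, rfl⟩ j
    induction w using TensorProduct.induction_on with
    | zero => simp
    | tmul l a =>
      rw [LinearMap.lTensor_tmul, coordLeft_tmul]
      exact G.smul_mem _ a.2
    | add a b ha hb => rw [map_add, map_add, Finsupp.add_apply]; exact add_mem ha hb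
  · intro h
    let _ := Classical.decEq (Module.Basis.ofVectorSpaceIndex k L)
    rw [← (coordLeft (k := k)).symm_apply_apply z, coordLeft,
      TensorProduct.equivFinsuppOfBasisLeft_symm_apply]
    exact Submodule.sum_mem _ fun j _ => tmul_mem_tensorFil _ (h j)

variable {α β γ : Type*} [Fintype β] [Fintype γ] {A : α → β → N →ₗ[k] N} {B : β → γ → N →ₗ[k] N}

/-- A filtered exactness statement for `N` passes to `L ⊗ N`, coordinate by coordinate in a basis
of `L`. -/
lemma exists_sub_sum_lTensor_mem {G G' : Submodule k N}
    (h : ∀ a : β → N, (∀ q, a q ∈ G') → (∀ p, ∑ q, A p q (a q) ∈ G') →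
      ∃ w : γ → N, (∀ r, w r ∈ G) ∧ ∀ q, a q - ∑ r, B q r (w r) ∈ G)
    (a : β → L ⊗[k] N) (ha : ∀ q, a q ∈ tensorFil L G')
    (ha' : ∀ p, ∑ q, (A p q).lTensor L (a q) ∈ tensorFil L G') :
    ∃ w : γ → L ⊗[k] N, (∀ r, w r ∈ tensorFil L G) ∧
      ∀ q, a q - ∑ r, (B q r).lTensor L (w r) ∈ tensorFil L G := by
  classical
  simp only [mem_tensorFil_iff, map_sum, Finsupp.coe_finsetSum, Finset.sum_apply,
    coordLeft_lTensor] at ha ha'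
  choose w hw hw' using fun j => h (fun q => coordLeft (k := k) (a q) j) (fun q => ha q j)
    (fun p => ha' p j)
  let T := Finset.univ.biUnion fun q => (coordLeft (k := k) (a q)).support
  let w' : γ → L ⊗[k] N := fun r => ∑ j ∈ T, Module.Basis.ofVectorSpace k L j ⊗ₜ w j r
  have hw1 : ∀ r j, coordLeft (k := k) (w' r) j = if j ∈ T then w j r else 0 := fun r j => by
    simp only [w', map_sum, Finsupp.coe_finsetSum, Finset.sum_apply, coordLeft_tmul,
      Module.Basis.repr_self, Finsupp.single_apply, ite_smul, one_smul, zero_smul]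
    rw [Finset.sum_ite_eq' T j fun i => w i r]
  refine ⟨w', fun r => mem_tensorFil_iff.2 fun j => ?_, fun q => mem_tensorFil_iff.2 fun j => ?_⟩
  · rw [hw1]
    split_ifs
    · exact hw j r
    · exact zero_mem _
  · simp only [map_sub, map_sum, Finsupp.coe_sub, Pi.sub_apply, Finsupp.coe_finsetSum,
      Finset.sum_apply, coordLeft_lTensor, hw1]
    split_ifs with hj
    · exact hw' j q
    · have h1 : coordLeft (k := k) (a q) j = 0 := by
        by_contra h2
        exact hj (Finset.mem_biUnion.2 ⟨q, Finset.mem_univ _, Finsupp.mem_support_iff.2 h2⟩)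
      simp [h1]

/-- Exactness of a filtered complex follows from exactness of its leading part. Here `A` and `B`
are the leading parts of the two maps, acting on the second factor and raising the filtration by
one, and `C` and `C'` are the remaining parts, which preserve the filtration; `hcomp` says that the
two maps compose to zero. -/
lemma exists_eq_of_leading_exact {G : ℕ → Submodule k N} (hG0 : G 0 = ⊥) (hmono : Monotone G)
    (hG : ∀ a, ∃ n, a ∈ G n)
    (h : ∀ n, ∀ a : β → N, (∀ q, a q ∈ G (n + 1)) → (∀ p, ∑ q, A p q (a q) ∈ G (n + 1)) →
      ∃ w : γ → N, (∀ r, w r ∈ G n) ∧ ∀ q, a q - ∑ r, B q r (w r) ∈ G n)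
    {C : α → β → L ⊗[k] N →ₗ[k] L ⊗[k] N} {C' : β → γ → L ⊗[k] N →ₗ[k] L ⊗[k] N}
    (hC : ∀ p q n, ∀ z ∈ tensorFil L (G n), C p q z ∈ tensorFil L (G n))
    (hC' : ∀ q r n, ∀ z ∈ tensorFil L (G n), C' q r z ∈ tensorFil L (G n))
    {s s' : k} (hs : s * s = 1) (hs' : s' * s' = 1)
    (hcomp : ∀ (w : γ → L ⊗[k] N) (b : β → L ⊗[k] N),
      (∀ q, ∑ r, (C' q r (w r) - s' • (B q r).lTensor L (w r)) = b q) →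
        ∀ p, ∑ q, (C p q (b q) - s • (A p q).lTensor L (b q)) = 0)
    (a : β → L ⊗[k] N) (ha : ∀ p, ∑ q, (C p q (a q) - s • (A p q).lTensor L (a q)) = 0) :
    ∃ w : γ → L ⊗[k] N, ∀ q, ∑ r, (C' q r (w r) - s' • (B q r).lTensor L (w r)) = a q := by
  have hn : ∃ n, ∀ q, a q ∈ tensorFil L (G n) := by
    choose m hm using fun q => exists_mem_tensorFil hmono hG (a q)
    exact ⟨Finset.univ.sup m, fun q =>
      tensorFil_mono (hmono (Finset.le_sup (Finset.mem_univ q))) (hm q)⟩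
  obtain ⟨n, hn⟩ := hn
  induction n generalizing a with
  | zero =>
    rw [hG0, tensorFil_bot] at hn
    exact ⟨0, fun q => by simp [(Submodule.mem_bot k).1 (hn q)]⟩
  | succ n ih =>
    have h1 : ∀ p, ∑ q, (A p q).lTensor L (a q) ∈ tensorFil L (G (n + 1)) := fun p => by
      have h2 := ha p
      rw [Finset.sum_sub_distrib] at h2
      rw [sub_eq_zero, ← Finset.smul_sum] at h2
      have h3 := congrArg (s • ·) h2
      simp only [smul_smul, hs, one_smul] at h3
      rw [← h3]
      exact Submodule.smul_mem _ _ (Submodule.sum_mem _ fun q _ => hC _ _ _ _ (hn q))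
    obtain ⟨w, hw, hw'⟩ := exists_sub_sum_lTensor_mem (h n) a hn h1
    have h4 : ∀ q, ∑ r, (C' q r (-(s' • w r)) - s' • (B q r).lTensor L (-(s' • w r))) =
        ∑ r, (B q r).lTensor L (w r) - s' • ∑ r, C' q r (w r) := fun q => by
      simp only [map_neg, map_smul, smul_neg, smul_smul, hs', one_smul, Finset.sum_sub_distrib,
        Finset.sum_neg_distrib, Finset.smul_sum]
      abel
    obtain ⟨w'', hw''⟩ := ih
      (fun q => a q - (∑ r, (B q r).lTensor L (w r) - s' • ∑ r, C' q r (w r)))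
      (fun p => by
        have h5 := hcomp _ _ h4 p
        rw [← sub_eq_zero.2 ((ha p).trans h5.symm), ← Finset.sum_sub_distrib]
        refine Finset.sum_congr rfl fun q _ => ?_
        rw [map_sub (C p q) (a q), map_sub ((A p q).lTensor L) (a q), smul_sub]
        abel)
      (fun q => by
        rw [← sub_add]
        exact add_mem (hw' q) (Submodule.smul_mem _ _
          (Submodule.sum_mem _ fun r _ => hC' _ _ _ _ (hw r))))
    refine ⟨fun r => w'' r + -(s' • w r), fun q => ?_⟩
    rw [← sub_add_cancel (a q), ← hw'' q, ← h4, ← Finset.sum_add_distrib]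
    refine Finset.sum_congr rfl fun r _ => ?_
    rw [map_add, map_add, smul_add]
    abel

end Basis

end TensorFiltration

/-! ### Exactness of the Koszul bimodule complex and of its dual -/

section Exactness

variable {R : Submodule k (V ⊗[k] V)} (K : KoszulData R) {ν : R →ₗ[k] V} {θ : R →ₗ[k] k}

lemma KoszulData.exists_of_vecMul_eq_zero {d : ℕ} (hG : IsASGorenstein R d) {i n : ℕ}
    (hi : i + 1 ≠ d) {v : Fin (K.b (i + 1)) → QuadAlg R} (hv : ∀ p, v p ∈ piece R (n + 1))
    (h : Matrix.vecMul v (K.M (i + 1)) = 0) :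
    ∃ w, (∀ p, w p ∈ piece R n) ∧ Matrix.vecMul w (K.M i) = v := by
  obtain ⟨z, hz⟩ := K.exists_vecMul_eq hG hi h
  refine ⟨fun p => proj R n (z p), fun p => proj_mem _ _, funext fun q => ?_⟩
  rw [← K.proj_vecMul, hz, proj_self (hv q)]

lemma KoszulData.eq_zero_of_vecMul_eq_zero {d : ℕ} (hG : IsASGorenstein R d) {i : ℕ}
    (hi : i + 1 ≠ d) {v : Fin (K.b (i + 1)) → QuadAlg R} (hv : ∀ p, v p ∈ piece R 0)
    (h : Matrix.vecMul v (K.M (i + 1)) = 0) : v = 0 := by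
  obtain ⟨z, hz⟩ := K.exists_vecMul_eq hG hi h
  funext q
  rw [Pi.zero_apply, ← proj_self (hv q), ← hz, K.proj_zero_vecMul]

/-- The filtration of `U^op`. -/
def opFil (ν : R →ₗ[k] V) (θ : R →ₗ[k] k) (n : ℕ) : Submodule k (DefAlg ν θ)ᵐᵒᵖ :=
  (DefAlg.filtrationBelow ν θ n).comap (MulOpposite.opLinearEquiv k).symm.toLinearMap

lemma opFil_zero : opFil ν θ 0 = ⊥ := by
  rw [eq_bot_iff]
  intro a ha
  exact (Submodule.mem_bot k).2 (MulOpposite.unop_injective ((Submodule.mem_bot k).1 ha))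

lemma opFil_mono : Monotone (opFil ν θ) := fun _ _ h _ ha => DefAlg.filtrationBelow_mono h ha

lemma exists_mem_opFil (a : (DefAlg ν θ)ᵐᵒᵖ) : ∃ n, a ∈ opFil ν θ n :=
  DefAlg.exists_mem_filtrationBelow ν θ a.unop

lemma gen_mul_range_pow (v : V) (n : ℕ) (t)
    (ht : t ∈ LinearMap.range (TensorAlgebra.ι k (M := V)) ^ n) :
    LinearMap.mulLeft k (TensorAlgebra.ι k v) t ∈
      LinearMap.range (TensorAlgebra.ι k (M := V)) ^ (n + 1) := by
  rw [pow_succ']; exact Submodule.mul_mem_mul ⟨v, rfl⟩ ht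

lemma range_pow_mul_gen (v : V) (n : ℕ) (t)
    (ht : t ∈ LinearMap.range (TensorAlgebra.ι k (M := V)) ^ n) :
    LinearMap.mulRight k (TensorAlgebra.ι k v) t ∈
      LinearMap.range (TensorAlgebra.ι k (M := V)) ^ (n + 1) := by
  rw [pow_succ]; exact Submodule.mul_mem_mul ht ⟨v, rfl⟩

/-- Right multiplication on `U^op` is left multiplication on `U`. -/
lemma exists_sub_sum_opFil_mulRight (hU : IsPBWDeformation ν θ) (i n : ℕ)
    (a : Fin (K.b (i + 1)) → (DefAlg ν θ)ᵐᵒᵖ) (ha : ∀ q, a q ∈ opFil ν θ (n + 1))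
    (ha' : ∀ p, ∑ q, LinearMap.mulRight k (MulOpposite.op (DefAlg.gen ν θ (K.m i p q))) (a q) ∈
      opFil ν θ (n + 1)) :
    ∃ w : Fin (K.b (i + 2)) → (DefAlg ν θ)ᵐᵒᵖ, (∀ r, w r ∈ opFil ν θ n) ∧ ∀ q, a q -
      ∑ r, LinearMap.mulRight k (MulOpposite.op (DefAlg.gen ν θ (K.m (i + 1) q r))) (w r) ∈
        opFil ν θ n := by
  obtain ⟨w, hw, hw'⟩ := exists_sub_sum_mem hU
    (LT := fun v => LinearMap.mulLeft k (TensorAlgebra.ι k v))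
    (LA := fun v => LinearMap.mulLeft k (gen R v))
    (LU := fun v => LinearMap.mulLeft k (DefAlg.gen ν θ v))
    (f := K.m i) (g := K.m (i + 1)) (fun v t => map_mul (QuadAlg.mk R) _ _)
    (fun v t => map_mul (DefAlg.mk ν θ) _ _) gen_mul_range_pow
    (fun v n a ha => DefAlg.gen_mul_mem_filtrationBelow v ha)
    (fun v hv h => K.eq_zero_of_mulVec_eq_zero hv
      (funext fun p => (K.mulVec_apply _ _ _).trans (h p)))
    (fun n v hv h => by
      obtain ⟨w, hw, hw'⟩ := K.exists_of_mulVec_eq_zero hv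
        (funext fun p => (K.mulVec_apply _ _ _).trans (h p))
      exact ⟨w, hw, fun q => (K.mulVec_apply _ _ _).symm.trans (congrFun hw' q)⟩)
    n (fun q => (a q).unop) ha (fun p => by
      have h1 := ha' p
      rw [opFil, Submodule.mem_comap, map_sum] at h1
      exact h1)
  refine ⟨fun r => MulOpposite.op (w r), hw, fun q => ?_⟩
  rw [opFil, Submodule.mem_comap, map_sub, map_sum]
  exact hw' q

/-- Left multiplication on `U^op` is right multiplication on `U`. -/
lemma exists_sub_sum_opFil_mulLeft (hU : IsPBWDeformation ν θ) {d : ℕ} (hG : IsASGorenstein R d)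
    (i : ℕ) (hi : i + 1 ≠ d) (n : ℕ)
    (a : Fin (K.b (i + 1)) → (DefAlg ν θ)ᵐᵒᵖ) (ha : ∀ q, a q ∈ opFil ν θ (n + 1))
    (ha' : ∀ p, ∑ q, LinearMap.mulLeft k (MulOpposite.op (DefAlg.gen ν θ (K.m (i + 1) q p))) (a q) ∈
      opFil ν θ (n + 1)) :
    ∃ w : Fin (K.b i) → (DefAlg ν θ)ᵐᵒᵖ, (∀ r, w r ∈ opFil ν θ n) ∧ ∀ q, a q -
      ∑ r, LinearMap.mulLeft k (MulOpposite.op (DefAlg.gen ν θ (K.m i r q))) (w r) ∈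
        opFil ν θ n := by
  obtain ⟨w, hw, hw'⟩ := exists_sub_sum_mem hU
    (LT := fun v => LinearMap.mulRight k (TensorAlgebra.ι k v))
    (LA := fun v => LinearMap.mulRight k (gen R v))
    (LU := fun v => LinearMap.mulRight k (DefAlg.gen ν θ v))
    (f := fun p q => K.m (i + 1) q p) (g := fun q r => K.m i r q)
    (fun v t => map_mul (QuadAlg.mk R) _ _)
    (fun v t => map_mul (DefAlg.mk ν θ) _ _) range_pow_mul_gen
    (fun v n a ha => DefAlg.mul_gen_mem_filtrationBelow v ha)
    (fun v hv h => K.eq_zero_of_vecMul_eq_zero hG hi hv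
      (funext fun p => (K.vecMul_apply _ _ _).trans (h p)))
    (fun n v hv h => by
      obtain ⟨w, hw, hw'⟩ := K.exists_of_vecMul_eq_zero hG hi hv
        (funext fun p => (K.vecMul_apply _ _ _).trans (h p))
      exact ⟨w, hw, fun q => (K.vecMul_apply _ _ _).symm.trans (congrFun hw' q)⟩)
    n (fun q => (a q).unop) ha (fun p => by
      have h1 := ha' p
      rw [opFil, Submodule.mem_comap, map_sum] at h1
      exact h1)
  refine ⟨fun r => MulOpposite.op (w r), hw, fun q => ?_⟩
  rw [opFil, Submodule.mem_comap, map_sub, map_sum]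
  exact hw' q

/-- Multiplication by `V` is injective at the start of the dual complex. -/
lemma mem_opFil_of_sum_mulLeft_mem (hU : IsPBWDeformation ν θ) {d : ℕ} (hG : IsASGorenstein R d)
    (hd : d ≠ 0) (n : ℕ) (a : Fin (K.b 0) → (DefAlg ν θ)ᵐᵒᵖ) (ha : ∀ q, a q ∈ opFil ν θ (n + 1))
    (ha' : ∀ p, ∑ q, LinearMap.mulLeft k (MulOpposite.op (DefAlg.gen ν θ (K.m 0 q p))) (a q) ∈
      opFil ν θ (n + 1)) (q) : a q ∈ opFil ν θ n := by
  have h0 : ∀ v : Fin (K.b 0) → QuadAlg R,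
      (∀ p, ∑ q, LinearMap.mulRight k (gen R (K.m 0 q p)) (v q) = 0) → v = 0 := fun v h =>
    K.eq_zero_of_vecMul_zero hG hd (funext fun p => (K.vecMul_apply _ _ _).trans (h p))
  obtain ⟨w, hw, hw'⟩ := exists_sub_sum_mem hU (γ := Fin 0)
    (LT := fun v => LinearMap.mulRight k (TensorAlgebra.ι k v))
    (LA := fun v => LinearMap.mulRight k (gen R v))
    (LU := fun v => LinearMap.mulRight k (DefAlg.gen ν θ v))
    (f := fun p q => K.m 0 q p) (g := fun q r => 0)
    (fun v t => map_mul (QuadAlg.mk R) _ _)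
    (fun v t => map_mul (DefAlg.mk ν θ) _ _) range_pow_mul_gen
    (fun v n a ha => DefAlg.mul_gen_mem_filtrationBelow v ha)
    (fun v _ h => h0 v h)
    (fun n v _ h => ⟨0, fun r => zero_mem _, fun q => by rw [h0 v h]; simp⟩)
    n (fun q => (a q).unop) ha (fun p => by
      have h1 := ha' p
      rw [opFil, Submodule.mem_comap, map_sum] at h1
      exact h1)
  have := hw' q
  rw [Finset.univ_eq_empty, Finset.sum_empty, sub_zero] at this
  exact this

lemma mulLeft_tmul_one_mem {n : ℕ} (b : DefAlg ν θ) (z : Env k (DefAlg ν θ))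
    (hz : z ∈ tensorFil (DefAlg ν θ) (opFil ν θ n)) :
    LinearMap.mulLeft k (b ⊗ₜ[k] (1 : (DefAlg ν θ)ᵐᵒᵖ)) z ∈
      tensorFil (DefAlg ν θ) (opFil ν θ n) := by
  suffices tensorFil (DefAlg ν θ) (opFil ν θ n) ≤
      (tensorFil (DefAlg ν θ) (opFil ν θ n)).comap
        (LinearMap.mulLeft k (b ⊗ₜ[k] (1 : (DefAlg ν θ)ᵐᵒᵖ))) from this hz
  refine tensorFil_le fun l a ha => ?_
  rw [Submodule.mem_comap, LinearMap.mulLeft_apply, Algebra.TensorProduct.tmul_mul_tmul, one_mul]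
  exact tmul_mem_tensorFil _ ha

lemma mulRight_tmul_one_mem {n : ℕ} (b : DefAlg ν θ) (z : Env k (DefAlg ν θ))
    (hz : z ∈ tensorFil (DefAlg ν θ) (opFil ν θ n)) :
    LinearMap.mulRight k (b ⊗ₜ[k] (1 : (DefAlg ν θ)ᵐᵒᵖ)) z ∈
      tensorFil (DefAlg ν θ) (opFil ν θ n) := by
  suffices tensorFil (DefAlg ν θ) (opFil ν θ n) ≤
      (tensorFil (DefAlg ν θ) (opFil ν θ n)).comap
        (LinearMap.mulRight k (b ⊗ₜ[k] (1 : (DefAlg ν θ)ᵐᵒᵖ))) from this hz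
  refine tensorFil_le fun l a ha => ?_
  rw [Submodule.mem_comap, LinearMap.mulRight_apply, Algebra.TensorProduct.tmul_mul_tmul, mul_one]
  exact tmul_mem_tensorFil _ ha

lemma lTensor_mulLeft (a : (DefAlg ν θ)ᵐᵒᵖ) : (LinearMap.mulLeft k a).lTensor (DefAlg ν θ) =
    LinearMap.mulLeft k ((1 : DefAlg ν θ) ⊗ₜ[k] a) := by
  refine TensorProduct.ext' fun l b => ?_
  rw [LinearMap.lTensor_tmul, LinearMap.mulLeft_apply, LinearMap.mulLeft_apply,
    Algebra.TensorProduct.tmul_mul_tmul, one_mul]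

lemma lTensor_mulRight (a : (DefAlg ν θ)ᵐᵒᵖ) : (LinearMap.mulRight k a).lTensor (DefAlg ν θ) =
    LinearMap.mulRight k ((1 : DefAlg ν θ) ⊗ₜ[k] a) := by
  refine TensorProduct.ext' fun l b => ?_
  rw [LinearMap.lTensor_tmul, LinearMap.mulRight_apply, LinearMap.mulRight_apply,
    Algebra.TensorProduct.tmul_mul_tmul, mul_one]

lemma neg_one_pow_mul_self (i : ℕ) : (-1 : k) ^ i * (-1) ^ i = 1 := by rw [← mul_pow]; simp

variable {δ : DualAlg R →ₗ[k] DualAlg R} {c : DualAlg R}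
  {n : ℕ} (x : Module.Basis (Fin n) k V)

lemma KoszulData.mul_diff (i : ℕ) (q p) (z : Env k (DefAlg ν θ)) :
    LinearMap.mulRight k (K.leftPart x ν θ δ i q p ⊗ₜ[k] (1 : (DefAlg ν θ)ᵐᵒᵖ)) z -
      (-1 : k) ^ i • (LinearMap.mulRight k
        (MulOpposite.op (DefAlg.gen ν θ (K.m i p q)))).lTensor (DefAlg ν θ) z =
      z * K.diff x ν θ δ i q p := by
  rw [lTensor_mulRight, LinearMap.mulRight_apply, LinearMap.mulRight_apply, KoszulData.diff,
    mul_sub, mul_smul_comm]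

lemma KoszulData.diff_mul (i : ℕ) (q p) (z : Env k (DefAlg ν θ)) :
    LinearMap.mulLeft k (K.leftPart x ν θ δ i q p ⊗ₜ[k] (1 : (DefAlg ν θ)ᵐᵒᵖ)) z -
      (-1 : k) ^ i • (LinearMap.mulLeft k
        (MulOpposite.op (DefAlg.gen ν θ (K.m i p q)))).lTensor (DefAlg ν θ) z =
      K.diff x ν θ δ i q p * z := by
  rw [lTensor_mulLeft, LinearMap.mulLeft_apply, LinearMap.mulLeft_apply, KoszulData.diff,
    sub_mul, smul_mul_assoc]

variable [FiniteDimensional k V] (hU : IsPBWDeformation ν θ) (hD : IsDualCurvedDGA ν θ δ c)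
include hU hD

/-- The Koszul bimodule complex is exact in positive degrees. -/
lemma KoszulData.exists_vecMul_diff_eq {i : ℕ} {v : Fin (K.b (i + 1)) → Env k (DefAlg ν θ)}
    (hv : Matrix.vecMul v (K.diff x ν θ δ i) = 0) :
    ∃ w, Matrix.vecMul w (K.diff x ν θ δ (i + 1)) = v := by
  obtain ⟨w, hw⟩ := exists_eq_of_leading_exact
    (A := fun p q => LinearMap.mulRight k (MulOpposite.op (DefAlg.gen ν θ (K.m i p q))))
    (B := fun p q => LinearMap.mulRight k (MulOpposite.op (DefAlg.gen ν θ (K.m (i + 1) p q))))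
    (C := fun p q => LinearMap.mulRight k (K.leftPart x ν θ δ i q p ⊗ₜ[k] (1 : (DefAlg ν θ)ᵐᵒᵖ)))
    (C' := fun p q => LinearMap.mulRight k
      (K.leftPart x ν θ δ (i + 1) q p ⊗ₜ[k] (1 : (DefAlg ν θ)ᵐᵒᵖ)))
    opFil_zero opFil_mono exists_mem_opFil (exists_sub_sum_opFil_mulRight K hU i)
    (fun p q n z hz => mulRight_tmul_one_mem _ z hz)
    (fun p q n z hz => mulRight_tmul_one_mem _ z hz)
    (neg_one_pow_mul_self i) (neg_one_pow_mul_self (i + 1)) (fun w b hb p => by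
      have h1 := congrFun (Matrix.vecMul_vecMul w (K.diff x ν θ δ (i + 1)) (K.diff x ν θ δ i)) p
      rw [K.diff_mul_diff x hD, Matrix.vecMul_zero] at h1
      have h2 : Matrix.vecMul w (K.diff x ν θ δ (i + 1)) = b := funext fun q =>
        (Finset.sum_congr rfl fun r _ => (K.mul_diff x _ _ _ _).symm).trans (hb q)
      rw [h2] at h1
      exact (Finset.sum_congr rfl fun r _ => K.mul_diff x _ _ _ _).trans h1) v
    (fun p => (Finset.sum_congr rfl fun r _ => K.mul_diff x _ _ _ _).trans (congrFun hv p))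
  exact ⟨w, funext fun q =>
    (Finset.sum_congr rfl fun r _ => (K.mul_diff x _ _ _ _).symm).trans (hw q)⟩

/-- The dual of the Koszul bimodule complex is exact outside degree `d`. -/
lemma KoszulData.exists_mulVec_diff_eq {d : ℕ} (hG : IsASGorenstein R d) {i : ℕ}
    (hi : i + 1 ≠ d) {y : Fin (K.b (i + 1)) → Env k (DefAlg ν θ)}
    (hy : (K.diff x ν θ δ (i + 1)).mulVec y = 0) :
    ∃ z, (K.diff x ν θ δ i).mulVec z = y := by
  obtain ⟨w, hw⟩ := exists_eq_of_leading_exact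
    (A := fun p q => LinearMap.mulLeft k (MulOpposite.op (DefAlg.gen ν θ (K.m (i + 1) q p))))
    (B := fun p q => LinearMap.mulLeft k (MulOpposite.op (DefAlg.gen ν θ (K.m i q p))))
    (C := fun p q => LinearMap.mulLeft k
      (K.leftPart x ν θ δ (i + 1) p q ⊗ₜ[k] (1 : (DefAlg ν θ)ᵐᵒᵖ)))
    (C' := fun p q => LinearMap.mulLeft k (K.leftPart x ν θ δ i p q ⊗ₜ[k] (1 : (DefAlg ν θ)ᵐᵒᵖ)))
    opFil_zero opFil_mono exists_mem_opFil (exists_sub_sum_opFil_mulLeft K hU hG i hi)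
    (fun p q n z hz => mulLeft_tmul_one_mem _ z hz)
    (fun p q n z hz => mulLeft_tmul_one_mem _ z hz)
    (neg_one_pow_mul_self (i + 1)) (neg_one_pow_mul_self i) (fun w b hb p => by
      have h1 := congrFun (Matrix.mulVec_mulVec w (K.diff x ν θ δ (i + 1)) (K.diff x ν θ δ i)) p
      rw [K.diff_mul_diff x hD, Matrix.zero_mulVec] at h1
      have h2 : (K.diff x ν θ δ i).mulVec w = b := funext fun q =>
        (Finset.sum_congr rfl fun r _ => (K.diff_mul x _ _ _ _).symm).trans (hb q)
      rw [h2] at h1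
      exact (Finset.sum_congr rfl fun r _ => K.diff_mul x _ _ _ _).trans h1) y
    (fun p => (Finset.sum_congr rfl fun r _ => K.diff_mul x _ _ _ _).trans (congrFun hy p))
  exact ⟨w, funext fun q =>
    (Finset.sum_congr rfl fun r _ => (K.diff_mul x _ _ _ _).symm).trans (hw q)⟩

omit [FiniteDimensional k V] hD in
/-- The dual of the Koszul bimodule complex is exact in degree zero, unless `d = 0`. -/
lemma KoszulData.eq_zero_of_mulVec_diff_zero {d : ℕ} (hG : IsASGorenstein R d) (hd : d ≠ 0)
    {y : Fin (K.b 0) → Env k (DefAlg ν θ)} (hy : (K.diff x ν θ δ 0).mulVec y = 0) : y = 0 := by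
  obtain ⟨w, hw⟩ := exists_eq_of_leading_exact (γ := Fin 0)
    (A := fun p q => LinearMap.mulLeft k (MulOpposite.op (DefAlg.gen ν θ (K.m 0 q p))))
    (B := fun p q => 0)
    (C := fun p q => LinearMap.mulLeft k (K.leftPart x ν θ δ 0 p q ⊗ₜ[k] (1 : (DefAlg ν θ)ᵐᵒᵖ)))
    (C' := fun p q => 0)
    opFil_zero opFil_mono exists_mem_opFil
    (fun n a ha ha' => ⟨0, fun r => zero_mem _, fun q => by
      rw [Finset.univ_eq_empty, Finset.sum_empty, sub_zero]
      exact mem_opFil_of_sum_mulLeft_mem K hU hG hd n a ha ha' q⟩)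
    (fun p q n z hz => mulLeft_tmul_one_mem _ z hz)
    (fun p q n z hz => zero_mem _)
    (neg_one_pow_mul_self 0) (neg_one_pow_mul_self 0) (fun w b hb p => by
      have h1 : b = 0 := funext fun q => by
        rw [← hb q, Finset.univ_eq_empty, Finset.sum_empty]; rfl
      simp [h1]) y
    (fun p => (Finset.sum_congr rfl fun r _ => K.diff_mul x _ _ _ _).trans (congrFun hy p))
  funext q
  rw [← hw q, Finset.univ_eq_empty, Finset.sum_empty]
  rfl

end Exactness

/-! ### The Koszul bimodule resolution -/

section Augmentation

variable (B : Type u) [Ring B] [Algebra k B]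

/-- The multiplication map `U ⊗ U^op → U`. -/
def envAug : Env k B →ₗ[k] B :=
  TensorProduct.lift ((LinearMap.mul k B).compl₂
    (MulOpposite.opLinearEquiv k).symm.toLinearMap)

lemma envAug_tmul (a : B) (b : Bᵐᵒᵖ) : envAug (k := k) B (a ⊗ₜ b) = a * b.unop := rfl

lemma smul_one_eq_envAug (z : Env k B) :
    letI : Module (Env k B) B := TensorProduct.Algebra.module
    z • (1 : B) = envAug (k := k) B z := by
  let _ : Module (Env k B) B := TensorProduct.Algebra.module
  induction z using TensorProduct.induction_on with
  | zero => exact (zero_smul (Env k B) (1 : B)).trans (map_zero (envAug (k := k) B)).symm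
  | tmul a b =>
    rw [TensorProduct.Algebra.smul_def, envAug_tmul, MulOpposite.smul_eq_mul_unop, one_mul,
      smul_eq_mul]
  | add a b ha hb => rw [add_smul, map_add, ha, hb]

/-- The kernel of multiplication is generated, as a left ideal, by the elements
`v ⊗ 1 - 1 ⊗ v`. -/
lemma sub_envAug_tmul_one_mem {g : V →ₗ[k] B}
    (hg : Function.Surjective (TensorAlgebra.lift k g)) {J : Ideal (Env k B)}
    (hJ : ∀ v, g v ⊗ₜ[k] (1 : Bᵐᵒᵖ) -
      1 ⊗ₜ[k] MulOpposite.op (g v) ∈ J) (z : Env k B) :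
    envAug (k := k) B z ⊗ₜ[k] (1 : Bᵐᵒᵖ) - z ∈ J := by
  have h1 : ∀ b : B, b ⊗ₜ[k] (1 : Bᵐᵒᵖ) - 1 ⊗ₜ[k] MulOpposite.op b ∈ J := by
    intro b
    obtain ⟨t, rfl⟩ := hg b
    induction t using TensorAlgebra.induction with
    | algebraMap c =>
      rw [AlgHom.commutes, Algebra.algebraMap_eq_smul_one, MulOpposite.op_smul, MulOpposite.op_one,
        TensorProduct.tmul_smul, ← TensorProduct.smul_tmul', sub_self]
      exact zero_mem _
    | ι v => rw [TensorAlgebra.lift_ι_apply]; exact hJ v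
    | mul a b ha hb =>
      set a' := TensorAlgebra.lift k g a
      set b' := TensorAlgebra.lift k g b
      have h2 : (a' * b') ⊗ₜ[k] (1 : Bᵐᵒᵖ) - 1 ⊗ₜ[k] MulOpposite.op (a' * b') =
          (a' ⊗ₜ[k] 1) * (b' ⊗ₜ[k] 1 - 1 ⊗ₜ[k] MulOpposite.op b') +
          (1 ⊗ₜ[k] MulOpposite.op b') * (a' ⊗ₜ[k] 1 - 1 ⊗ₜ[k] MulOpposite.op a') := by
        simp only [mul_sub, Algebra.TensorProduct.tmul_mul_tmul, mul_one, one_mul,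
          MulOpposite.op_mul]
        abel
      rw [map_mul, h2]
      exact add_mem (J.mul_mem_left _ hb) (J.mul_mem_left _ ha)
    | add a b ha hb =>
      rw [map_add, TensorProduct.add_tmul, MulOpposite.op_add, TensorProduct.tmul_add,
        add_sub_add_comm]
      exact add_mem ha hb
  induction z using TensorProduct.induction_on with
  | zero => rw [map_zero, TensorProduct.zero_tmul, sub_zero]; exact zero_mem _
  | tmul a b =>
    have h2 : envAug (k := k) B (a ⊗ₜ b) ⊗ₜ[k] (1 : Bᵐᵒᵖ) - a ⊗ₜ b =
        (a ⊗ₜ[k] 1) * (b.unop ⊗ₜ[k] 1 - 1 ⊗ₜ[k] MulOpposite.op b.unop) := by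
      simp only [mul_sub, Algebra.TensorProduct.tmul_mul_tmul, mul_one, one_mul, envAug_tmul,
        MulOpposite.op_unop]
    rw [h2]
    exact J.mul_mem_left _ (h1 _)
  | add a b ha hb =>
    rw [map_add, TensorProduct.add_tmul, add_sub_add_comm]
    exact add_mem ha hb

variable {B} in
lemma sum_smul_tmul_one_sub {β : Type*} [Fintype β] (g g' : V →ₗ[k] B) (c : β → k) (m : β → V) :
    g (∑ q, c q • m q) ⊗ₜ[k] (1 : Bᵐᵒᵖ) - 1 ⊗ₜ[k] MulOpposite.op (g' (∑ q, c q • m q)) =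
      ∑ q, algebraMap k (Env k B) (c q) *
        (g (m q) ⊗ₜ[k] (1 : Bᵐᵒᵖ) - 1 ⊗ₜ[k] MulOpposite.op (g' (m q))) := by
  simp only [map_sum, map_smul, Finset.op_sum, MulOpposite.op_smul, TensorProduct.sum_tmul,
    TensorProduct.tmul_sum, TensorProduct.tmul_smul, ← TensorProduct.smul_tmul', ← Algebra.smul_def,
    smul_sub, Finset.sum_sub_distrib]

variable {B} (ξ : B ≃ₐ[k] B)

/-- The map `p ⊗ q ↦ q ξ(p)`, whose kernel is the right ideal generated by the elements
`v ⊗ 1 - 1 ⊗ ξ(v)`. -/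
def twistAug : Env k B →ₗ[k] B :=
  TensorProduct.lift ((LinearMap.mul k B).flip.compl₁₂ ξ.toLinearMap
    (MulOpposite.opLinearEquiv k).symm.toLinearMap)

lemma twistAug_tmul (a : B) (b : Bᵐᵒᵖ) :
    twistAug ξ (a ⊗ₜ b) = b.unop * ξ a := rfl

lemma twistAug_mul (z : Env k B) (a b : B) :
    twistAug ξ (z * b ⊗ₜ MulOpposite.op a) = a * twistAug ξ z * ξ b := by
  induction z using TensorProduct.induction_on with
  | zero => rw [zero_mul, map_zero, mul_zero, zero_mul]
  | tmul p q =>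
    rw [Algebra.TensorProduct.tmul_mul_tmul, twistAug_tmul, twistAug_tmul, map_mul,
      MulOpposite.unop_mul, MulOpposite.unop_op]
    simp only [mul_assoc]
  | add s t hs ht => rw [add_mul, map_add, map_add, hs, ht, mul_add, add_mul]

lemma twistAug_mul_eq_zero {z : Env k B} (hz : twistAug ξ z = 0)
    (t : Env k B) : twistAug ξ (z * t) = 0 := by
  induction t using TensorProduct.induction_on with
  | zero => rw [mul_zero, map_zero]
  | tmul p q =>
    have h1 := twistAug_mul ξ z q.unop p
    rw [hz, mul_zero, zero_mul] at h1
    exact h1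
  | add s t hs ht => rw [mul_add, map_add, hs, ht, add_zero]

lemma twistAug_surjective : Function.Surjective (twistAug ξ) := fun b =>
  ⟨1 ⊗ₜ MulOpposite.op b, by rw [twistAug_tmul, map_one, mul_one, MulOpposite.unop_op]⟩

/-- Modulo the right ideal generated by the elements `v ⊗ 1 - 1 ⊗ ξ(v)`, every element of `U ⊗ U^op`
is of the form `1 ⊗ q`. -/
lemma sub_twistAug_mem {g : V →ₗ[k] B}
    (hg : Function.Surjective (TensorAlgebra.lift k g)) {J : Submodule k (Env k B)}
    (hmul : ∀ z ∈ J, ∀ t, z * t ∈ J) (hJ : ∀ v, g v ⊗ₜ[k] (1 : Bᵐᵒᵖ) -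
      1 ⊗ₜ[k] MulOpposite.op (ξ (g v)) ∈ J) (z : Env k B) :
    z - 1 ⊗ₜ[k] MulOpposite.op (twistAug ξ z) ∈ J := by
  have h1 : ∀ b : B,
      b ⊗ₜ[k] (1 : Bᵐᵒᵖ) - 1 ⊗ₜ[k] MulOpposite.op (ξ b) ∈ J := by
    intro b
    obtain ⟨t, rfl⟩ := hg b
    induction t using TensorAlgebra.induction with
    | algebraMap c =>
      rw [AlgHom.commutes, AlgEquiv.commutes, Algebra.algebraMap_eq_smul_one, MulOpposite.op_smul,
        MulOpposite.op_one, TensorProduct.tmul_smul, ← TensorProduct.smul_tmul', sub_self]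
      exact zero_mem _
    | ι v => rw [TensorAlgebra.lift_ι_apply]; exact hJ v
    | mul a b ha hb =>
      set a' := TensorAlgebra.lift k g a
      set b' := TensorAlgebra.lift k g b
      have h2 : (a' * b') ⊗ₜ[k] (1 : Bᵐᵒᵖ) - 1 ⊗ₜ[k] MulOpposite.op (ξ (a' * b')) =
          (a' ⊗ₜ[k] 1 - 1 ⊗ₜ[k] MulOpposite.op (ξ a')) * (b' ⊗ₜ[k] 1) +
          (b' ⊗ₜ[k] 1 - 1 ⊗ₜ[k] MulOpposite.op (ξ b')) * (1 ⊗ₜ[k] MulOpposite.op (ξ a')) := by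
        simp only [sub_mul, Algebra.TensorProduct.tmul_mul_tmul, mul_one, one_mul, map_mul,
          MulOpposite.op_mul]
        abel
      rw [map_mul, h2]
      exact add_mem (hmul _ ha _) (hmul _ hb _)
    | add a b ha hb =>
      rw [map_add, map_add, TensorProduct.add_tmul, MulOpposite.op_add, TensorProduct.tmul_add,
        add_sub_add_comm]
      exact add_mem ha hb
  induction z using TensorProduct.induction_on with
  | zero =>
    rw [map_zero, MulOpposite.op_zero, TensorProduct.tmul_zero, sub_zero]
    exact zero_mem _
  | tmul a b =>
    have h2 : a ⊗ₜ b - 1 ⊗ₜ[k] MulOpposite.op (twistAug ξ (a ⊗ₜ b)) =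
        (a ⊗ₜ[k] 1 - 1 ⊗ₜ[k] MulOpposite.op (ξ a)) * (1 ⊗ₜ[k] b) := by
      simp only [sub_mul, Algebra.TensorProduct.tmul_mul_tmul, mul_one, one_mul, twistAug_tmul,
        MulOpposite.op_mul, MulOpposite.op_unop]
    rw [h2]
    exact hmul _ (h1 _) _
  | add a b ha hb =>
    rw [map_add, MulOpposite.op_add, TensorProduct.tmul_add, add_sub_add_comm]
    exact add_mem ha hb

end Augmentation

section Resolution

variable {R : Submodule k (V ⊗[k] V)} (K : KoszulData R)
  {ν : R →ₗ[k] V} {θ : R →ₗ[k] k} {δ : DualAlg R →ₗ[k] DualAlg R} {c : DualAlg R}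
  {n : ℕ} (x : Module.Basis (Fin n) k V)

lemma KoszulData.eq_of_fin_zero (p q : Fin (K.b 0)) : p = q := by
  have := K.b_zero
  omega

variable [FiniteDimensional k V]

lemma KoszulData.diff_zero (hD : IsDualCurvedDGA ν θ δ c) (q p) : K.diff x ν θ δ 0 q p =
    DefAlg.gen ν θ (K.m 0 p q) ⊗ₜ[k] (1 : (DefAlg ν θ)ᵐᵒᵖ) -
      1 ⊗ₜ[k] MulOpposite.op (DefAlg.gen ν θ (K.m 0 p q)) := by
  have h1 : ∀ j, K.coord (0 + 1) (DualAlg.gen R (x.coord j) * K.e 0 p) q =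
      x.coord j (K.m 0 p q) := fun j => by
    rw [K.e_zero, mul_one, ← one_mul (DualAlg.gen R (x.coord j)), ← K.e_zero p, K.e_mul_gen,
      map_sum, Finset.sum_apply, Finset.sum_eq_single q]
    · rw [map_smul, K.coord_e, Pi.smul_apply, Pi.single_eq_same, smul_eq_mul, mul_one]
    · intro q' _ hq'
      rw [map_smul, K.coord_e, Pi.smul_apply, Pi.single_eq_of_ne hq'.symm, smul_zero]
    · simp
  have h2 : K.leftPart x ν θ δ 0 q p = DefAlg.gen ν θ (K.m 0 p q) := by
    rw [KoszulData.leftPart, K.e_zero, derivation_one hD.leibniz, map_zero, Pi.zero_apply, map_zero,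
      sub_zero]
    simp only [← K.e_zero p, h1]
    conv_rhs => rw [← x.sum_repr (K.m 0 p q)]
    rw [map_sum]
    simp only [map_smul, Module.Basis.coord_apply]
  rw [KoszulData.diff, h2, pow_zero, one_smul]

variable (hU : IsPBWDeformation ν θ) (hD : IsDualCurvedDGA ν θ δ c)

/-- The Koszul resolution of `U` by free bimodules. -/
@[reducible] def KoszulData.bimoduleResolution :
    letI : Module (Env k (DefAlg ν θ)) (DefAlg ν θ) := TensorProduct.Algebra.module
    FreeResolution (Env k (DefAlg ν θ)) (DefAlg ν θ) :=
  letI : Module (Env k (DefAlg ν θ)) (DefAlg ν θ) := TensorProduct.Algebra.module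
  let p₀ : Fin (K.b 0) := ⟨0, by rw [K.b_zero]; exact one_pos⟩
  { b := K.b
    D := K.diff x ν θ δ
    ε := LinearMap.toSpanSingleton _ _ 1 ∘ₗ LinearMap.proj p₀
    surj := fun a => ⟨fun _ => a ⊗ₜ 1, by
      change (a ⊗ₜ[k] (1 : (DefAlg ν θ)ᵐᵒᵖ)) • (1 : DefAlg ν θ) = a
      rw [smul_one_eq_envAug, envAug_tmul, MulOpposite.unop_one, mul_one]⟩
    exact_zero := fun v => by
      change v p₀ • (1 : DefAlg ν θ) = 0 ↔ _
      rw [smul_one_eq_envAug]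
      constructor
      · intro h
        let J : Ideal (Env k (DefAlg ν θ)) :=
          Submodule.span _ (Set.range fun q => K.diff x ν θ δ 0 q p₀)
        have hJ : ∀ v, DefAlg.gen ν θ v ⊗ₜ[k] (1 : (DefAlg ν θ)ᵐᵒᵖ) -
            1 ⊗ₜ[k] MulOpposite.op (DefAlg.gen ν θ v) ∈ J := fun v => by
          obtain ⟨c, hc⟩ := K.exists_smul_m_zero fun _ => v
          have h1 := sum_smul_tmul_one_sub (DefAlg.gen ν θ) (DefAlg.gen ν θ) c (K.m 0 p₀)
          rw [← hc p₀] at h1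
          simp only [← K.diff_zero x hD] at h1
          rw [h1]
          exact Submodule.sum_mem _ fun q _ => J.smul_mem _ (Submodule.subset_span ⟨q, rfl⟩)
        have h2 := sub_envAug_tmul_one_mem _ (DefAlg.lift_gen_surjective ν θ) hJ (v p₀)
        rw [h, TensorProduct.zero_tmul, zero_sub] at h2
        obtain ⟨w, hw⟩ := (Submodule.mem_span_range_iff_exists_fun _).1
          ((neg_mem_iff (H := J)).1 h2)
        refine ⟨w, funext fun p => ?_⟩
        rw [K.eq_of_fin_zero p p₀]
        exact hw
      · rintro ⟨w, rfl⟩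
        change envAug (k := k) (DefAlg ν θ) (∑ q, w q * K.diff x ν θ δ 0 q p₀) = 0
        rw [map_sum]
        refine Finset.sum_eq_zero fun q _ => ?_
        rw [K.diff_zero x hD]
        induction w q using TensorProduct.induction_on with
        | zero => rw [zero_mul, map_zero]
        | tmul a b =>
          rw [mul_sub, map_sub, Algebra.TensorProduct.tmul_mul_tmul,
            Algebra.TensorProduct.tmul_mul_tmul, envAug_tmul, envAug_tmul, mul_one, mul_one,
            MulOpposite.unop_mul, MulOpposite.unop_op, mul_assoc, sub_self]
        | add a b ha hb => rw [add_mul, map_add, ha, hb, add_zero]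
    exact_succ := fun i v => by
      refine ⟨fun h => K.exists_vecMul_diff_eq x hU hD h, ?_⟩
      rintro ⟨w, rfl⟩
      rw [Matrix.vecMul_vecMul, K.diff_mul_diff x hD, Matrix.vecMul_zero] }

end Resolution

/-! ### The groups `Ext` of the enveloping algebra -/

section TopDegree

lemma slice_smul {B E : Type u} [Ring B] [Algebra k B] [AddCommGroup E] [Module k E] (s : k)
    (χ : Module.Dual k E) (z : B ⊗[k] E) : slice (s • χ) z = s • slice χ z := by
  induction z using TensorProduct.induction_on with
  | zero => simp
  | tmul b a => simp [smul_smul]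
  | add a b ha hb => rw [map_add, map_add, ha, hb, smul_add]

variable {R : Submodule k (V ⊗[k] V)} {d : ℕ} {ϖ : DualAlg R} {τ : DualAlg R →ₗ[k] k}
  (h : IsFrobeniusTrace R d ϖ τ) (K : KoszulData R)
  {φ : DualAlg R ≃ₐ[k] DualAlg R} {ν : R →ₗ[k] V} {θ : R →ₗ[k] k}
  {δ : DualAlg R →ₗ[k] DualAlg R} {c : DualAlg R}
  {n : ℕ} {x : Module.Basis (Fin n) k V} {P : Matrix (Fin n) (Fin n) k}
include h

/-- The coordinate in top degree is a multiple of the Frobenius form. -/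
lemma IsFrobeniusTrace.proj_comp_coord (q : Fin (K.b d)) :
    LinearMap.proj q ∘ₗ K.coord d = K.coord d ϖ q • τ := by
  refine LinearMap.ext fun a => ?_
  rw [LinearMap.comp_apply, LinearMap.proj_apply, LinearMap.smul_apply, smul_eq_mul]
  induction a using homogeneous_induction with
  | mem i a ha =>
    by_cases hi : i = d
    · subst hi
      conv_lhs => rw [h.eq_smul a ha, map_smul, Pi.smul_apply, smul_eq_mul, mul_comm]
    · rw [K.coord_of_ne hi ha, h.of_ne i hi a ha, Pi.zero_apply, mul_zero]
  | add a b ha hb => rw [map_add, Pi.add_apply, ha, hb, map_add, mul_add]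

lemma IsFrobeniusTrace.coord_ne_zero [FiniteDimensional k V] (hd : K.b d = 1)
    (q : Fin (K.b d)) : K.coord d ϖ q ≠ 0 := by
  intro h0
  have h1 : ϖ = 0 := K.eq_zero_of_coord h.mem (funext fun p => by
    rw [show p = q by omega, h0, Pi.zero_apply])
  have h2 := h.apply_self
  rw [h1, map_zero] at h2
  exact zero_ne_one h2

end TopDegree

section Coker

variable {R : Submodule k (V ⊗[k] V)} {m : ℕ} {ϖ : DualAlg R} {τ : DualAlg R →ₗ[k] k}
  (h : IsFrobeniusTrace R (m + 1) ϖ τ) (K : KoszulData R)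
  {φ : DualAlg R ≃ₐ[k] DualAlg R} {ν : R →ₗ[k] V} {θ : R →ₗ[k] k}
  {δ : DualAlg R →ₗ[k] DualAlg R} {c : DualAlg R}
  {n : ℕ} {x : Module.Basis (Fin n) k V} {P : Matrix (Fin n) (Fin n) k}

/-- The last differential, contracted with the trace. -/
def traceDiff (ν : R →ₗ[k] V) (θ : R →ₗ[k] k) (x : Module.Basis (Fin n) k V)
    (δ : DualAlg R →ₗ[k] DualAlg R) (τ : DualAlg R →ₗ[k] k) (m : ℕ) :
    DualAlg R →ₗ[k] Env k (DefAlg ν θ) :=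
  slice τ ∘ₗ diffOp x ν θ δ m ∘ₗ TensorProduct.mk k (Env k (DefAlg ν θ)) (DualAlg R) 1

include h

lemma KoszulData.diff_top [FiniteDimensional k V] (p : Fin (K.b m)) (q : Fin (K.b (m + 1))) :
    K.diff x ν θ δ m q p = K.coord (m + 1) ϖ q • traceDiff ν θ x δ τ m (K.e m p) := by
  rw [K.diff_eq_slice, h.proj_comp_coord, slice_smul]
  rfl

/-- On the basis dual to the generators, the last differential is `xⱼ ⊗ 1 - 1 ⊗ ξ(xⱼ)`. -/
lemma traceDiff_dualBasis (hφ : IsNakayamaAut R (m + 1) φ) (hP : HasMatrix R x φ P)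
    {w : Fin n → DualAlg R} (hw : IsDualBasisTo R x (m + 1) ϖ w) {l : Fin n → k}
    (hl : ∀ i, δ (w i) = l i • ϖ) (j : Fin n) :
    traceDiff ν θ x δ τ m (w j) = DefAlg.gen ν θ (x j) ⊗ₜ[k] (1 : (DefAlg ν θ)ᵐᵒᵖ) -
      1 ⊗ₜ[k] MulOpposite.op (nakayamaGen ν θ (m + 1) x P l (x j)) := by
  have h1 : ∀ i, τ (DualAlg.gen R (x.coord i) * w j) = if i = j then 1 else 0 := fun i => by
    rw [hw.mul_eq]
    split_ifs
    · exact h.apply_self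
    · exact map_zero τ
  have h2 : ∀ i, τ (w j * DualAlg.gen R (x.coord i)) = P⁻¹ j i := fun i => by
    rw [← h.apply_symm_mul hφ, hφ.symm_gen hP, Finset.sum_mul, map_sum, Finset.sum_eq_single j]
    · rw [smul_mul_assoc, map_smul, h1, if_pos rfl, smul_eq_mul, mul_one]
    · intro i' _ hi'
      rw [smul_mul_assoc, map_smul, h1, if_neg hi', smul_zero]
    · simp
  have h3 : (-1 : k) ^ (m + 1 + 1) = (-1) ^ m := by rw [pow_add, pow_add]; ring
  rw [traceDiff, LinearMap.comp_apply, LinearMap.comp_apply, TensorProduct.mk_apply, diffOp,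
    twistedDiff_tmul, map_sub, map_sub, map_smul, map_sum, map_sum]
  simp only [slice_tmul, h1, h2, hl, map_smul, h.apply_self, ite_smul, one_smul, zero_smul,
    Finset.sum_ite_eq', Finset.mem_univ, if_true, mul_one, smul_eq_mul]
  rw [nakayamaGen_apply, h3, MulOpposite.op_add, TensorProduct.tmul_add, MulOpposite.op_smul,
    TensorProduct.tmul_smul, Finset.op_sum, TensorProduct.tmul_sum,
    Algebra.algebraMap_eq_smul_one, MulOpposite.op_smul, TensorProduct.tmul_smul,
    MulOpposite.op_one]
  simp only [MulOpposite.op_smul, TensorProduct.tmul_smul, Matrix.transpose_apply]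
  exact sub_sub _ _ _

/-- The cokernel of the last differential of the dual complex is `U`, twisted by `ξ`. -/
lemma KoszulData.twistAug_eq_zero_iff [FiniteDimensional k V] (hb : K.b (m + 1) = 1)
    (hφ : IsNakayamaAut R (m + 1) φ)
    (hP : HasMatrix R x φ P) {w : Fin n → DualAlg R} (hw : IsDualBasisTo R x (m + 1) ϖ w)
    {l : Fin n → k} (hl : ∀ i, δ (w i) = l i • ϖ) {ξ : DefAlg ν θ ≃ₐ[k] DefAlg ν θ}
    (hξ : ∀ v, ξ (DefAlg.gen ν θ v) = nakayamaGen ν θ (m + 1) x P l v)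
    (s : Env k (DefAlg ν θ)) :
    twistAug ξ s = 0 ↔ ∃ z, (K.diff x ν θ δ m).mulVec z = fun _ => s := by
  let q₀ : Fin (K.b (m + 1)) := ⟨0, by rw [hb]; exact one_pos⟩
  have hq : ∀ q, q = q₀ := fun q => by omega
  have htop := h.coord_ne_zero K hb q₀
  have hspan : ∀ a ∈ DualAlg.piece R m, a ∈ Submodule.span k (Set.range w) := fun a ha => by
    rw [hw.span_eq, if_neg m.succ_ne_zero]
    exact ha
  have hker : ∀ a ∈ DualAlg.piece R m, twistAug ξ (traceDiff ν θ x δ τ m a) = 0 := fun a ha => by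
    have h1 : Submodule.span k (Set.range w) ≤
        LinearMap.ker (twistAug ξ ∘ₗ traceDiff ν θ x δ τ m) := by
      rw [Submodule.span_le]
      rintro _ ⟨j, rfl⟩
      change twistAug ξ (traceDiff ν θ x δ τ m (w j)) = 0
      rw [traceDiff_dualBasis h hφ hP hw hl, map_sub, twistAug_tmul, twistAug_tmul, ← hξ, map_one,
        MulOpposite.unop_one, one_mul, mul_one, MulOpposite.unop_op, sub_self]
    exact h1 (hspan a ha)
  constructor
  · intro hs
    let J : Submodule k (Env k (DefAlg ν θ)) :=
      LinearMap.range (∑ p, LinearMap.mulLeft k (K.diff x ν θ δ m q₀ p) ∘ₗ LinearMap.proj p)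
    have hJ : ∀ t, t ∈ J ↔ ∃ z : Fin (K.b m) → Env k (DefAlg ν θ),
        ∑ p, K.diff x ν θ δ m q₀ p * z p = t := fun t => by
      simp [J, LinearMap.mem_range]
    have hmul : ∀ z ∈ J, ∀ t, z * t ∈ J := fun z hz t => by
      obtain ⟨y, rfl⟩ := (hJ z).1 hz
      exact (hJ _).2 ⟨fun p => y p * t, by simp only [Finset.sum_mul, mul_assoc]⟩
    have hgen : ∀ v, DefAlg.gen ν θ v ⊗ₜ[k] (1 : (DefAlg ν θ)ᵐᵒᵖ) -
        1 ⊗ₜ[k] MulOpposite.op (ξ (DefAlg.gen ν θ v)) ∈ J := fun v => by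
      have h2 : ∀ j, DefAlg.gen ν θ (x j) ⊗ₜ[k] (1 : (DefAlg ν θ)ᵐᵒᵖ) -
          1 ⊗ₜ[k] MulOpposite.op (ξ (DefAlg.gen ν θ (x j))) ∈ J := fun j => by
        have hwj : w j ∈ DualAlg.piece R m := by
          have h3 := hw.span_eq.le (Submodule.subset_span ⟨j, rfl⟩)
          rwa [if_neg m.succ_ne_zero] at h3
        rw [hξ, ← traceDiff_dualBasis h hφ hP hw hl]
        refine (hJ _).2 ⟨fun p => algebraMap k _ ((K.coord (m + 1) ϖ q₀)⁻¹ * K.coord m (w j) p), ?_⟩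
        conv_rhs => rw [← K.sum_coord_smul_e hwj, map_sum]
        refine Finset.sum_congr rfl fun p _ => ?_
        rw [K.diff_top h, ← Algebra.commutes, ← Algebra.smul_def, smul_smul, map_smul, mul_comm,
          mul_inv_cancel_left₀ htop]
      have h4 := sum_smul_tmul_one_sub (DefAlg.gen ν θ) (ξ.toLinearMap ∘ₗ DefAlg.gen ν θ)
        (x.repr v) x
      rw [x.sum_repr v] at h4
      refine h4 ▸ Submodule.sum_mem _ fun j _ => ?_
      rw [Algebra.commutes]
      exact hmul _ (h2 j) _
    have h1 := sub_twistAug_mem ξ (DefAlg.lift_gen_surjective ν θ) hmul hgen s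
    rw [hs, MulOpposite.op_zero, TensorProduct.tmul_zero, sub_zero] at h1
    obtain ⟨z, hz⟩ := (hJ s).1 h1
    exact ⟨z, funext fun q => by rw [hq q]; exact hz⟩
  · rintro ⟨z, hz⟩
    rw [← congrFun hz q₀]
    change twistAug ξ (∑ p, K.diff x ν θ δ m q₀ p * z p) = 0
    rw [map_sum]
    refine Finset.sum_eq_zero fun p _ => twistAug_mul_eq_zero ξ ?_ _
    rw [K.diff_top h, map_smul, hker _ (K.e_mem m p), smul_zero]

end Coker

section ExtGroups

lemma exists_addEquiv_of_ker_eq {S E U : Type*} [AddCommGroup S] [AddCommGroup E] [AddCommGroup U]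
    {α : S →+ E} {β : S →+ U} (hα : Function.Surjective α) (hβ : Function.Surjective β)
    (h : ∀ s, α s = 0 ↔ β s = 0) : ∃ Ψ : E ≃+ U, ∀ s, Ψ (α s) = β s := by
  have hk : α.ker = β.ker := by
    ext s
    exact h s
  refine ⟨(QuotientAddGroup.quotientKerEquivOfSurjective α hα).symm.trans
    ((QuotientAddGroup.quotientAddEquivOfEq hk).trans
      (QuotientAddGroup.quotientKerEquivOfSurjective β hβ)), fun s => ?_⟩
  have h1 : (QuotientAddGroup.quotientKerEquivOfSurjective α hα).symm (α s) =
      QuotientAddGroup.mk s := by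
    rw [AddEquiv.symm_apply_eq]
    rfl
  rw [AddEquiv.trans_apply, h1]
  rfl

variable {R : Submodule k (V ⊗[k] V)} {d : ℕ} (K : KoszulData R)
  {ν : R →ₗ[k] V} {θ : R →ₗ[k] k} {δ : DualAlg R →ₗ[k] DualAlg R} {c : DualAlg R}
  {n : ℕ} (x : Module.Basis (Fin n) k V) [FiniteDimensional k V]
  (hG : IsASGorenstein R d) (hU : IsPBWDeformation ν θ) (hD : IsDualCurvedDGA ν θ δ c)
include K x hG hU hD

lemma KoszulData.subsingleton_extEnv {i : ℕ} (hi : i ≠ d) :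
    Subsingleton (ExtEnv k (DefAlg ν θ) i) := by
  let _ : Module (Env k (DefAlg ν θ)) (DefAlg ν θ) := TensorProduct.Algebra.module
  let F := K.bimoduleResolution x hU hD
  suffices h : ∀ e : Abelian.Ext (ModuleCat.of (Env k (DefAlg ν θ)) (DefAlg ν θ))
      (ModuleCat.of (Env k (DefAlg ν θ)) (Env k (DefAlg ν θ))) i, e = 0 from
    ⟨fun a b => (h a).trans (h b).symm⟩
  intro e
  obtain ⟨y, hy, rfl⟩ := F.extOf_surjective i e
  cases i with
  | zero =>
    exact (F.extOf_zero_eq_zero_iff y hy).2 (K.eq_zero_of_mulVec_diff_zero x hU hG hi.symm hy)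
  | succ i => exact (F.extOf_succ_eq_zero_iff i y hy).2 (K.exists_mulVec_diff_eq x hU hD hG hi hy)

/-- The top `Ext` group is the cokernel of the last differential of the dual complex, and the
kernel of `twistAug ξ` is the image of that differential. -/
lemma KoszulData.extEnvIsoTwist {ξ : DefAlg ν θ ≃ₐ[k] DefAlg ν θ}
    (h0 : d = 0 → ∀ s, twistAug ξ s = 0 → s = 0)
    (hsucc : ∀ m, d = m + 1 → ∀ s, twistAug ξ s = 0 ↔
      ∃ z, (K.diff x ν θ δ m).mulVec z = fun _ => s) :
    ExtEnvIsoTwist k (DefAlg ν θ) d ξ := by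
  let _ : Module (Env k (DefAlg ν θ)) (DefAlg ν θ) := TensorProduct.Algebra.module
  let F := K.bimoduleResolution x hU hD
  have hempty : IsEmpty (Fin (F.b (d + 1))) := by
    change IsEmpty (Fin (K.b (d + 1)))
    rw [K.b_eq_zero hG d.lt_succ_self]
    infer_instance
  have hcyc : ∀ y : Fin (F.b d) → Env k (DefAlg ν θ), colMul (F.D d) y = 0 := fun y =>
    funext fun q => hempty.elim q
  have hone : F.b d = 1 := K.b_top hG
  let q₀ : Fin (F.b d) := ⟨0, by rw [hone]; exact one_pos⟩
  have hconst : ∀ y : Fin (F.b d) → Env k (DefAlg ν θ), y = fun _ => y q₀ := fun y =>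
    funext fun q => congrArg y (by omega)
  let α : Env k (DefAlg ν θ) →+ Abelian.Ext (ModuleCat.of (Env k (DefAlg ν θ)) (DefAlg ν θ))
      (ModuleCat.of (Env k (DefAlg ν θ)) (Env k (DefAlg ν θ))) d :=
    AddMonoidHom.mk' (fun s => F.extOf d (fun _ => s) (hcyc _)) fun s t =>
      F.extOf_add d (fun _ => s) (fun _ => t) (hcyc _) (hcyc _)
  have hα : Function.Surjective α := fun e => by
    obtain ⟨y, hy, rfl⟩ := F.extOf_surjective d e
    refine ⟨y q₀, ?_⟩
    change F.extOf d (fun _ => y q₀) (hcyc _) = _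
    congr 1
    exact (hconst y).symm
  have hker : ∀ s, α s = 0 ↔ (twistAug ξ).toAddMonoidHom s = 0 := fun s => by
    change F.extOf d (fun _ => s) (hcyc _) = 0 ↔ twistAug ξ s = 0
    cases d with
    | zero =>
      rw [F.extOf_zero_eq_zero_iff]
      refine ⟨fun h1 => ?_, fun h1 => funext fun _ => h0 rfl s h1⟩
      rw [show s = 0 from congrFun h1 q₀, map_zero]
    | succ m =>
      rw [F.extOf_succ_eq_zero_iff, hsucc m rfl]
      rfl
  obtain ⟨Ψ, hΨ⟩ := exists_addEquiv_of_ker_eq hα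
    (β := (twistAug ξ).toAddMonoidHom) (twistAug_surjective ξ) hker
  refine ⟨Ψ, fun a b e => ?_⟩
  obtain ⟨s, rfl⟩ := hα e
  have h1 : ExtEnv.act k (DefAlg ν θ) a b (α s) = α (s * (b ⊗ₜ MulOpposite.op a)) :=
    F.extOf_comp_mk₀ d (fun _ => s) (hcyc _) (LinearMap.toSpanSingleton _ _ _) (hcyc _)
  rw [h1]
  refine (hΨ _).trans ((twistAug_mul ξ s a b).trans ?_)
  exact congrArg (fun t => a * t * ξ b) (hΨ s).symm

end ExtGroups

/-- If `V = 0`, then `U = k`. -/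
lemma eq_zero_of_twistAug_eq_zero [Subsingleton V] {R : Submodule k (V ⊗[k] V)} {ν : R →ₗ[k] V}
    {θ : R →ₗ[k] k} (ξ : DefAlg ν θ ≃ₐ[k] DefAlg ν θ) {s : Env k (DefAlg ν θ)}
    (hs : twistAug ξ s = 0) : s = 0 := by
  have h1 := sub_twistAug_mem ξ (DefAlg.lift_gen_surjective ν θ) (J := ⊥)
    (fun z hz t => by
      rw [(Submodule.mem_bot k).1 hz, zero_mul]; exact zero_mem _)
    (fun v => by
      rw [Subsingleton.elim v 0, map_zero, map_zero, MulOpposite.op_zero, TensorProduct.zero_tmul,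
        TensorProduct.tmul_zero]
      exact (Submodule.mem_bot k).2 (sub_self _)) s
  rw [hs, MulOpposite.op_zero, TensorProduct.tmul_zero] at h1
  exact (sub_zero s).symm.trans ((Submodule.mem_bot k).1 h1)

end KoszulDeformation

end

open KoszulDeformation in
theorem mainTheorem1 {k : Type u} [Field k] [CharZero k]
    {V : Type u} [AddCommGroup V] [Module k V] {n : ℕ} (x : Module.Basis (Fin n) k V)
    (R : Submodule k (V ⊗[k] V)) (d : ℕ)
    (hKoszul : IsKoszul R) (hGorenstein : IsASGorenstein R d)
    (ν : R →ₗ[k] V) (θ : R →ₗ[k] k) (hU : IsPBWDeformation ν θ) :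
    -- the data in the formula exist and are unique
    (∃! φ : DualAlg R ≃ₐ[k] DualAlg R, IsNakayamaAut R d φ) ∧
    (∃! D : (DualAlg R →ₗ[k] DualAlg R) × DualAlg R, IsDualCurvedDGA ν θ D.1 D.2) ∧
    Module.finrank k (DualAlg.piece R d) = 1 ∧
    (∀ φ, IsNakayamaAut R d φ → ∃! P : Matrix (Fin n) (Fin n) k, HasMatrix R x φ P) ∧
    (∀ ϖ ∈ DualAlg.piece R d, ϖ ≠ 0 →
      (∃! w : Fin n → DualAlg R, IsDualBasisTo R x d ϖ w) ∧
      ∀ δ c, IsDualCurvedDGA ν θ δ c → ∀ w, IsDualBasisTo R x d ϖ w →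
        ∃! l : Fin n → k, ∀ i, δ (w i) = l i • ϖ) ∧
    -- vanishing outside degree `d`
    (∀ i, i ≠ d → Subsingleton (ExtEnv k (DefAlg ν θ) i)) ∧
    -- the group in degree `d` and the Nakayama automorphism of `U`
    (∀ φ P δ c ϖ w, ∀ l : Fin n → k,
      IsNakayamaAut R d φ → HasMatrix R x φ P →
      IsDualCurvedDGA ν θ δ c →
      ϖ ∈ DualAlg.piece R d → ϖ ≠ 0 → IsDualBasisTo R x d ϖ w →
      (∀ i, δ (w i) = l i • ϖ) →
      IsUnit P.det ∧
      ∃ ξ : DefAlg ν θ ≃ₐ[k] DefAlg ν θ,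
        (∀ j, ξ (DefAlg.gen ν θ (x j)) =
          (-1 : k) ^ (d + 1) • ∑ i, (P⁻¹).transpose i j • DefAlg.gen ν θ (x i) +
            algebraMap k (DefAlg ν θ) (l j)) ∧
        ExtEnvIsoTwist k (DefAlg ν θ) d ξ) := by
  obtain ⟨K⟩ := hKoszul.exists_koszulData
  have hV : FiniteDimensional k V := Module.Finite.of_basis x
  have hE : FiniteDimensional k (DualAlg R) := K.finite_dualAlg hGorenstein
  have hn : d = 0 → n = 0 := K.n_eq_zero hGorenstein x
  have hrank : Module.finrank k (DualAlg.piece R d) = 1 := by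
    rw [K.finrank_piece, K.b_top hGorenstein]
  refine ⟨?_, hU.exists_isDualCurvedDGA x, hrank, fun φ hφ => hφ.existsUnique_hasMatrix x, ?_,
    ?_, ?_⟩
  · have hb : K.b d = 1 := K.b_top hGorenstein
    let q : Fin (K.b d) := ⟨0, hb ▸ one_pos⟩
    have h0 : K.e d q ≠ 0 := fun h => by
      have h1 := congrFun (K.coord_e d q) q
      rw [h, map_zero, Pi.single_eq_same] at h1
      exact zero_ne_one h1
    obtain ⟨τ, hτ⟩ := K.exists_frobeniusTrace hGorenstein (K.e_mem d q) h0
    exact hτ.exists_isNakayamaAut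
  · intro ϖ hϖ h0
    obtain ⟨τ, hτ⟩ := K.exists_frobeniusTrace hGorenstein hϖ h0
    exact ⟨hτ.existsUnique_isDualBasisTo x hn,
      fun δ c hD w hw => hτ.existsUnique_smul x hn hw hD.degree⟩
  · intro i hi
    obtain ⟨⟨δ, c⟩, hD, -⟩ := hU.exists_isDualCurvedDGA x
    exact K.subsingleton_extEnv x hGorenstein hU hD hi
  · intro φ P δ c ϖ w l hφ hP hD hϖ h0 hw hl
    obtain ⟨τ, hτ⟩ := K.exists_frobeniusTrace hGorenstein hϖ h0
    obtain ⟨ξ, hξ⟩ := exists_nakayamaEquiv (ν := ν) (θ := θ) hτ hφ hP hD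
      (hτ.apply_derivation x hw hD.degree hl)
    refine ⟨hφ.isUnit_det hP, ξ, fun j => (hξ (x j)).trans (nakayamaGen_apply l j),
      K.extEnvIsoTwist x hGorenstein hU hD (fun hd s hs => ?_) ?_⟩
    · have hx : IsEmpty (Fin n) := by rw [hn hd]; infer_instance
      have hV0 : Subsingleton V := x.repr.toEquiv.subsingleton
      exact eq_zero_of_twistAug_eq_zero ξ hs
    · rintro m rfl s
      exact K.twistAug_eq_zero_iff hτ (K.b_top hGorenstein) hφ hP hw hl hξ s
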